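/- Let $M$ be a smooth finite-dimensional manifold. **Jets.** For a Lie groupoid $G\rightrightarrows M$ with source $\alpha$ and target $\beta$, let $\mathcal B^{(1)}(G)\rightrightarrows M$ be the Lie groupoid of 1-jets $j^1_xb$ of local bisections $b$ of $G$ (local sections of $\alpha$ with $\beta\circ b$ a local diffeomorphism), with product $j^1_{y}b'\cdot j^1_xb=j^1_x(b'\cdot b)$, $y=\beta(b(x))$. Put $p(j^1_xb)=b(x)$. Let $\mathcal B^{(1)}=GL(TM)$ be the groupoid of linear isomorphisms $\xi:T_xM\to T_yM$, i.e. of 1-jets of local diffeomorphisms of $M$; let $\mathcal B^{(1,1)}_{nh}=\mathcal B^{(1)}(\mathcal B^{(1)})$ and $\mathcal B^{(1,1,1)}_{nh}=\mathcal B^{(1)}(\mathcal B^{(1,1)}_{nh})$. On these, $p_*(j^1_xb)=j^1_x(p\circ b)$ (with $p$ read as $\beta$ on $\mathcal B^{(1)}$), and on $\mathcal B^{(1,1,1)}_{nh}$, $p_{**}(j^1_xb)=j^1_x(p_*\circ b)$. Let $\mathcal B^{(1,1)}=\{\zeta\in\mathcal B^{(1,1)}_{nh}: p(\zeta)=p_*(\zeta)\}$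 and $\mathcal B^{(1,1,1)}=\{\zeta\in\mathcal B^{(1,1,1)}_{nh} : p(\zeta)=p_*(\zeta)=p_{**}(\zeta)\in\mathcal B^{(1,1)}\}$. **Connection and affine jets.** Let $\mathfrak s:M\to\mathcal B^{(1,1)}$ be a symmetry jet: a smooth section of $\alpha$ with $p(\mathfrak s(x))=-I_x$ for all $x$. Let $\nabla$ be the associated affine connection, $(\nabla_XY)_x=\tfrac12[X,\,Y+s_x(Y)]_x$ where $\mathfrak s(x)=j^1_xs_x$; here, for a local bisection $b$ of $\mathcal B^{(1)}$, $bY$ denotes the transported vector field $(bY)_{\beta(b(x'))}=b(x')Y_{x'}$. A jet $j^1_xb\in\mathcal B^{(1,1)}$ is *affine* if $b(x)(\nabla_{X_x}Y)=\nabla_{b(x)X_x}(bY)$ for all vector fields $X,Y$ on $M$. A jet $\zeta\in\mathcal B^{(1,1,1)}$ can be written $\zeta=j^1_x\big(x'\mapsto j^1_{x'}b_{x'}\big)$ with $b_{x'}$ a smooth family of local bisections of $\mathcal B^{(1)}$ such that $b_{x'}(x')=b_x(x')$ and $j^1_{x'}(\beta\circ b_{x'})=b_{x'}(x')$ for $x'$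 near $x$. It is *affine* if $p(\zeta)$ is affine and, with $\xi=p(p(\zeta))$ its first order part, $$\xi\big(\nabla_{X_x}\nabla_YZ\big)=\nabla_{\xi X_x}\big(\nabla_{b_xY}\,b_{\bullet}Z\big)\qquad\text{for all vector fields }X,Y,Z\text{ on }M,$$ where $\nabla_{b_xY}b_\bullet Z$ is the local vector field whose value at $y'=\beta(b_x(x'))$ is $\nabla_{b_x(x')Y_{x'}}(b_{x'}Z)$. **Proposition.** There is a unique Lie groupoid morphism $S:\mathcal B^{(1)}\to\mathcal B^{(1,1)}$ over $\mathrm{id}_M$ with $p\circ S=\mathrm{id}$ and $S(-I_x)=\mathfrak s(x)$ for all $x\in M$. For $\xi\in\mathcal B^{(1)}$ with source $x$, write $S(\xi)=j^1_xa$ and put $\mathbb S(\xi)=j^1_x(S\circ a)$; equivalently, $\mathbb S(\xi)$ is the jet of local bisections whose plane is $S_{*\xi}(\mathcal D_\xi)$, where $\mathcal D_\xi=a_{*x}(T_xM)$. Then: 1. $\mathbb S$ takes its values in $\mathcal B^{(1,1,1)}$, it is a morphism of Lie groupoids $\mathcal B^{(1)}\to\mathcal B^{(1,1,1)}$, and it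 lifts $S$, that is, $p\circ\mathbb S=S$; 2. for every $\xi\in\mathcal B^{(1)}$, the jet $\mathbb S(\xi)$ is an affine $(1,1,1)$-jet; 3. for every $\xi\in\mathcal B^{(1)}$, $\mathbb S(\xi)$ is the unique affine $(1,1,1)$-jet whose first order part is $\xi$. -/

import Mathlib

open Bundle Set Filter
open scoped Manifold ContDiff Topology

noncomputable section

namespace AffineJets

/-! ## The manifold of 1-jets of maps from `M` to `G`

A 1-jet at `x` of a map `b : M → G` with `b x = g` is the triple `(x, g, L)` with
`L = b_{*x} : T_x M → T_g G`.  These triples form the total space of the smooth vector bundle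
`Hom (pr₁^* TM, pr₂^* TG)` over `M × G`. -/

section JetSpace

variable (E : Type*) [NormedAddCommGroup E] [NormedSpace ℝ E]
  (M : Type*) [TopologicalSpace M] [ChartedSpace E M]
  {F : Type*} [NormedAddCommGroup F] [NormedSpace ℝ F]
  {H : Type*} [TopologicalSpace H] (J : ModelWithCorners ℝ F H)
  (G : Type*) [TopologicalSpace G] [ChartedSpace H G]

/-- The pullback of `TM` to `M × G`. -/
def SrcBundle (q : M × G) : Type _ := TangentSpace 𝓘(ℝ, E) q.1

/-- The pullback of `TG` to `M × G`. -/
def TgtBundle (q : M × G) : Type _ := TangentSpace J q.2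

namespace SrcBundle
variable (q : M × G)
instance : AddCommGroup (SrcBundle E M G q) :=
  inferInstanceAs (AddCommGroup (TangentSpace 𝓘(ℝ, E) q.1))
instance : Module ℝ (SrcBundle E M G q) :=
  inferInstanceAs (Module ℝ (TangentSpace 𝓘(ℝ, E) q.1))
instance : TopologicalSpace (SrcBundle E M G q) :=
  inferInstanceAs (TopologicalSpace (TangentSpace 𝓘(ℝ, E) q.1))
variable [IsManifold 𝓘(ℝ, E) ∞ M] [IsManifold J ∞ G]
instance : TopologicalSpace (TotalSpace E (SrcBundle E M G)) := inferInstanceAs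
  (TopologicalSpace (TotalSpace E
    ((ContinuousMap.fst : C(M × G, M)) *ᵖ (TangentSpace 𝓘(ℝ, E) : M → Type _))))
instance : FiberBundle E (SrcBundle E M G) := inferInstanceAs
  (FiberBundle E ((ContinuousMap.fst : C(M × G, M)) *ᵖ (TangentSpace 𝓘(ℝ, E) : M → Type _)))
instance : VectorBundle ℝ E (SrcBundle E M G) := inferInstanceAs
  (VectorBundle ℝ E ((ContinuousMap.fst : C(M × G, M)) *ᵖ (TangentSpace 𝓘(ℝ, E) : M → Type _)))
instance : ContMDiffVectorBundle ∞ E (SrcBundle E M G) (𝓘(ℝ, E).prod J) := inferInstanceAs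
  (ContMDiffVectorBundle ∞ E ((ContMDiffMap.fst : C^∞⟮𝓘(ℝ, E).prod J, M × G; 𝓘(ℝ, E), M⟯) *ᵖ
    (TangentSpace 𝓘(ℝ, E) : M → Type _)) (𝓘(ℝ, E).prod J))
end SrcBundle

namespace TgtBundle
variable (q : M × G)
instance : AddCommGroup (TgtBundle M J G q) :=
  inferInstanceAs (AddCommGroup (TangentSpace J q.2))
instance : Module ℝ (TgtBundle M J G q) :=
  inferInstanceAs (Module ℝ (TangentSpace J q.2))
instance : TopologicalSpace (TgtBundle M J G q) :=
  inferInstanceAs (TopologicalSpace (TangentSpace J q.2))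
instance : IsTopologicalAddGroup (TgtBundle M J G q) :=
  inferInstanceAs (IsTopologicalAddGroup (TangentSpace J q.2))
instance : ContinuousSMul ℝ (TgtBundle M J G q) :=
  inferInstanceAs (ContinuousSMul ℝ (TangentSpace J q.2))
variable [IsManifold 𝓘(ℝ, E) ∞ M] [IsManifold J ∞ G]
instance : TopologicalSpace (TotalSpace F (TgtBundle M J G)) := inferInstanceAs
  (TopologicalSpace (TotalSpace F
    ((ContinuousMap.snd : C(M × G, G)) *ᵖ (TangentSpace J : G → Type _))))
instance : FiberBundle F (TgtBundle M J G) := inferInstanceAs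
  (FiberBundle F ((ContinuousMap.snd : C(M × G, G)) *ᵖ (TangentSpace J : G → Type _)))
instance : VectorBundle ℝ F (TgtBundle M J G) := inferInstanceAs
  (VectorBundle ℝ F ((ContinuousMap.snd : C(M × G, G)) *ᵖ (TangentSpace J : G → Type _)))
instance : ContMDiffVectorBundle ∞ F (TgtBundle M J G) (𝓘(ℝ, E).prod J) := inferInstanceAs
  (ContMDiffVectorBundle ∞ F ((ContMDiffMap.snd : C^∞⟮𝓘(ℝ, E).prod J, M × G; J, G⟯) *ᵖ
    (TangentSpace J : G → Type _)) (𝓘(ℝ, E).prod J))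
end TgtBundle

/-- The space `J¹(M, G)` of 1-jets `(x, g, L : T_x M → T_g G)`. -/
def JetSpace : Type _ :=
  TotalSpace (E →L[ℝ] F) (fun q : M × G => SrcBundle E M G q →L[ℝ] TgtBundle M J G q)

/-- The model of the manifold `J¹(M, G)`. -/
abbrev JetModel := (𝓘(ℝ, E).prod J).prod 𝓘(ℝ, E →L[ℝ] F)

namespace JetSpace

variable {E M J G} in
/-- The jet `(x, g, L)`. -/
def mk (x : M) (g : G) (L : TangentSpace 𝓘(ℝ, E) x →L[ℝ] TangentSpace J g) :
    JetSpace E M J G := TotalSpace.mk (x, g) L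

variable {E M J G} in
/-- The source `α(j_x^1 b) = x`. -/
def src (ζ : JetSpace E M J G) : M := ζ.proj.1

variable {E M J G} in
/-- The zeroth order part `p(j_x^1 b) = b(x)`. -/
def val (ζ : JetSpace E M J G) : G := ζ.proj.2

variable {E M J G} in
/-- The linear part `b_{*x}` of `j_x^1 b`. -/
def lin (ζ : JetSpace E M J G) : TangentSpace 𝓘(ℝ, E) ζ.src →L[ℝ] TangentSpace J ζ.val := ζ.snd

variable [IsManifold 𝓘(ℝ, E) ∞ M] [IsManifold J ∞ G]
instance : TopologicalSpace (JetSpace E M J G) := inferInstanceAs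
  (TopologicalSpace (TotalSpace (E →L[ℝ] F)
    (fun q : M × G => SrcBundle E M G q →L[ℝ] TgtBundle M J G q)))
instance : ChartedSpace (ModelProd (ModelProd E H) (E →L[ℝ] F)) (JetSpace E M J G) :=
  inferInstanceAs (ChartedSpace (ModelProd (ModelProd E H) (E →L[ℝ] F)) (TotalSpace (E →L[ℝ] F)
    (fun q : M × G => SrcBundle E M G q →L[ℝ] TgtBundle M J G q)))
instance : IsManifold (JetModel E J) ∞ (JetSpace E M J G) := inferInstanceAs
  (IsManifold (JetModel E J) ∞ (TotalSpace (E →L[ℝ] F)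
    (fun q : M × G => SrcBundle E M G q →L[ℝ] TgtBundle M J G q)))

end JetSpace

end JetSpace

section Jets

variable {E : Type*} [NormedAddCommGroup E] [NormedSpace ℝ E]
  {M : Type*} [TopologicalSpace M] [ChartedSpace E M]
  {F : Type*} [NormedAddCommGroup F] [NormedSpace ℝ F]
  {H : Type*} [TopologicalSpace H] (J : ModelWithCorners ℝ F H)
  {G : Type*} [TopologicalSpace G] [ChartedSpace H G]
  {F' : Type*} [NormedAddCommGroup F'] [NormedSpace ℝ F']
  {H' : Type*} [TopologicalSpace H'] (J' : ModelWithCorners ℝ F' H')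
  {G' : Type*} [TopologicalSpace G'] [ChartedSpace H' G']

/-- The jet `j_x^1 b`. -/
def jet1 (b : M → G) (x : M) : JetSpace E M J G := .mk x (b x) (mfderiv 𝓘(ℝ, E) J b x)

variable {J} in
/-- The map `j_x^1 b ↦ j_x^1 (f ∘ b)` induced by `f : G → G'`. -/
def JetSpace.map (f : G → G') (ζ : JetSpace E M J G) : JetSpace E M J' G' :=
  .mk ζ.src (f ζ.val) ((mfderiv J J' f ζ.val).comp ζ.lin)

theorem map_jet1 (f : G → G') (b : M → G) (x : M) (hb : MDifferentiableAt 𝓘(ℝ, E) J b x)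
    (hf : MDifferentiableAt J J' f (b x)) :
    (jet1 J b x : JetSpace E M J G).map J' f = jet1 J' (f ∘ b) x := by
  unfold JetSpace.map jet1
  rw [mfderiv_comp x hf hb]
  rfl

/-- The (set-theoretic) data of a groupoid over `M` whose arrows form a subset of `G`.
`IsMul g' g h` says that `g'` and `g` are composable and that `g' · g = h`. -/
structure GroupoidData (M G : Type*) where
  carrier : Set G
  src : G → M
  tgt : G → M
  IsMul : G → G → G → Prop

/-- `b` is a smooth local bisection, near `x`, of the groupoid `𝒢`: a smooth section of the source
map over a neighbourhood of `x` whose composition with the target map is a local diffeomorphism. -/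
def IsLocalBisectionAt (𝒢 : GroupoidData M G) (b : M → G) (x : M) : Prop :=
  (∃ U : Set M, IsOpen U ∧ x ∈ U ∧ ContMDiffOn 𝓘(ℝ, E) J ∞ b U ∧
    ∀ x' ∈ U, b x' ∈ 𝒢.carrier ∧ 𝒢.src (b x') = x') ∧
  IsLocalDiffeomorphAt 𝓘(ℝ, E) 𝓘(ℝ, E) ∞ (𝒢.tgt ∘ b) x

/-- The first jet extension `ℬ⁽¹⁾(𝒢)` of a groupoid: the 1-jets of local bisections of `𝒢`, with
`α(j_x^1 b) = x`, `β(j_x^1 b) = β(b(x))` and `j_y^1 b' · j_x^1 b = j_x^1 (b' · b)` for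
`y = β(b(x))`, where `(b' · b)(x') = b'(β(b(x'))) · b(x')`. -/
def GroupoidData.prolong (𝒢 : GroupoidData M G) : GroupoidData M (JetSpace E M J G) where
  carrier := {ζ | ∃ b : M → G, IsLocalBisectionAt (E := E) J 𝒢 b ζ.src ∧ jet1 J b ζ.src = ζ}
  src ζ := ζ.src
  tgt ζ := 𝒢.tgt ζ.val
  IsMul ζ' ζ η := ∃ (x : M) (b' b c : M → G),
    IsLocalBisectionAt (E := E) J 𝒢 b x ∧
    IsLocalBisectionAt (E := E) J 𝒢 b' (𝒢.tgt (b x)) ∧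
    (∀ᶠ x' in 𝓝 x, 𝒢.IsMul (b' (𝒢.tgt (b x'))) (b x') (c x')) ∧
    ζ = jet1 J b x ∧ ζ' = jet1 J b' (𝒢.tgt (b x)) ∧ η = jet1 J c x

/-- Smooth morphisms of groupoids over the identity of `M`. -/
structure IsLieGroupoidMorphism (𝒢 : GroupoidData M G) (𝒢' : GroupoidData M G')
    (Φ : G → G') : Prop where
  smooth : ContMDiffOn J J' ∞ Φ 𝒢.carrier
  mapsTo : ∀ g ∈ 𝒢.carrier, Φ g ∈ 𝒢'.carrier
  src_eq : ∀ g ∈ 𝒢.carrier, 𝒢'.src (Φ g) = 𝒢.src g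
  tgt_eq : ∀ g ∈ 𝒢.carrier, 𝒢'.tgt (Φ g) = 𝒢.tgt g
  map_mul : ∀ g' ∈ 𝒢.carrier, ∀ g ∈ 𝒢.carrier, ∀ h ∈ 𝒢.carrier,
    𝒢.IsMul g' g h → 𝒢'.IsMul (Φ g') (Φ g) (Φ h)

end Jets

/-! ## The groupoids of 1-jets, (1,1)-jets and (1,1,1)-jets of `M` -/

section Groupoids

variable (E : Type*) [NormedAddCommGroup E] [NormedSpace ℝ E]
  (M : Type*) [TopologicalSpace M] [ChartedSpace E M]

/-- `J¹(M, M)`. -/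
abbrev J1 := JetSpace E M 𝓘(ℝ, E) M

/-- The model of `J1`. -/
abbrev I1 := JetModel E 𝓘(ℝ, E)

/-- `ℬ⁽¹⁾(Pair M) = GL(TM)`: the linear isomorphisms `T_x M → T_y M`, under composition. -/
def GL1 : GroupoidData M (J1 E M) where
  carrier := {ξ | ξ.lin.IsInvertible}
  src ξ := ξ.src
  tgt ξ := ξ.val
  IsMul ξ' ξ η := ∃ (x y z : M) (A : TangentSpace 𝓘(ℝ, E) x →L[ℝ] TangentSpace 𝓘(ℝ, E) y)
    (B : TangentSpace 𝓘(ℝ, E) y →L[ℝ] TangentSpace 𝓘(ℝ, E) z),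
    ξ = .mk x y A ∧ ξ' = .mk y z B ∧ η = .mk x z (B.comp A)

variable [IsManifold 𝓘(ℝ, E) ∞ M]

/-- `J¹(M, J¹(M, M))`. -/
abbrev J2 := JetSpace E M (I1 E) (J1 E M)

/-- The model of `J2`. -/
abbrev I2 := JetModel E (I1 E)

/-- `J¹(M, J¹(M, J¹(M, M)))`. -/
abbrev J3 := JetSpace E M (I2 E) (J2 E M)

/-- The model of `J3`. -/
abbrev I3 := JetModel E (I2 E)

/-- The groupoid of all (non-holonomic) (1,1)-jets. -/
def NH2 : GroupoidData M (J2 E M) := (GL1 E M).prolong (I1 E)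

/-- The groupoid of all (non-holonomic) (1,1,1)-jets. -/
def NH3 : GroupoidData M (J3 E M) := (NH2 E M).prolong (I2 E)

variable {E M}

/-- `p_* : j_x^1 b ↦ j_x^1 (p ∘ b)` on (1,1)-jets. -/
def pStar₂ (ζ : J2 E M) : J1 E M := ζ.map 𝓘(ℝ, E) JetSpace.val

/-- `p_* : j_x^1 b ↦ j_x^1 (p ∘ b)` on (1,1,1)-jets. -/
def pStar₃ (ζ : J3 E M) : J2 E M := ζ.map (I1 E) JetSpace.val

/-- `p_** : j_x^1 b ↦ j_x^1 (p_* ∘ b)` on (1,1,1)-jets. -/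
def pStarStar (ζ : J3 E M) : J2 E M := ζ.map (I1 E) pStar₂

variable (E M) in
/-- The semi-holonomic (1,1)-jets: `p(ζ) = p_*(ζ)`. -/
def SH2 : Set (J2 E M) := {ζ | ζ ∈ (NH2 E M).carrier ∧ ζ.val = pStar₂ ζ}

variable (E M) in
/-- The semi-holonomic (1,1,1)-jets: `p(ζ) = p_*(ζ) = p_**(ζ)` is a semi-holonomic (1,1)-jet. -/
def SH3 : Set (J3 E M) :=
  {ζ | ζ ∈ (NH3 E M).carrier ∧ ζ.val = pStar₃ ζ ∧ pStar₃ ζ = pStarStar ζ ∧ ζ.val ∈ SH2 E M}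

/-- The 1-jet `-I_x`. -/
def negId (x : M) : J1 E M := .mk x x (-ContinuousLinearMap.id ℝ (TangentSpace 𝓘(ℝ, E) x))

/-- Symmetry jets: smooth sections of `α : SH2 → M` with first order part `-I`. -/
structure IsSymmetryJet (s : M → J2 E M) : Prop where
  smooth : ContMDiff 𝓘(ℝ, E) (I2 E) ∞ s
  mem : ∀ x, s x ∈ SH2 E M
  src_eq : ∀ x, (s x).src = x
  val_eq : ∀ x, (s x).val = negId x

end Groupoids

/-! ## The connection of a symmetry jet, and affine jets -/

section Affine

variable {E : Type*} [NormedAddCommGroup E] [NormedSpace ℝ E]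
  {M : Type*} [TopologicalSpace M] [ChartedSpace E M]

variable (E) in
/-- (Not necessarily continuous) vector fields on `M`. -/
abbrev VField (M : Type*) [TopologicalSpace M] [ChartedSpace E M] :=
  (x : M) → TangentSpace 𝓘(ℝ, E) x

/-- Smooth vector fields on `M`. -/
def VField.Smooth [IsManifold 𝓘(ℝ, E) ∞ M] (X : VField E M) : Prop :=
  ContMDiff 𝓘(ℝ, E) 𝓘(ℝ, E).tangent ∞ (fun x => (⟨x, X x⟩ : TangentBundle 𝓘(ℝ, E) M))

/-- The value `ξ X_{α(ξ)} ∈ T_{β(ξ)} M`. -/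
def act (ξ : J1 E M) (X : VField E M) : TangentSpace 𝓘(ℝ, E) ξ.val := ξ.lin (X ξ.src)

/-- For a local homeomorphism `f` near `x` and vectors `W x' ∈ T_{f(x')} M`, a vector field `V` such
that `V (f x') = W x'` for `x'` near `x`. Such a `V` exists and its germ at `f x` is unique; the
values of `V` away from `f x` are never used. -/
def fieldAlong (f : M → M) (x : M) (W : (x' : M) → TangentSpace 𝓘(ℝ, E) (f x')) : VField E M :=
  Classical.epsilon fun V : VField E M => ∀ᶠ x' in 𝓝 x, V (f x') = W x'

/-- The transport `bY` of a vector field by a local bisection `b` of `GL(TM)` near `x`, given near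
`β(b(x))` by `(bY)_{y'} = b(x') Y_{x'}` for `y' = β(b(x'))`. -/
def transport (b : M → J1 E M) (x : M) (Y : VField E M) : VField E M :=
  fieldAlong (fun x' => (b x').val) x (fun x' => act (b x') Y)

variable [IsManifold 𝓘(ℝ, E) ∞ M]

/-- A local bisection `b` of `GL(TM)` near `x = α(ζ)` such that `j_x^1 b = ζ`. -/
def representative (ζ : J2 E M) : M → J1 E M :=
  @Classical.epsilon _ ⟨fun _ => ζ.val⟩ fun b : M → J1 E M =>
    IsLocalBisectionAt (E := E) (I1 E) (GL1 E M) b ζ.src ∧ jet1 (I1 E) b ζ.src = ζ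

/-- The connection of the symmetry jet `s`: `∇_v Y = ½ [X, Y + s_x(Y)]_x`, where `X` is a vector
field extending `v ∈ T_x M` and `s_x` is a local bisection with `j_x^1 s_x = s(x)`. -/
def cov (s : M → J2 E M) (x : M) (v : TangentSpace 𝓘(ℝ, E) x) (Y : VField E M) :
    TangentSpace 𝓘(ℝ, E) x :=
  (1 / 2 : ℝ) • VectorField.mlieBracket 𝓘(ℝ, E) (FiberBundle.extend E v)
    (Y + transport (representative (s x)) x Y) x

/-- The vector field `∇_X Y`. -/
def nabla (s : M → J2 E M) (X Y : VField E M) : VField E M := fun x => cov s x (X x) Y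

/-- Affine (1,1)-jets: the semi-holonomic jets `ζ = j_x^1 b` such that
`b(x) (∇_{X_x} Y) = ∇_{b(x) X_x} (bY)` for all vector fields `X`, `Y`. -/
def IsAffine₂ (s : M → J2 E M) (ζ : J2 E M) : Prop :=
  ζ ∈ SH2 E M ∧ ∃ b : M → J1 E M,
    IsLocalBisectionAt (E := E) (I1 E) (GL1 E M) b ζ.src ∧ jet1 (I1 E) b ζ.src = ζ ∧
    ∀ X Y : VField E M, X.Smooth → Y.Smooth →
      act ζ.val (nabla s X Y) = cov s ζ.val.val (act ζ.val X) (transport b ζ.src Y)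

/-- A smooth two-parameter family `b x' x'' : T_{x''} M → T M` (for `x'`, `x''` near `x`)
of linear isomorphisms with `ζ = j_x^1 (x' ↦ j_{x'}^1 b_{x'})`, normalized by
`b_{x'}(x') = b_x(x')` and `j_{x'}^1 (β ∘ b_{x'}) = b_{x'}(x')` for `x'` near `x`. -/
structure IsFamily (b : M → M → J1 E M) (ζ : J3 E M) : Prop where
  smooth : ∃ U : Set (M × M), IsOpen U ∧ (ζ.src, ζ.src) ∈ U ∧
    ContMDiffOn (𝓘(ℝ, E).prod 𝓘(ℝ, E)) (I1 E) ∞ (fun q : M × M => b q.1 q.2) U ∧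
    ∀ q ∈ U, b q.1 q.2 ∈ (GL1 E M).carrier ∧ (b q.1 q.2).src = q.2
  jet_eq : jet1 (I2 E) (fun x' => (jet1 (I1 E) (b x') x' : J2 E M)) ζ.src = ζ
  diag : ∀ᶠ x' in 𝓝 ζ.src, b x' x' = b ζ.src x'
  holonomic : ∀ᶠ x' in 𝓝 ζ.src, jet1 𝓘(ℝ, E) (fun x'' => (b x' x'').val) x' = b x' x'

/-- Affine (1,1,1)-jets: the semi-holonomic jets `ζ = j_x^1 (x' ↦ j_{x'}^1 b_{x'})` with first order
part `ξ` whose (1,1)-part is affine and such that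
`ξ (∇_{X_x} ∇_Y Z) = ∇_{ξ X_x} (∇_{b_x Y} b.Z)` for all vector fields `X`, `Y`, `Z`. Here
`∇_{b_x Y} b.Z` is the vector field near `β(ξ)` whose value at `y' = β(b_x(x'))` is the derivative
of the transported field `b_{x'} Z` in the direction `b_x(x') Y_{x'} ∈ T_{y'} M`. -/
def IsAffine₃ (s : M → J2 E M) (ζ : J3 E M) : Prop :=
  ζ ∈ SH3 E M ∧ IsAffine₂ s ζ.val ∧ ∃ b : M → M → J1 E M, IsFamily b ζ ∧
    ∀ X Y Z : VField E M, X.Smooth → Y.Smooth → Z.Smooth →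
      act ζ.val.val (nabla s X (nabla s Y Z)) =
        cov s ζ.val.val.val (act ζ.val.val X)
          (fieldAlong (fun x' => (b ζ.src x').val) ζ.src
            (fun x' => cov s (b ζ.src x').val (act (b ζ.src x') Y) (transport (b x') x' Z)))

/-- `S` is the affine extension of the symmetry jet `s`: a smooth groupoid morphism from 1-jets to
semi-holonomic (1,1)-jets that is a section of `p` and satisfies `S ∘ (-I) = s`. -/
structure IsAffineExtension (s : M → J2 E M) (S : J1 E M → J2 E M) : Prop where
  morphism : IsLieGroupoidMorphism (I1 E) (I2 E) (GL1 E M) (NH2 E M) S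
  mem : ∀ ξ ∈ (GL1 E M).carrier, S ξ ∈ SH2 E M
  val_eq : ∀ ξ ∈ (GL1 E M).carrier, (S ξ).val = ξ
  negId_eq : ∀ x, S (negId x) = s x

/-- The jet `𝕊(ξ) = j_x^1 (S ∘ a)`, where `a` is any local bisection with `j_x^1 a = S(ξ)`. Its
linear part is `S_{*ξ} ∘ a_{*x}`, so that its image is the plane `S_{*ξ}(𝒟_ξ)`, where
`𝒟_ξ = a_{*x}(T_x M)` is the plane of `S(ξ)`. -/
def thirdExtension (S : J1 E M → J2 E M) (ξ : J1 E M) : J3 E M := (S ξ).map (I2 E) S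

end Affine

end AffineJets

end

open AffineJets

open Bundle Set Filter
open scoped Manifold ContDiff Topology

noncomputable section

set_option linter.unusedSectionVars false

/-! In charts around source and target, a semi-holonomic (1,1)-jet over a 1-jet with linear part A
has a single free component, a bilinear map B (`secondPart`): the source component is the identity
because the bisection is a section of the source map, and the target component is A by semi-holonomy
(`SH2_ext`, `ofSecondPart`). For the symmetry jet, -B/2 is the Christoffel form Γ of ∇
(`dchart_cov`). Differentiating a transported field gives, in charts, ∇_{AX}(bY) - A ∇_X Y = B(X,Y)
- (A Γ(X,Y) - Γ(AX,AY)) (`dchart_cov_transport`). Hence a jet is affine exactly when B equals the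
bracketed form `affForm`, and over each ξ there is exactly one affine (1,1)-jet, `affineExtension s
ξ`. This is S(ξ).

The second part of a product is B'(A·,A·) + A'B (`secondPart_mulJet`). Since `affForm` is a source
term minus a target term, the middle terms of a product cancel and S is a morphism; at A = -I it
returns the second part of s. Conversely, -I commutes with ξ, so every affine extension satisfies
S(ξ)·s(x) = s(y)·S(ξ). Comparing second parts leaves an equation for 2B, which forces `affForm`
(`IsAffineExtension.eqOn`).

The jet 𝕊(ξ) is the jet of S ∘ b for any bisection b with j¹b = S(ξ). Its product, lifting and
semi-holonomy properties are obtained by applying those of S at all points near the source.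

For affineness, let δ(x') (`affDefect`) be the amount by which the second part of j¹b_{x'} at x'
differs from `affForm`. The (1,1)-part is affine iff δ(x) = 0, and in that case the two sides of the
third order identity differ in charts by (Dδ)(X)(Y)(Z) (`act_nabla_nabla_eq_iff`). So the identity
says Dδ = 0. Since j¹b_{x'} differs from S(b_x(x')) only by δ(x'), the vanishing of δ and Dδ at x
makes the jet equal to 𝕊(ξ) (`jet1_eq_thirdExtension`), which is uniqueness. For existence,
`affineFamily` is a family representing 𝕊(ξ) with δ identically zero near x. -/

namespace AffineJets

/-! ### Explicit charts of the jet bundle -/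

section Charts

variable {E : Type*} [NormedAddCommGroup E] [NormedSpace ℝ E]
  {M : Type*} [TopologicalSpace M] [ChartedSpace E M]
  {F : Type*} [NormedAddCommGroup F] [NormedSpace ℝ F]
  {H : Type*} [TopologicalSpace H] (J : ModelWithCorners ℝ F H)
  {G : Type*} [TopologicalSpace G] [ChartedSpace H G]

/-- The derivative at `g` of the chart centred at `g₀`. -/
def dchart (g₀ g : G) : TangentSpace J g →L[ℝ] F := mfderiv J 𝓘(ℝ, F) (extChartAt J g₀) g

variable [IsManifold J ∞ G] [IsManifold 𝓘(ℝ, E) ∞ M]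

theorem dchart_isInvertible {g₀ g : G} (h : g ∈ (chartAt H g₀).source) :
    (dchart J g₀ g).IsInvertible := by
  have : IsManifold J 1 G := .of_le (n := ∞) (by simp)
  exact isInvertible_mfderiv_extChartAt (by simpa using h)

/-- The trivializations of the pulled back bundles agree definitionally with those of TM and TG. The
latter are chart derivatives, and over the base set `symmL` is the inverse of
`continuousLinearMapAt`. -/
theorem inCoordinates_eq_dchart {x₀ x : M} {g₀ g : G} (hx : x ∈ (chartAt E x₀).source)
    (hg : g ∈ (chartAt H g₀).source) (L : TangentSpace 𝓘(ℝ, E) x →L[ℝ] TangentSpace J g) :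
    ContinuousLinearMap.inCoordinates E (SrcBundle E M G) F (TgtBundle M J G) (x₀, g₀) (x, g)
      (x₀, g₀) (x, g) L = dchart J g₀ g ∘L L ∘L (dchart 𝓘(ℝ, E) x₀ x).inverse := by
  have : IsManifold J 1 G := .of_le (n := ∞) (by simp)
  have : IsManifold 𝓘(ℝ, E) 1 M := .of_le (n := ∞) (by simp)
  have h1 : (trivializationAt F (TgtBundle M J G) (x₀, g₀)).continuousLinearMapAt ℝ (x, g) =
      (trivializationAt F (TangentSpace J : G → Type _) g₀).continuousLinearMapAt ℝ g := by
    ext v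
    rfl
  have h2 : (trivializationAt E (SrcBundle E M G) (x₀, g₀)).continuousLinearMapAt ℝ (x, g) =
      (trivializationAt E (TangentSpace 𝓘(ℝ, E) : M → Type _) x₀).continuousLinearMapAt ℝ x := by
    ext v
    rfl
  have hb : (x, g) ∈ (trivializationAt E (SrcBundle E M G) (x₀, g₀)).baseSet := hx
  have h3 : (trivializationAt E (SrcBundle E M G) (x₀, g₀)).symmL ℝ (x, g) =
      ((trivializationAt E (SrcBundle E M G) (x₀, g₀)).continuousLinearMapAt ℝ (x, g)).inverse := by
    have h4 : (trivializationAt E (SrcBundle E M G) (x₀, g₀)).continuousLinearMapAt ℝ (x, g) =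
        (trivializationAt E (SrcBundle E M G) (x₀, g₀)).continuousLinearEquivAt ℝ (x, g) hb := by
      ext v
      rw [ContinuousLinearEquiv.coe_coe, Trivialization.coe_continuousLinearEquivAt_eq]
    rw [h4, ContinuousLinearMap.inverse_equiv]
    ext v
    rw [ContinuousLinearEquiv.coe_coe, Trivialization.symm_continuousLinearEquivAt_eq]
  unfold ContinuousLinearMap.inCoordinates
  rw [h3, h1, h2, TangentBundle.continuousLinearMapAt_trivializationAt hx,
    TangentBundle.continuousLinearMapAt_trivializationAt hg]
  rfl

theorem jetSpace_chartAt_source (ζ₀ : JetSpace E M J G) :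
    (chartAt (ModelProd (ModelProd E H) (E →L[ℝ] F)) ζ₀).source =
      {ζ | ζ.src ∈ (chartAt E ζ₀.src).source ∧ ζ.val ∈ (chartAt H ζ₀.val).source} := by
  have h := FiberBundle.chartedSpace_chartAt (HB := ModelProd E H) (F := E →L[ℝ] F)
    (E := fun q : M × G => SrcBundle E M G q →L[ℝ] TgtBundle M J G q) ζ₀
  have h' := congrArg (fun e => e.source) h
  refine h'.trans ?_
  ext ζ
  rw [OpenPartialHomeomorph.trans_source, OpenPartialHomeomorph.prod_source, mem_inter_iff,
    Trivialization.source_eq, mem_preimage, mem_preimage, hom_trivializationAt_baseSet]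
  simp only [OpenPartialHomeomorph.refl_source, prodChartedSpace_chartAt,
    OpenPartialHomeomorph.prod_source]
  exact ⟨fun h => ⟨h.2.1.1, h.2.1.2⟩, fun h => ⟨⟨h.1, h.2⟩, ⟨h.1, h.2⟩, trivial⟩⟩

/-- This turns questions about jets into calculus in vector spaces: a chart of the jet space records
the two base points and the linear part conjugated by chart derivatives. -/
theorem jetSpace_extChartAt_apply {ζ₀ ζ : JetSpace E M J G}
    (hx : ζ.src ∈ (chartAt E ζ₀.src).source) (hg : ζ.val ∈ (chartAt H ζ₀.val).source) :
    extChartAt (JetModel E J) ζ₀ ζ =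
      ((extChartAt 𝓘(ℝ, E) ζ₀.src ζ.src, extChartAt J ζ₀.val ζ.val),
        dchart J ζ₀.val ζ.val ∘L ζ.lin ∘L (dchart 𝓘(ℝ, E) ζ₀.src ζ.src).inverse) := by
  have h := hom_chart (HB := ModelProd E H) (F₁ := E) (F₂ := F) (E₁ := SrcBundle E M G)
    (E₂ := TgtBundle M J G) ζ₀ ζ
  rw [← inCoordinates_eq_dchart J hx hg]
  exact congrArg (JetModel E J) h


theorem mem_jetSpace_extChartAt_source {ζ₀ ζ : JetSpace E M J G} :
    ζ ∈ (extChartAt (JetModel E J) ζ₀).source ↔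
      ζ.src ∈ (extChartAt 𝓘(ℝ, E) ζ₀.src).source ∧ ζ.val ∈ (extChartAt J ζ₀.val).source := by
  rw [extChartAt_source, extChartAt_source, extChartAt_source, jetSpace_chartAt_source]
  rfl

end Charts

/-! ### Smoothness and derivatives of extended charts -/

section Local

variable {F : Type*} [NormedAddCommGroup F] [NormedSpace ℝ F]
  {H : Type*} [TopologicalSpace H] {J : ModelWithCorners ℝ F H}
  {G : Type*} [TopologicalSpace G] [ChartedSpace H G] [IsManifold J ∞ G]
  {F' : Type*} [NormedAddCommGroup F'] [NormedSpace ℝ F']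
  {H' : Type*} [TopologicalSpace H'] {J' : ModelWithCorners ℝ F' H'}
  {G' : Type*} [TopologicalSpace G'] [ChartedSpace H' G'] [IsManifold J' ∞ G']

theorem contMDiffAt_extChartAt_of_mem {g₀ g : G} (h : g ∈ (extChartAt J g₀).source) :
    ContMDiffAt J 𝓘(ℝ, F) ∞ (extChartAt J g₀) g :=
  contMDiffAt_extChartAt' (by simpa using h)

theorem mdifferentiableAt_extChartAt_of_mem {g₀ g : G} (h : g ∈ (extChartAt J g₀).source) :
    MDifferentiableAt J 𝓘(ℝ, F) (extChartAt J g₀) g :=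
  (contMDiffAt_extChartAt_of_mem h).mdifferentiableAt (by simp)

theorem eventually_mem_extChartAt_source {g₀ g : G} (h : g ∈ (extChartAt J g₀).source) :
    ∀ᶠ g' in 𝓝 g, g' ∈ (extChartAt J g₀).source :=
  (isOpen_extChartAt_source g₀).mem_nhds h

variable [J.Boundaryless]

theorem contMDiffAt_extChartAt_symm {g₀ : G} {y : F} (h : y ∈ (extChartAt J g₀).target) :
    ContMDiffAt 𝓘(ℝ, F) J ∞ (extChartAt J g₀).symm y :=
  (contMDiffOn_extChartAt_symm g₀).contMDiffAt ((isOpen_extChartAt_target g₀).mem_nhds h)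

theorem mdifferentiableAt_extChartAt_symm {g₀ : G} {y : F} (h : y ∈ (extChartAt J g₀).target) :
    MDifferentiableAt 𝓘(ℝ, F) J (extChartAt J g₀).symm y :=
  (contMDiffAt_extChartAt_symm h).mdifferentiableAt (by simp)

theorem eventually_mem_extChartAt_target {g₀ : G} {y : F} (h : y ∈ (extChartAt J g₀).target) :
    ∀ᶠ y' in 𝓝 y, y' ∈ (extChartAt J g₀).target :=
  (isOpen_extChartAt_target g₀).mem_nhds h

theorem dchart_comp_mfderiv_symm {g₀ : G} {y : F}
    (h : y ∈ (extChartAt J g₀).target) :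
    dchart J g₀ ((extChartAt J g₀).symm y) ∘L mfderiv 𝓘(ℝ, F) J (extChartAt J g₀).symm y =
      ContinuousLinearMap.id ℝ F := by
  have : IsManifold J 1 G := .of_le (n := ∞) (by simp)
  have := mfderiv_extChartAt_comp_mfderivWithin_extChartAt_symm (I := J) (x := g₀) h
  rwa [ModelWithCorners.range_eq_univ, mfderivWithin_univ] at this

theorem mfderiv_symm_eq {g₀ : G} {y : F} (h : y ∈ (extChartAt J g₀).target) :
    mfderiv 𝓘(ℝ, F) J (extChartAt J g₀).symm y =
      (dchart J g₀ ((extChartAt J g₀).symm y)).inverse := by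
  have hi : (dchart J g₀ ((extChartAt J g₀).symm y)).IsInvertible :=
    dchart_isInvertible J (by simpa using (extChartAt J g₀).map_target h)
  obtain ⟨e, he⟩ := hi
  have := dchart_comp_mfderiv_symm h
  rw [← he] at this ⊢
  rw [ContinuousLinearMap.inverse_equiv]
  ext v
  apply e.injective
  have h1 : e (mfderiv 𝓘(ℝ, F) J (extChartAt J g₀).symm y v) = v :=
    congrArg (fun L : F →L[ℝ] F => L v) this
  exact h1.trans (e.apply_symm_apply v).symm

end Local

/-! ### Maps read in charts -/

section InCharts

variable {F : Type*} [NormedAddCommGroup F] [NormedSpace ℝ F]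
  {H : Type*} [TopologicalSpace H] (J : ModelWithCorners ℝ F H)
  {G : Type*} [TopologicalSpace G] [ChartedSpace H G] [IsManifold J ∞ G]
  {F' : Type*} [NormedAddCommGroup F'] [NormedSpace ℝ F']
  {H' : Type*} [TopologicalSpace H'] (J' : ModelWithCorners ℝ F' H')
  {G' : Type*} [TopologicalSpace G'] [ChartedSpace H' G'] [IsManifold J' ∞ G']

/-- The map `f` read in the charts centred at `g₀` and `g₀'`. -/
def inCharts (g₀ : G) (g₀' : G') (f : G → G') : F → F' :=
  extChartAt J' g₀' ∘ f ∘ (extChartAt J g₀).symm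

variable {J J'} {g₀ g : G} {g₀' : G'} {f f₁ : G → G'}

theorem inCharts_apply (hg : g ∈ (extChartAt J g₀).source) :
    inCharts J J' g₀ g₀' f (extChartAt J g₀ g) = extChartAt J' g₀' (f g) := by
  simp only [inCharts, Function.comp_apply, (extChartAt J g₀).left_inv hg]

theorem eventually_extChartAt_symm {p : G → Prop} (hg : g ∈ (extChartAt J g₀).source)
    (h : ∀ᶠ g' in 𝓝 g, p g') :
    ∀ᶠ y in 𝓝 (extChartAt J g₀ g), p ((extChartAt J g₀).symm y) := by
  have hc : ContinuousAt (extChartAt J g₀).symm (extChartAt J g₀ g) :=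
    continuousAt_extChartAt_symm' hg
  rw [ContinuousAt, (extChartAt J g₀).left_inv hg] at hc
  exact hc.eventually h

variable [J.Boundaryless] [J'.Boundaryless]

theorem contDiffAt_inCharts (hg : g ∈ (extChartAt J g₀).source)
    (hg' : f g ∈ (extChartAt J' g₀').source) (hf : ContMDiffAt J J' ∞ f g) :
    ContDiffAt ℝ ∞ (inCharts J J' g₀ g₀' f) (extChartAt J g₀ g) := by
  rw [← contMDiffAt_iff_contDiffAt]
  have h1 := contMDiffAt_extChartAt_symm ((extChartAt J g₀).map_source hg)
  have h2 := contMDiffAt_extChartAt_of_mem hg'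
  refine ContMDiffAt.comp (I' := J') _ ?_ (ContMDiffAt.comp (I' := J) _ ?_ h1)
  · rwa [Function.comp_apply, (extChartAt J g₀).left_inv hg]
  · rwa [(extChartAt J g₀).left_inv hg]

theorem hasMFDerivAt_inCharts (hg : g ∈ (extChartAt J g₀).source)
    (hg' : f g ∈ (extChartAt J' g₀').source) (hf : MDifferentiableAt J J' f g) :
    HasFDerivAt (inCharts J J' g₀ g₀' f)
      (dchart J' g₀' (f g) ∘L mfderiv J J' f g ∘L (dchart J g₀ g).inverse)
      (extChartAt J g₀ g) := by
  obtain ⟨y, ht, rfl⟩ : ∃ y ∈ (extChartAt J g₀).target, (extChartAt J g₀).symm y = g :=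
    ⟨_, (extChartAt J g₀).map_source hg, (extChartAt J g₀).left_inv hg⟩
  rw [(extChartAt J g₀).right_inv ht]
  have h1 := (mdifferentiableAt_extChartAt_symm ht).hasMFDerivAt
  have h2 := (mdifferentiableAt_extChartAt_of_mem hg').hasMFDerivAt
  rw [mfderiv_symm_eq ht] at h1
  have h3 := HasMFDerivAt.comp y hf.hasMFDerivAt h1
  have h4 := HasMFDerivAt.comp (g := extChartAt J' g₀') (f := f ∘ (extChartAt J g₀).symm) y h2 h3
  exact hasMFDerivAt_iff_hasFDerivAt.1 h4

/-- The derivative of a map read in charts. -/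
theorem fderiv_inCharts (hg : g ∈ (extChartAt J g₀).source)
    (hg' : f g ∈ (extChartAt J' g₀').source) (hf : MDifferentiableAt J J' f g) :
    fderiv ℝ (inCharts J J' g₀ g₀' f) (extChartAt J g₀ g) =
      dchart J' g₀' (f g) ∘L mfderiv J J' f g ∘L (dchart J g₀ g).inverse :=
  (hasMFDerivAt_inCharts hg hg' hf).fderiv

theorem eventually_mdifferentiableAt (hf : ContMDiffAt J J' ∞ f g) :
    ∀ᶠ x in 𝓝 g, MDifferentiableAt J J' f x := by
  have : IsManifold J 1 G := .of_le (n := ∞) (by simp)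
  have : IsManifold J' 1 G' := .of_le (n := ∞) (by simp)
  have h := (contMDiffAt_iff_contMDiffAt_nhds (by simp)).1
    (hf.of_le (show (1 : ℕ∞ω) ≤ ∞ by simp))
  filter_upwards [h] with x hx using hx.mdifferentiableAt (by simp)

end InCharts

/-! ### Coordinates and smooth maps on jet spaces -/

section JetCoordinates

variable {E : Type*} [NormedAddCommGroup E] [NormedSpace ℝ E]
  {M : Type*} [TopologicalSpace M] [ChartedSpace E M] [IsManifold 𝓘(ℝ, E) ∞ M]
  {F : Type*} [NormedAddCommGroup F] [NormedSpace ℝ F]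
  {H : Type*} [TopologicalSpace H] {J : ModelWithCorners ℝ F H}
  {G : Type*} [TopologicalSpace G] [ChartedSpace H G] [IsManifold J ∞ G]
  {F' : Type*} [NormedAddCommGroup F'] [NormedSpace ℝ F']
  {H' : Type*} [TopologicalSpace H'] {J' : ModelWithCorners ℝ F' H'}
  {G' : Type*} [TopologicalSpace G'] [ChartedSpace H' G'] [IsManifold J' ∞ G']

/-- The linear part of a jet, read in the charts centred at `x₀` and `g₀`. -/
def jetLin (x₀ : M) (g₀ : G) (ζ : JetSpace E M J G) : E →L[ℝ] F :=
  dchart J g₀ ζ.val ∘L ζ.lin ∘L (dchart 𝓘(ℝ, E) x₀ ζ.src).inverse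

variable (E J) in
/-- The chart of the jet space induced by the charts centred at `x₀` and `g₀`. -/
abbrev jetChart (x₀ : M) (g₀ : G) : PartialEquiv (JetSpace E M J G) ((E × F) × (E →L[ℝ] F)) :=
  extChartAt (JetModel E J) (JetSpace.mk x₀ g₀ 0 : JetSpace E M J G)

variable {x₀ x : M} {g₀ g : G} {g₀' : G'} {ζ ζ' : JetSpace E M J G}

theorem mem_jetChart_source : ζ ∈ (jetChart E J x₀ g₀).source ↔
    ζ.src ∈ (extChartAt 𝓘(ℝ, E) x₀).source ∧ ζ.val ∈ (extChartAt J g₀).source :=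
  mem_jetSpace_extChartAt_source J

theorem jetChart_apply (h : ζ ∈ (jetChart E J x₀ g₀).source) :
    jetChart E J x₀ g₀ ζ =
      ((extChartAt 𝓘(ℝ, E) x₀ ζ.src, extChartAt J g₀ ζ.val), jetLin x₀ g₀ ζ) := by
  rw [mem_jetChart_source, extChartAt_source, extChartAt_source] at h
  exact jetSpace_extChartAt_apply J (ζ₀ := JetSpace.mk x₀ g₀ 0) h.1 h.2

theorem mem_jetChart_target {p : (E × F) × (E →L[ℝ] F)} : p ∈ (jetChart E J x₀ g₀).target ↔
    p.1.1 ∈ (extChartAt 𝓘(ℝ, E) x₀).target ∧ p.1.2 ∈ (extChartAt J g₀).target := by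
  have h := FiberBundle.extChartAt_target (IB := 𝓘(ℝ, E).prod J) (F := E →L[ℝ] F)
    (E := fun q : M × G => SrcBundle E M G q →L[ℝ] TgtBundle M J G q) (TotalSpace.mk (x₀, g₀) 0)
  have h' : p ∈ (jetChart E J x₀ g₀).target ↔ _ := Set.ext_iff.1 h p
  rw [h', hom_trivializationAt_baseSet]
  have e1 : (extChartAt (𝓘(ℝ, E).prod J) (x₀, g₀)) = (extChartAt 𝓘(ℝ, E) x₀).prod
    (extChartAt J g₀) := extChartAt_prod _
  simp only [e1]
  constructor
  · rintro ⟨⟨h1, h2⟩, h3⟩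
    exact h1
  · rintro ⟨h1, h2⟩
    have h3 := (extChartAt 𝓘(ℝ, E) x₀).map_target h1
    have h4 := (extChartAt J g₀).map_target h2
    rw [extChartAt_source] at h3 h4
    exact ⟨⟨⟨h1, h2⟩, ⟨h3, h4⟩⟩, trivial⟩

/-- Injectivity of the chart. Comparing linear parts in coordinates avoids an equality between maps
of different tangent spaces. -/
theorem jet_ext (h : ζ ∈ (jetChart E J x₀ g₀).source) (hs : ζ.src = ζ'.src) (hv : ζ.val = ζ'.val)
    (hl : jetLin x₀ g₀ ζ = jetLin x₀ g₀ ζ') : ζ = ζ' := by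
  have h' : ζ' ∈ (jetChart E J x₀ g₀).source := by
    rw [mem_jetChart_source] at h ⊢
    rwa [← hs, ← hv]
  refine (jetChart E J x₀ g₀).injOn h h' ?_
  rw [jetChart_apply h, jetChart_apply h', hs, hv, hl]

theorem jetChart_symm_src {p : (E × F) × (E →L[ℝ] F)}
    (hp : p ∈ (jetChart E J x₀ g₀).target) :
    ((jetChart E J x₀ g₀).symm p).src = (extChartAt 𝓘(ℝ, E) x₀).symm p.1.1 := by
  have h := (jetChart E J x₀ g₀).map_target hp
  have h1 := (jetChart E J x₀ g₀).right_inv hp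
  rw [jetChart_apply h] at h1
  rw [← congrArg (fun q => q.1.1) h1]
  exact ((extChartAt 𝓘(ℝ, E) x₀).left_inv (mem_jetChart_source.1 h).1).symm

theorem jetChart_symm_val {p : (E × F) × (E →L[ℝ] F)}
    (hp : p ∈ (jetChart E J x₀ g₀).target) :
    ((jetChart E J x₀ g₀).symm p).val = (extChartAt J g₀).symm p.1.2 := by
  have h := (jetChart E J x₀ g₀).map_target hp
  have h1 := (jetChart E J x₀ g₀).right_inv hp
  rw [jetChart_apply h] at h1
  rw [← congrArg (fun q => q.1.2) h1]
  exact ((extChartAt J g₀).left_inv (mem_jetChart_source.1 h).2).symm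

theorem jetLin_jetChart_symm {p : (E × F) × (E →L[ℝ] F)}
    (hp : p ∈ (jetChart E J x₀ g₀).target) :
    jetLin x₀ g₀ ((jetChart E J x₀ g₀).symm p) = p.2 := by
  have h := (jetChart E J x₀ g₀).map_target hp
  have h1 := (jetChart E J x₀ g₀).right_inv hp
  rw [jetChart_apply h] at h1
  exact congrArg Prod.snd h1

theorem contMDiff_src : ContMDiff (JetModel E J) 𝓘(ℝ, E) ∞ (JetSpace.src : JetSpace E M J G → M) :=
  contMDiff_fst.comp (contMDiff_proj (F := E →L[ℝ] F) (IB := 𝓘(ℝ, E).prod J)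
    (E := fun q : M × G => SrcBundle E M G q →L[ℝ] TgtBundle M J G q))

theorem contMDiff_val : ContMDiff (JetModel E J) J ∞ (JetSpace.val : JetSpace E M J G → G) :=
  contMDiff_snd.comp (contMDiff_proj (F := E →L[ℝ] F) (IB := 𝓘(ℝ, E).prod J)
    (E := fun q : M × G => SrcBundle E M G q →L[ℝ] TgtBundle M J G q))

variable [J.Boundaryless] [J'.Boundaryless]

theorem jetLin_jet1 {b : M → G} (hx : x ∈ (extChartAt 𝓘(ℝ, E) x₀).source)
    (hb : b x ∈ (extChartAt J g₀).source) (hd : MDifferentiableAt 𝓘(ℝ, E) J b x) :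
    jetLin x₀ g₀ (jet1 J b x) = fderiv ℝ (inCharts 𝓘(ℝ, E) J x₀ g₀ b) (extChartAt 𝓘(ℝ, E) x₀ x) :=
  (fderiv_inCharts hx hb hd).symm

/-- The chain rule; the chart derivative at the intermediate point cancels against its inverse. -/
theorem jetLin_map {f : G → G'} (h : ζ.val ∈ (extChartAt J g₀).source)
    (hf' : f ζ.val ∈ (extChartAt J' g₀').source) (hf : MDifferentiableAt J J' f ζ.val) :
    jetLin x₀ g₀' (ζ.map J' f) =
      fderiv ℝ (inCharts J J' g₀ g₀' f) (extChartAt J g₀ ζ.val) ∘L jetLin x₀ g₀ ζ := by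
  rw [fderiv_inCharts h hf' hf]
  ext v
  have hi : (dchart J g₀ ζ.val).IsInvertible :=
      dchart_isInvertible J (by rwa [← extChartAt_source (I := J)])
  simp only [jetLin, ContinuousLinearMap.comp_apply, hi.inverse_apply_self]
  rfl

section Into

variable {F₁ : Type*} [NormedAddCommGroup F₁] [NormedSpace ℝ F₁]
  {H₁ : Type*} [TopologicalSpace H₁] {J₁ : ModelWithCorners ℝ F₁ H₁}
  {N : Type*} [TopologicalSpace N] [ChartedSpace H₁ N] {n : ℕ∞ω} {m : N}

theorem contMDiffAt_jetLin (h : ζ ∈ (jetChart E J x₀ g₀).source) :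
    ContMDiffAt (JetModel E J) 𝓘(ℝ, E →L[ℝ] F) ∞ (jetLin x₀ g₀ : JetSpace E M J G → E →L[ℝ] F)
      ζ := by
  have h1 := contMDiffAt_extChartAt_of_mem h
  have h2 : ContMDiffAt (JetModel E J) 𝓘(ℝ, E →L[ℝ] F) ∞
      (fun ζ' => (jetChart E J x₀ g₀ ζ').2) ζ :=
    (contDiff_snd.contMDiff.contMDiffAt (n := ∞)).comp ζ h1
  refine h2.congr_of_eventuallyEq ?_
  filter_upwards [eventually_mem_extChartAt_source h] with ζ' h'
  rw [jetChart_apply h']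

/-- A map into the jet space is smooth if its source, its value and its linear part are. -/
theorem contMDiffAt_jet (hn : n ≤ ∞) {f : N → JetSpace E M J G}
    (h : f m ∈ (jetChart E J x₀ g₀).source)
    (hs : ContMDiffAt J₁ 𝓘(ℝ, E) n (fun m => (f m).src) m)
    (hv : ContMDiffAt J₁ J n (fun m => (f m).val) m)
    (hl : ContMDiffAt J₁ 𝓘(ℝ, E →L[ℝ] F) n (fun m => jetLin x₀ g₀ (f m)) m) :
    ContMDiffAt J₁ (JetModel E J) n f m := by
  have hm := mem_jetChart_source.1 h
  have hev : ∀ᶠ m' in 𝓝 m, f m' ∈ (jetChart E J x₀ g₀).source := by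
    filter_upwards [hs.continuousAt.eventually (eventually_mem_extChartAt_source hm.1),
      hv.continuousAt.eventually (eventually_mem_extChartAt_source hm.2)] with m' h1 h2
    exact mem_jetChart_source.2 ⟨h1, h2⟩
  have h1 : ContMDiffAt J₁ 𝓘(ℝ, (E × F) × (E →L[ℝ] F)) n (fun m' => jetChart E J x₀ g₀ (f m')) m := by
    have ha := ((contMDiffAt_extChartAt_of_mem hm.1).of_le hn).comp m hs
    have hb := ((contMDiffAt_extChartAt_of_mem hm.2).of_le hn).comp m hv
    refine ((ha.prodMk_space hb).prodMk_space hl).congr_of_eventuallyEq ?_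
    filter_upwards [hev] with m' h'
    rw [jetChart_apply h']
    rfl
  have h2 := ((contMDiffAt_extChartAt_symm ((jetChart E J x₀ g₀).map_source h)).of_le hn).comp m h1
  refine h2.congr_of_eventuallyEq ?_
  filter_upwards [hev] with m' h'
  exact ((jetChart E J x₀ g₀).left_inv h').symm

end Into

/-- By `jetLin_map` the linear part is the derivative of f in charts composed with the old linear
part. The derivative of a map of class C^∞ is again C^∞, so no smoothness is lost. -/
theorem contMDiffAt_map {f : G → G'} (hf : ContMDiffAt J J' ∞ f ζ.val) :
    ContMDiffAt (JetModel E J) (JetModel E J') ∞ (JetSpace.map J' f) ζ := by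
  have hg : ζ.val ∈ (extChartAt J ζ.val).source := mem_extChartAt_source _
  have hg' : f ζ.val ∈ (extChartAt J' (f ζ.val)).source := mem_extChartAt_source _
  have hx : ζ.src ∈ (extChartAt 𝓘(ℝ, E) ζ.src).source := mem_extChartAt_source _
  have hv := contMDiff_val.contMDiffAt (x := ζ)
  refine contMDiffAt_jet (x₀ := ζ.src) (g₀ := f ζ.val) le_rfl
    (mem_jetChart_source.2 ⟨hx, hg'⟩) contMDiff_src.contMDiffAt (hf.comp ζ hv) ?_
  have h1 : ContDiffAt ℝ ∞ (fderiv ℝ (inCharts J J' ζ.val (f ζ.val) f)) (extChartAt J ζ.val ζ.val) :=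
    (contDiffAt_inCharts hg hg' hf).fderiv_right (by simp)
  have h2 : ContMDiffAt (JetModel E J) 𝓘(ℝ, F →L[ℝ] F') ∞ (fun ζ' =>
      fderiv ℝ (inCharts J J' ζ.val (f ζ.val) f) (extChartAt J ζ.val ζ'.val)) ζ :=
    ContMDiffAt.comp ζ (I' := 𝓘(ℝ, F)) h1.contMDiffAt
      ((contMDiffAt_extChartAt_of_mem hg).comp ζ hv)
  refine (h2.clm_comp (contMDiffAt_jetLin (mem_jetChart_source.2 ⟨hx, hg⟩))).congr_of_eventuallyEq ?_
  filter_upwards [hv.continuousAt.eventually (eventually_mem_extChartAt_source hg),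
    hv.continuousAt.eventually (hf.continuousAt.eventually (eventually_mem_extChartAt_source hg')),
    hv.continuousAt.eventually (eventually_mdifferentiableAt hf)]
    with ζ' h3 h4 h5
  exact jetLin_map h3 h4 h5

end JetCoordinates

/-! ### Vector fields, brackets and fields along a local diffeomorphism in charts -/

section Fields

variable {E : Type*} [NormedAddCommGroup E] [NormedSpace ℝ E]
  {M : Type*} [TopologicalSpace M] [ChartedSpace E M] [IsManifold 𝓘(ℝ, E) ∞ M]

/-- A vector field, read in the chart centred at `x₀`. -/
def coordField (x₀ : M) (Y : VField E M) (u : E) : E :=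
  dchart 𝓘(ℝ, E) x₀ ((extChartAt 𝓘(ℝ, E) x₀).symm u) (Y ((extChartAt 𝓘(ℝ, E) x₀).symm u))

variable {x₀ y₀ x : M} {Y V : VField E M}

theorem coordField_apply (hx : x ∈ (extChartAt 𝓘(ℝ, E) x₀).source) :
    coordField x₀ Y (extChartAt 𝓘(ℝ, E) x₀ x) = dchart 𝓘(ℝ, E) x₀ x (Y x) := by
  have h : ∀ x', x' = x → (dchart 𝓘(ℝ, E) x₀ x' (Y x') : E) = dchart 𝓘(ℝ, E) x₀ x (Y x) := by
    rintro _ rfl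
    rfl
  exact h _ ((extChartAt 𝓘(ℝ, E) x₀).left_inv hx)

theorem dchart_isInvertible' (hx : x ∈ (extChartAt 𝓘(ℝ, E) x₀).source) :
    (dchart 𝓘(ℝ, E) x₀ x).IsInvertible :=
  dchart_isInvertible _ (by rwa [← extChartAt_source (I := 𝓘(ℝ, E))])

theorem trivializationAt_snd (hx : x ∈ (extChartAt 𝓘(ℝ, E) x₀).source) (v : TangentSpace 𝓘(ℝ, E) x) :
    (trivializationAt E (TangentSpace 𝓘(ℝ, E) : M → Type _) x₀ ⟨x, v⟩).2 =
      dchart 𝓘(ℝ, E) x₀ x v := by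
  have : IsManifold 𝓘(ℝ, E) 1 M := .of_le (n := ∞) (by simp)
  rw [extChartAt_source] at hx
  unfold dchart
  rw [← TangentBundle.continuousLinearMapAt_trivializationAt hx,
    Trivialization.continuousLinearMapAt_apply, Trivialization.coe_linearMapAt_of_mem]
  exact hx

/-- In the trivialization over the chart, the fibre component of a field is its coordinate
expression composed with the chart; this passes between sections of TM and maps E → E. -/
theorem mdifferentiableAt_vField_iff (hx : x ∈ (extChartAt 𝓘(ℝ, E) x₀).source) :
    MDifferentiableAt 𝓘(ℝ, E) 𝓘(ℝ, E).tangent (fun x => (⟨x, Y x⟩ : TangentBundle 𝓘(ℝ, E) M)) x ↔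
      DifferentiableAt ℝ (coordField x₀ Y) (extChartAt 𝓘(ℝ, E) x₀ x) := by
  have : IsManifold 𝓘(ℝ, E) 1 M := .of_le (n := ∞) (by simp)
  have hb : x ∈ (trivializationAt E (TangentSpace 𝓘(ℝ, E) : M → Type _) x₀).baseSet := by
    rw [extChartAt_source] at hx
    exact hx
  have h1 := (trivializationAt E (TangentSpace 𝓘(ℝ, E) : M → Type _) x₀).mdifferentiableAt_section_iff
    𝓘(ℝ, E) (fun x => Y x) hb
  refine h1.trans ?_
  have ht := (extChartAt 𝓘(ℝ, E) x₀).map_source hx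
  constructor
  · intro h
    rw [← mdifferentiableAt_iff_differentiableAt]
    have h2 := mdifferentiableAt_extChartAt_symm ht
    rw [← (extChartAt 𝓘(ℝ, E) x₀).left_inv hx] at h
    refine (MDifferentiableAt.comp _ h h2).congr_of_eventuallyEq ?_
    filter_upwards [eventually_mem_extChartAt_target ht] with u hu
    exact (trivializationAt_snd ((extChartAt 𝓘(ℝ, E) x₀).map_target hu) _).symm
  · intro h
    refine (h.mdifferentiableAt.comp x (mdifferentiableAt_extChartAt_of_mem hx)).congr_of_eventuallyEq ?_
    filter_upwards [eventually_mem_extChartAt_source hx] with x' hx'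
    rw [Function.comp_apply, coordField_apply hx']
    exact trivializationAt_snd hx' _

theorem VField.Smooth.differentiableAt (hY : Y.Smooth) (hx : x ∈ (extChartAt 𝓘(ℝ, E) x₀).source) :
    DifferentiableAt ℝ (coordField x₀ Y) (extChartAt 𝓘(ℝ, E) x₀ x) :=
  (mdifferentiableAt_vField_iff hx).1 ((hY x).mdifferentiableAt (by simp))

theorem VField.Smooth.contDiffAt (hY : Y.Smooth) {u : E} (hu : u ∈ (extChartAt 𝓘(ℝ, E) x₀).target) :
    ContDiffAt ℝ ∞ (coordField x₀ Y) u := by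
  have : IsManifold 𝓘(ℝ, E) 1 M := .of_le (n := ∞) (by simp)
  have hx := (extChartAt 𝓘(ℝ, E) x₀).map_target hu
  have hb : (extChartAt 𝓘(ℝ, E) x₀).symm u ∈
      (trivializationAt E (TangentSpace 𝓘(ℝ, E) : M → Type _) x₀).baseSet := by
    rw [extChartAt_source] at hx
    exact hx
  have h1 := ((trivializationAt E (TangentSpace 𝓘(ℝ, E) : M → Type _) x₀).contMDiffAt_section_iff
    (IB := 𝓘(ℝ, E)) (n := ∞) (s := fun x => Y x) hb).1 (hY _)
  rw [← contMDiffAt_iff_contDiffAt]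
  refine (ContMDiffAt.comp _ h1 (contMDiffAt_extChartAt_symm hu)).congr_of_eventuallyEq ?_
  filter_upwards [eventually_mem_extChartAt_target hu] with u hu
  exact (trivializationAt_snd ((extChartAt 𝓘(ℝ, E) x₀).map_target hu) _).symm

/-- Every tangent vector is the value of a smooth vector field. -/
theorem exists_smooth_vField [FiniteDimensional ℝ E] [T2Space M] (x : M)
    (v : TangentSpace 𝓘(ℝ, E) x) : ∃ Y : VField E M, Y.Smooth ∧ Y x = v := by
  obtain ⟨t, ht, h⟩ := FiberBundle.exists_contMDiffOn_extend (k := ∞) 𝓘(ℝ, E) E v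
  obtain ⟨u, hut, hu, hxu⟩ := mem_nhds_iff.1 ht
  obtain ⟨ψ, -, hψ⟩ := (SmoothBumpFunction.nhds_basis_tsupport (I := 𝓘(ℝ, E)) x).mem_iff.1
    (hu.mem_nhds hxu)
  have hs := ContMDiffOn.smul_section_of_tsupport (ψ.contMDiff.contMDiffOn) hu hψ (h.mono hut)
  refine ⟨fun x' => ψ x' • FiberBundle.extend E v x', hs, ?_⟩
  simp

/-- The Lie bracket of vector fields, read in a chart. -/
theorem dchart_mlieBracket [CompleteSpace E] (hx : x ∈ (extChartAt 𝓘(ℝ, E) x₀).source)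
    (hV : DifferentiableAt ℝ (coordField x₀ V) (extChartAt 𝓘(ℝ, E) x₀ x))
    (hY : DifferentiableAt ℝ (coordField x₀ Y) (extChartAt 𝓘(ℝ, E) x₀ x)) :
    dchart 𝓘(ℝ, E) x₀ x (VectorField.mlieBracket 𝓘(ℝ, E) V Y x) =
      VectorField.lieBracket ℝ (coordField x₀ V) (coordField x₀ Y) (extChartAt 𝓘(ℝ, E) x₀ x) := by
  rw [← mdifferentiableAt_vField_iff hx] at hV hY
  obtain ⟨u, hu, rfl⟩ : ∃ u ∈ (extChartAt 𝓘(ℝ, E) x₀).target, (extChartAt 𝓘(ℝ, E) x₀).symm u = x :=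
    ⟨_, (extChartAt 𝓘(ℝ, E) x₀).map_source hx, (extChartAt 𝓘(ℝ, E) x₀).left_inv hx⟩
  rw [(extChartAt 𝓘(ℝ, E) x₀).right_inv hu]
  have hi := dchart_isInvertible' hx
  -- Coordinate expressions are pullbacks along the inverse chart, so the formula is naturality of
  -- the Lie bracket under pullback.
  have key : ∀ Z : VField E M, ∀ u ∈ (extChartAt 𝓘(ℝ, E) x₀).target,
      VectorField.mpullback 𝓘(ℝ, E) 𝓘(ℝ, E) (extChartAt 𝓘(ℝ, E) x₀).symm Z u =
        coordField x₀ Z u := by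
    intro Z u hu
    have h := (congrArg ContinuousLinearMap.inverse (mfderiv_symm_eq (J := 𝓘(ℝ, E)) hu)).trans
      (dchart_isInvertible' ((extChartAt 𝓘(ℝ, E) x₀).map_target hu)).inverse_inverse
    exact congrArg (fun L : TangentSpace 𝓘(ℝ, E) ((extChartAt 𝓘(ℝ, E) x₀).symm u) →L[ℝ] E =>
      L (Z ((extChartAt 𝓘(ℝ, E) x₀).symm u))) h
  have hm : minSmoothness ℝ 3 ≤ (∞ : ℕ∞ω) := by
    rw [minSmoothness_of_isRCLikeNormedField]
    exact WithTop.coe_le_coe.2 le_top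
  have : IsManifold 𝓘(ℝ, E) (minSmoothness ℝ 3) M := .of_le (n := ∞) hm
  have h := VectorField.mpullback_mlieBracket (n := ∞) hV hY (contMDiffAt_extChartAt_symm hu)
    (by rw [minSmoothness_of_isRCLikeNormedField]; exact WithTop.coe_le_coe.2 le_top)
  rw [key _ _ hu] at h
  refine h.trans ?_
  rw [← VectorField.mlieBracketWithin_univ, VectorField.mlieBracketWithin_eq_lieBracketWithin]
  refine (congrFun VectorField.lieBracketWithin_univ u).trans ?_
  have e1 : ∀ Z : VField E M, VectorField.mpullback 𝓘(ℝ, E) 𝓘(ℝ, E) (extChartAt 𝓘(ℝ, E) x₀).symm Z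
      =ᶠ[𝓝 u] coordField x₀ Z := by
    intro Z
    filter_upwards [eventually_mem_extChartAt_target hu] with u' hu' using key Z u' hu'
  exact (e1 V).lieBracket_vectorField_eq (e1 Y)

/-- The value and the derivative of a vector field given along a local diffeomorphism. -/
theorem fieldAlong_spec [CompleteSpace E] {f : M → M} {W : (x' : M) → TangentSpace 𝓘(ℝ, E) (f x')}
    (hx : x ∈ (extChartAt 𝓘(ℝ, E) x₀).source) (hfx : f x ∈ (extChartAt 𝓘(ℝ, E) y₀).source)
    (hfc : ContinuousAt f x) {A : E ≃L[ℝ] E}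
    (hf : HasStrictFDerivAt (inCharts 𝓘(ℝ, E) 𝓘(ℝ, E) x₀ y₀ f) (A : E →L[ℝ] E)
      (extChartAt 𝓘(ℝ, E) x₀ x)) {W' : E →L[ℝ] E} {Ŵ : E → E}
    (hŴ : ∀ᶠ x' in 𝓝 x, Ŵ (extChartAt 𝓘(ℝ, E) x₀ x') = dchart 𝓘(ℝ, E) y₀ (f x') (W x'))
    (hW : HasFDerivAt Ŵ W' (extChartAt 𝓘(ℝ, E) x₀ x)) :
    HasFDerivAt (coordField y₀ (fieldAlong f x W)) (W' ∘L (A.symm : E →L[ℝ] E))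
      (extChartAt 𝓘(ℝ, E) y₀ (f x)) ∧ fieldAlong f x W (f x) = W x := by
  set φ := extChartAt 𝓘(ℝ, E) x₀ with hφ
  set ψ := extChartAt 𝓘(ℝ, E) y₀ with hψ
  set fc := inCharts 𝓘(ℝ, E) 𝓘(ℝ, E) x₀ y₀ f with hfc'
  have hfcx : fc (φ x) = ψ (f x) := inCharts_apply hx
  have hsrc := eventually_mem_extChartAt_source hx
  have hsrc' := hfc.eventually (eventually_mem_extChartAt_source hfx)
  have hφc : ContinuousAt φ x := continuousAt_extChartAt' hx
  have hV : ∀ᶠ x' in 𝓝 x, fieldAlong f x W (f x') = W x' := by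
    -- All tangent spaces are copies of E. Forgetting the base point lets a witness for the choice
    -- be defined by pushing W through the local inverse of f.
    let W₀ : M → E := fun x' => W x'
    refine Classical.epsilon_spec (p := fun V : VField E M => ∀ᶠ x' in 𝓝 x, V (f x') = W x')
      ⟨fun y' => (W₀ (φ.symm (hf.localInverse fc A _ (ψ y'))) : E), ?_⟩
    filter_upwards [hsrc, hφc.eventually hf.eventually_left_inverse] with x' h1 h2
    have h3 : φ.symm (hf.localInverse fc A _ (ψ (f x'))) = x' := by
      rw [← inCharts_apply (f := f) (g₀' := y₀) h1, h2, φ.left_inv h1]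
    exact congrArg W₀ h3
  refine ⟨?_, hV.self_of_nhds⟩
  have h1 : ∀ᶠ u in 𝓝 (φ x), coordField y₀ (fieldAlong f x W) (fc u) = Ŵ u := by
    have hall : ∀ᶠ x' in 𝓝 x, x' ∈ φ.source ∧ coordField y₀ (fieldAlong f x W) (ψ (f x')) =
        Ŵ (φ x') := by
      filter_upwards [hsrc, hsrc', hV, hŴ] with x' h1 h2 h3 h4
      rw [coordField_apply h2, h3, h4]
      exact ⟨h1, rfl⟩
    filter_upwards [eventually_extChartAt_symm hx hall,
      eventually_mem_extChartAt_target (φ.map_source hx)] with u h2 h3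
    rw [φ.right_inv h3] at h2
    exact h2.2
  have h2 := hf.to_localInverse
  have h3 : hf.localInverse fc A _ (fc (φ x)) = φ x := hf.localInverse_apply_image
  have h4 : ContinuousAt (hf.localInverse fc A _) (fc (φ x)) := hf.localInverse_continuousAt
  rw [ContinuousAt, h3] at h4
  rw [← hfcx]
  -- Near the image point the chosen field is Ŵ composed with the local inverse of f, whose
  -- derivative is the inverse of A.
  have h5 : HasFDerivAt (Ŵ ∘ hf.localInverse fc A _) (W' ∘L (A.symm : E →L[ℝ] E)) (fc (φ x)) := by
    refine HasFDerivAt.comp _ ?_ h2.hasFDerivAt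
    rwa [h3]
  refine h5.congr_of_eventuallyEq ?_
  filter_upwards [h4.eventually h1, hf.eventually_right_inverse] with v h6 h7
  rw [h7] at h6
  exact h6

end Fields

/-! ### (1,1)-jets in charts -/

section SecondOrder

variable {E : Type*} [NormedAddCommGroup E] [NormedSpace ℝ E]
  {M : Type*} [TopologicalSpace M] [ChartedSpace E M]

/-- The jet on which the chart of `J1` induced by the charts centred at `x₀` and `y₀` is based. -/
def basePt (x₀ y₀ : M) : J1 E M := .mk x₀ y₀ 0

variable [IsManifold 𝓘(ℝ, E) ∞ M]

variable (E) in
/-- The chart of `J1` induced by the charts centred at `x₀` and `y₀`. -/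
abbrev chart1 (x₀ y₀ : M) : PartialEquiv (J1 E M) ((E × E) × (E →L[ℝ] E)) :=
  extChartAt (I1 E) (basePt x₀ y₀ : J1 E M)

/-- The second order part of a (1,1)-jet, read in charts. -/
def secondPart (x₀ y₀ : M) (ζ : J2 E M) : E →L[ℝ] E →L[ℝ] E :=
  ContinuousLinearMap.snd ℝ (E × E) (E →L[ℝ] E) ∘L jetLin x₀ (basePt x₀ y₀) ζ

variable {x₀ y₀ z₀ x : M} {ξ ξ' : J1 E M} {ζ ζ' : J2 E M} {b : M → J1 E M}

theorem mem_chart1_source : ξ ∈ (chart1 E x₀ y₀).source ↔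
    ξ.src ∈ (extChartAt 𝓘(ℝ, E) x₀).source ∧ ξ.val ∈ (extChartAt 𝓘(ℝ, E) y₀).source :=
  mem_jetChart_source

theorem mem_chart1_target {p : (E × E) × (E →L[ℝ] E)} : p ∈ (chart1 E x₀ y₀).target ↔
    p.1.1 ∈ (extChartAt 𝓘(ℝ, E) x₀).target ∧ p.1.2 ∈ (extChartAt 𝓘(ℝ, E) y₀).target :=
  mem_jetChart_target

theorem chart1_apply (h : ξ ∈ (chart1 E x₀ y₀).source) : chart1 E x₀ y₀ ξ =
    ((extChartAt 𝓘(ℝ, E) x₀ ξ.src, extChartAt 𝓘(ℝ, E) y₀ ξ.val), jetLin x₀ y₀ ξ) :=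
  jetChart_apply h

theorem mem_chart1_self : ξ ∈ (chart1 E ξ.src ξ.val).source :=
  mem_chart1_source.2 ⟨mem_extChartAt_source _, mem_extChartAt_source _⟩

theorem dchart_act {Y : VField E M} (h : ξ ∈ (chart1 E x₀ y₀).source) :
    dchart 𝓘(ℝ, E) y₀ ξ.val (act ξ Y) =
      jetLin x₀ y₀ ξ (coordField x₀ Y (extChartAt 𝓘(ℝ, E) x₀ ξ.src)) := by
  have hs := (mem_chart1_source.1 h).1
  rw [coordField_apply hs]
  simp only [jetLin, ContinuousLinearMap.comp_apply,
    (dchart_isInvertible' hs).inverse_apply_self]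
  rfl

theorem jetLin_isInvertible_iff (h : ξ ∈ (chart1 E x₀ y₀).source) :
    (jetLin x₀ y₀ ξ).IsInvertible ↔ ξ ∈ (GL1 E M).carrier := by
  obtain ⟨h1, h2⟩ := mem_chart1_source.1 h
  have i1 := dchart_isInvertible' h1
  have i2 := dchart_isInvertible' h2
  constructor
  · intro hi
    have h3 := i2.inverse.comp (hi.comp i1)
    have e : ξ.lin = (dchart 𝓘(ℝ, E) y₀ ξ.val).inverse ∘L (jetLin x₀ y₀ ξ ∘L
        dchart 𝓘(ℝ, E) x₀ ξ.src) := by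
      ext v
      simp only [jetLin, ContinuousLinearMap.comp_apply, i1.inverse_apply_self,
        i2.inverse_apply_self]
    change ξ.lin.IsInvertible
    rw [e]
    exact h3
  · intro hi
    exact i2.comp (ContinuousLinearMap.IsInvertible.comp hi i1.inverse)

theorem isOpen_isInvertible [CompleteSpace E] : IsOpen {A : E →L[ℝ] E | A.IsInvertible} :=
  ContinuousLinearEquiv.isOpen

theorem isOpen_GL1 [CompleteSpace E] : IsOpen (GL1 E M).carrier := by
  rw [isOpen_iff_mem_nhds]
  intro ξ hξ
  have h := mem_chart1_self (ξ := ξ)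
  have h1 := (contMDiffAt_jetLin (J := 𝓘(ℝ, E)) h).continuousAt
  filter_upwards [eventually_mem_extChartAt_source h,
    h1.preimage_mem_nhds (isOpen_isInvertible.mem_nhds ((jetLin_isInvertible_iff h).2 hξ))]
    with ξ' h2 h3
  exact (jetLin_isInvertible_iff h2).1 h3

theorem fderiv_val (h : ξ ∈ (chart1 E x₀ y₀).source) :
    fderiv ℝ (inCharts (I1 E) 𝓘(ℝ, E) (basePt x₀ y₀) y₀ (JetSpace.val : J1 E M → M))
      (chart1 E x₀ y₀ ξ) = ContinuousLinearMap.snd ℝ E E ∘L ContinuousLinearMap.fst ℝ _ _ := by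
  have h1 : inCharts (I1 E) 𝓘(ℝ, E) (basePt x₀ y₀) y₀ (JetSpace.val : J1 E M → M)
      =ᶠ[𝓝 (chart1 E x₀ y₀ ξ)] (ContinuousLinearMap.snd ℝ E E ∘L ContinuousLinearMap.fst ℝ _ _) := by
    filter_upwards [eventually_mem_extChartAt_target ((chart1 E x₀ y₀).map_source h)] with p hp
    have hp' := mem_chart1_target.1 hp
    have := jetChart_symm_val (J := 𝓘(ℝ, E)) hp
    simp only [inCharts, Function.comp_apply]
    refine (congrArg _ this).trans ((extChartAt 𝓘(ℝ, E) y₀).right_inv hp'.2)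
  rw [h1.fderiv_eq, ContinuousLinearMap.fderiv]

theorem fderiv_src (h : ξ ∈ (chart1 E x₀ y₀).source) :
    fderiv ℝ (inCharts (I1 E) 𝓘(ℝ, E) (basePt x₀ y₀) x₀ (JetSpace.src : J1 E M → M))
      (chart1 E x₀ y₀ ξ) = ContinuousLinearMap.fst ℝ E E ∘L ContinuousLinearMap.fst ℝ _ _ := by
  have h1 : inCharts (I1 E) 𝓘(ℝ, E) (basePt x₀ y₀) x₀ (JetSpace.src : J1 E M → M)
      =ᶠ[𝓝 (chart1 E x₀ y₀ ξ)] (ContinuousLinearMap.fst ℝ E E ∘L ContinuousLinearMap.fst ℝ _ _) := by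
    filter_upwards [eventually_mem_extChartAt_target ((chart1 E x₀ y₀).map_source h)] with p hp
    have hp' := mem_chart1_target.1 hp
    have := jetChart_symm_src (J := 𝓘(ℝ, E)) hp
    simp only [inCharts, Function.comp_apply]
    refine (congrArg _ this).trans ((extChartAt 𝓘(ℝ, E) x₀).right_inv hp'.1)
  rw [h1.fderiv_eq, ContinuousLinearMap.fderiv]

theorem jetLin_pStar₂ (h : ζ.val ∈ (chart1 E x₀ y₀).source) :
    jetLin x₀ y₀ (pStar₂ ζ) = ContinuousLinearMap.snd ℝ E E ∘L ContinuousLinearMap.fst ℝ _ _ ∘L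
      jetLin x₀ (basePt x₀ y₀) ζ := by
  unfold pStar₂
  rw [jetLin_map h (mem_chart1_source.1 h).2 (contMDiff_val.mdifferentiable (by simp) _),
    fderiv_val h]
  rfl

theorem fderiv_inCharts_of_eventuallyEq_id {f : M → M}
    (hx : x ∈ (extChartAt 𝓘(ℝ, E) x₀).source) (hf : ∀ᶠ x' in 𝓝 x, f x' = x') :
    fderiv ℝ (inCharts 𝓘(ℝ, E) 𝓘(ℝ, E) x₀ x₀ f) (extChartAt 𝓘(ℝ, E) x₀ x) =
      ContinuousLinearMap.id ℝ E := by
  have h : inCharts 𝓘(ℝ, E) 𝓘(ℝ, E) x₀ x₀ f =ᶠ[𝓝 (extChartAt 𝓘(ℝ, E) x₀ x)] id := by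
    filter_upwards [eventually_extChartAt_symm hx hf,
      eventually_mem_extChartAt_target ((extChartAt 𝓘(ℝ, E) x₀).map_source hx)] with u h1 h2
    simp only [inCharts, Function.comp_apply, h1, (extChartAt 𝓘(ℝ, E) x₀).right_inv h2, id]
  rw [h.fderiv_eq, fderiv_id]

/-- A germ of a smooth section of the source map of `GL1`, with semi-holonomic 1-jet. -/
structure IsSemiholonomicAt (b : M → J1 E M) (x : M) : Prop where
  smooth : ContMDiffAt 𝓘(ℝ, E) (I1 E) ∞ b x
  src_eq : ∀ᶠ x' in 𝓝 x, (b x').src = x'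
  mem : b x ∈ (GL1 E M).carrier
  pStar_eq : pStar₂ (jet1 (I1 E) b x) = b x

namespace IsSemiholonomicAt

theorem mem_source (hb : IsSemiholonomicAt b x) (h : b x ∈ (chart1 E x₀ y₀).source) :
    x ∈ (extChartAt 𝓘(ℝ, E) x₀).source := by
  have h1 := (mem_chart1_source.1 h).1
  rwa [hb.src_eq.self_of_nhds] at h1

/-- Two of the three components are forced. The source component is the derivative of `src ∘ b`,
which is locally the identity; the target component is the linear part of `pStar₂`, equal to that of
b(x) by semi-holonomy. -/
theorem jetLin_eq (hb : IsSemiholonomicAt b x) (h : b x ∈ (chart1 E x₀ y₀).source) :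
    jetLin x₀ (basePt x₀ y₀) (jet1 (I1 E) b x : J2 E M) =
      ((ContinuousLinearMap.id ℝ E).prod (jetLin x₀ y₀ (b x))).prod
        (secondPart x₀ y₀ (jet1 (I1 E) b x)) := by
  have hd : MDifferentiableAt 𝓘(ℝ, E) (I1 E) b x := hb.smooth.mdifferentiableAt (by simp)
  have hx := hb.mem_source h
  have h1 := jetLin_pStar₂ (ζ := jet1 (I1 E) b x) h
  rw [hb.pStar_eq] at h1
  have h2 : ContinuousLinearMap.fst ℝ E E ∘L ContinuousLinearMap.fst ℝ _ _ ∘L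
      jetLin x₀ (basePt x₀ y₀) (jet1 (I1 E) b x : J2 E M) = ContinuousLinearMap.id ℝ E := by
    have h3 := jetLin_map (J := I1 E) (J' := 𝓘(ℝ, E)) (x₀ := x₀) (g₀' := x₀)
      (ζ := (jet1 (I1 E) b x : J2 E M)) (f := JetSpace.src) h (mem_chart1_source.1 h).1
      (contMDiff_src.mdifferentiable (by simp) _)
    have hs : MDifferentiableAt (I1 E) 𝓘(ℝ, E) (JetSpace.src : J1 E M → M) (b x) :=
      contMDiff_src.mdifferentiable (by simp) _
    have hx' : (JetSpace.src ∘ b) x ∈ (extChartAt 𝓘(ℝ, E) x₀).source := (mem_chart1_source.1 h).1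
    rw [map_jet1 (I1 E) 𝓘(ℝ, E) (JetSpace.src : J1 E M → M) b x hd hs,
      jetLin_jet1 hx hx' (hs.comp x hd),
      fderiv_inCharts_of_eventuallyEq_id (f := JetSpace.src ∘ b) hx hb.src_eq] at h3
    rw [h3]
    exact (congrArg (fun L => L ∘L jetLin x₀ (basePt x₀ y₀) (jet1 (I1 E) b x : J2 E M))
      (fderiv_src h)).symm
  rw [h1]
  ext1 w
  refine Prod.ext (Prod.ext ?_ rfl) rfl
  exact congrArg (fun L => L w) h2

end IsSemiholonomicAt

end SecondOrder

/-! ### Bisections that are affine in charts -/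

section Representatives

variable {E : Type*} [NormedAddCommGroup E] [NormedSpace ℝ E]
  {M : Type*} [TopologicalSpace M] [ChartedSpace E M] [IsManifold 𝓘(ℝ, E) ∞ M]

/-- The affine path of 1-jets (in charts) through `p` with second order part `B`. -/
def affPath (p : (E × E) × (E →L[ℝ] E)) (B : E →L[ℝ] E →L[ℝ] E) (u : E) :
    (E × E) × (E →L[ℝ] E) :=
  ((u, p.1.2 + p.2 (u - p.1.1)), p.2 + B (u - p.1.1))

/-- A local section of the source map of `J1` with prescribed 1-jet in charts. -/
def affSection (x₀ y₀ : M) (p : (E × E) × (E →L[ℝ] E)) (B : E →L[ℝ] E →L[ℝ] E) (x : M) : J1 E M :=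
  (chart1 E x₀ y₀).symm (affPath p B (extChartAt 𝓘(ℝ, E) x₀ x))

variable {x₀ y₀ z₀ x : M} {ξ ξ' : J1 E M} {ζ ζ' : J2 E M} {b : M → J1 E M}
  {p : (E × E) × (E →L[ℝ] E)} {B : E →L[ℝ] E →L[ℝ] E}

theorem affPath_self : affPath p B p.1.1 = p := by
  simp [affPath]

theorem contDiff_affPath : ContDiff ℝ ∞ fun q : ((E × E) × (E →L[ℝ] E)) × (E →L[ℝ] E →L[ℝ] E) × E =>
    affPath q.1 q.2.1 q.2.2 := by
  unfold affPath
  fun_prop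

theorem hasFDerivAt_affPath (u : E) : HasFDerivAt (affPath p B)
    (((ContinuousLinearMap.id ℝ E).prod p.2).prod B) u := by
  have h := hasFDerivAt_id (𝕜 := ℝ) u
  have h' := h.sub_const p.1.1
  exact (h.prodMk ((p.2.hasFDerivAt.comp u h').const_add p.1.2)).prodMk
    ((B.hasFDerivAt.comp u h').const_add p.2)

variable (x₀ y₀ p B) in
/-- The domain on which `affSection` is a section of `GL1`. -/
def affDomain : Set M :=
  {x | x ∈ (extChartAt 𝓘(ℝ, E) x₀).source ∧
    (affPath p B (extChartAt 𝓘(ℝ, E) x₀ x)).1.2 ∈ (extChartAt 𝓘(ℝ, E) y₀).target ∧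
    (affPath p B (extChartAt 𝓘(ℝ, E) x₀ x)).2.IsInvertible}

theorem isOpen_affDomain [CompleteSpace E] : IsOpen (affDomain x₀ y₀ p B) := by
  have hc : Continuous (affPath p B) := by
    unfold affPath
    fun_prop
  exact (continuousOn_extChartAt (I := 𝓘(ℝ, E)) x₀).isOpen_inter_preimage
    (isOpen_extChartAt_source x₀) (((isOpen_extChartAt_target y₀).preimage
    (continuous_snd.comp (continuous_fst.comp hc))).inter
    (isOpen_isInvertible.preimage (continuous_snd.comp hc)))

theorem affPath_mem_target (hx : x ∈ affDomain x₀ y₀ p B) :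
    affPath p B (extChartAt 𝓘(ℝ, E) x₀ x) ∈ (chart1 E x₀ y₀).target :=
  mem_chart1_target.2 ⟨(extChartAt 𝓘(ℝ, E) x₀).map_source hx.1, hx.2.1⟩

theorem affSection_mem_source (hx : x ∈ affDomain x₀ y₀ p B) :
    affSection x₀ y₀ p B x ∈ (chart1 E x₀ y₀).source :=
  (chart1 E x₀ y₀).map_target (affPath_mem_target hx)

theorem chart1_affSection (hx : x ∈ affDomain x₀ y₀ p B) :
    chart1 E x₀ y₀ (affSection x₀ y₀ p B x) = affPath p B (extChartAt 𝓘(ℝ, E) x₀ x) :=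
  (chart1 E x₀ y₀).right_inv (affPath_mem_target hx)

theorem affSection_src (hx : x ∈ affDomain x₀ y₀ p B) : (affSection x₀ y₀ p B x).src = x :=
  (jetChart_symm_src (J := 𝓘(ℝ, E)) (affPath_mem_target hx)).trans
    ((extChartAt 𝓘(ℝ, E) x₀).left_inv hx.1)

theorem affSection_mem (hx : x ∈ affDomain x₀ y₀ p B) :
    affSection x₀ y₀ p B x ∈ (GL1 E M).carrier := by
  rw [← jetLin_isInvertible_iff (affSection_mem_source hx)]
  have h := (jetLin_jetChart_symm (J := 𝓘(ℝ, E)) (affPath_mem_target hx))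
  have h' : jetLin x₀ y₀ (affSection x₀ y₀ p B x) = _ := h
  rw [h']
  exact hx.2.2

theorem contMDiffAt_affSection (hx : x ∈ affDomain x₀ y₀ p B) :
    ContMDiffAt 𝓘(ℝ, E) (I1 E) ∞ (affSection x₀ y₀ p B) x := by
  have h1 : ContDiff ℝ ∞ (affPath p B) := by
    unfold affPath
    fun_prop
  exact (contMDiffAt_extChartAt_symm (affPath_mem_target hx)).comp x
    (h1.contMDiff.contMDiffAt.comp x (contMDiffAt_extChartAt_of_mem hx.1))

variable (x₀) in
/-- An extended chart, as a partial diffeomorphism. -/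
def chartPartialDiffeomorph : PartialDiffeomorph 𝓘(ℝ, E) 𝓘(ℝ, E) M E ∞ where
  toPartialEquiv := extChartAt 𝓘(ℝ, E) x₀
  open_source := isOpen_extChartAt_source x₀
  open_target := isOpen_extChartAt_target x₀
  contMDiffOn_toFun _ hx := (contMDiffAt_extChartAt_of_mem hx).contMDiffWithinAt
  contMDiffOn_invFun _ hx := (contMDiffAt_extChartAt_symm hx).contMDiffWithinAt

/-- An affine isomorphism, as a partial diffeomorphism. -/
def affPartialDiffeomorph (A : E ≃L[ℝ] E) (u v : E) : PartialDiffeomorph 𝓘(ℝ, E) 𝓘(ℝ, E) E E ∞ where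
  toFun w := v + A (w - u)
  invFun w := u + A.symm (w - v)
  source := univ
  target := univ
  map_source' _ _ := trivial
  map_target' _ _ := trivial
  left_inv' w _ := by simp
  right_inv' w _ := by simp
  open_source := isOpen_univ
  open_target := isOpen_univ
  contMDiffOn_toFun := by
    rw [contMDiffOn_iff_contDiffOn]
    fun_prop
  contMDiffOn_invFun := by
    rw [contMDiffOn_iff_contDiffOn]
    fun_prop

theorem isLocalBisectionAt_affSection [CompleteSpace E] (hx : x ∈ affDomain x₀ y₀ p B)
    (hp : p.2.IsInvertible) :
    IsLocalBisectionAt (E := E) (I1 E) (GL1 E M) (affSection x₀ y₀ p B) x := by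
  refine ⟨⟨affDomain x₀ y₀ p B, isOpen_affDomain, hx,
    fun x' hx' => (contMDiffAt_affSection hx').contMDiffWithinAt,
    fun x' hx' => ⟨affSection_mem hx', affSection_src hx'⟩⟩, ?_⟩
  obtain ⟨A, hA⟩ := hp
  -- In charts the target of `affSection` is the affine isomorphism w ↦ p.1.2 + A (w - p.1.1), so
  -- conjugating it by the charts gives the required diffeomorphism without the inverse function
  -- theorem.
  let Φ := ((chartPartialDiffeomorph x₀).trans (affPartialDiffeomorph A p.1.1 p.1.2)).trans
    (chartPartialDiffeomorph y₀).symm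
  have hΦ : ∀ x', Φ x' = (extChartAt 𝓘(ℝ, E) y₀).symm (affPath p B (extChartAt 𝓘(ℝ, E) x₀ x')).1.2 := by
    intro x'
    simp only [affPath, ← hA]
    rfl
  have hsrc : ∀ x', x' ∈ Φ.source ↔ x' ∈ (extChartAt 𝓘(ℝ, E) x₀).source ∧
      (affPath p B (extChartAt 𝓘(ℝ, E) x₀ x')).1.2 ∈ (extChartAt 𝓘(ℝ, E) y₀).target := by
    intro x'
    simp only [affPath, ← hA]
    constructor
    · rintro ⟨⟨h1, -⟩, h2⟩
      exact ⟨h1, h2⟩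
    · rintro ⟨h1, h2⟩
      exact ⟨⟨h1, trivial⟩, h2⟩
  refine ⟨Φ, (hsrc x).2 ⟨hx.1, hx.2.1⟩, fun x' hx' => ?_⟩
  have h1 := (hsrc x').1 hx'
  have ht : affPath p B (extChartAt 𝓘(ℝ, E) x₀ x') ∈ (chart1 E x₀ y₀).target :=
    mem_chart1_target.2 ⟨(extChartAt 𝓘(ℝ, E) x₀).map_source h1.1, h1.2⟩
  exact (jetChart_symm_val (J := 𝓘(ℝ, E)) ht).trans (hΦ x').symm

theorem jetLin_jet1_affSection [CompleteSpace E] (hx : x ∈ affDomain x₀ y₀ p B) :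
    jetLin x₀ (basePt x₀ y₀) (jet1 (I1 E) (affSection x₀ y₀ p B) x : J2 E M) =
      ((ContinuousLinearMap.id ℝ E).prod p.2).prod B := by
  rw [jetLin_jet1 hx.1 (affSection_mem_source hx)
    ((contMDiffAt_affSection hx).mdifferentiableAt (by simp))]
  have h : inCharts 𝓘(ℝ, E) (I1 E) x₀ (basePt x₀ y₀) (affSection x₀ y₀ p B)
      =ᶠ[𝓝 (extChartAt 𝓘(ℝ, E) x₀ x)] affPath p B := by
    filter_upwards [eventually_extChartAt_symm hx.1 (isOpen_affDomain.mem_nhds hx),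
      eventually_mem_extChartAt_target ((extChartAt 𝓘(ℝ, E) x₀).map_source hx.1)] with u h1 h2
    have h3 := chart1_affSection h1
    rw [(extChartAt 𝓘(ℝ, E) x₀).right_inv h2] at h3
    exact h3
  rw [h.fderiv_eq, (hasFDerivAt_affPath _).fderiv]

end Representatives

/-! ### Semi-holonomic jets as bilinear maps; transport of fields -/

section SemiHolonomic

variable {E : Type*} [NormedAddCommGroup E] [NormedSpace ℝ E]
  {M : Type*} [TopologicalSpace M] [ChartedSpace E M] [IsManifold 𝓘(ℝ, E) ∞ M]

variable {x₀ y₀ z₀ x : M} {ξ ξ' : J1 E M} {ζ ζ' : J2 E M} {b : M → J1 E M}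
  {p : (E × E) × (E →L[ℝ] E)} {B : E →L[ℝ] E →L[ℝ] E} {s : M → J2 E M}

theorem IsLocalBisectionAt.contMDiffAt (hb : IsLocalBisectionAt (E := E) (I1 E) (GL1 E M) b x) :
    ContMDiffAt 𝓘(ℝ, E) (I1 E) ∞ b x := by
  obtain ⟨⟨U, hU, hxU, hs, -⟩, -⟩ := hb
  exact hs.contMDiffAt (hU.mem_nhds hxU)

theorem IsLocalBisectionAt.isSemiholonomicAt
    (hb : IsLocalBisectionAt (E := E) (I1 E) (GL1 E M) b x)
    (hj : jet1 (I1 E) b x ∈ SH2 E M) : IsSemiholonomicAt b x := by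
  refine ⟨hb.contMDiffAt, ?_, ?_, hj.2.symm⟩
  · obtain ⟨⟨U, hU, hxU, hs, h⟩, -⟩ := hb
    filter_upwards [hU.mem_nhds hxU] with x' hx' using (h x' hx').2
  · obtain ⟨⟨U, hU, hxU, hs, h⟩, -⟩ := hb
    exact (h x hxU).1

theorem exists_isSemiholonomicAt (h : ζ ∈ SH2 E M) : ∃ b : M → J1 E M,
    IsLocalBisectionAt (E := E) (I1 E) (GL1 E M) b ζ.src ∧ jet1 (I1 E) b ζ.src = ζ ∧
      IsSemiholonomicAt b ζ.src := by
  obtain ⟨b, hb, hj⟩ := h.1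
  exact ⟨b, hb, hj, hb.isSemiholonomicAt (hj ▸ h)⟩

theorem SH2_val_src (h : ζ ∈ SH2 E M) : ζ.val.src = ζ.src := by
  obtain ⟨b, hb, hj, h'⟩ := exists_isSemiholonomicAt h
  have h1 : b ζ.src = ζ.val := congrArg JetSpace.val hj
  rw [← h1]
  exact h'.src_eq.self_of_nhds

theorem SH2_val_mem (h : ζ ∈ SH2 E M) : ζ.val ∈ (GL1 E M).carrier := by
  obtain ⟨b, hb, hj, h'⟩ := exists_isSemiholonomicAt h
  have h1 : b ζ.src = ζ.val := congrArg JetSpace.val hj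
  rw [← h1]
  exact h'.mem

theorem SH2_jetLin (h : ζ ∈ SH2 E M) (hc : ζ.val ∈ (chart1 E x₀ y₀).source) :
    jetLin x₀ (basePt x₀ y₀) ζ =
      ((ContinuousLinearMap.id ℝ E).prod (jetLin x₀ y₀ ζ.val)).prod (secondPart x₀ y₀ ζ) := by
  obtain ⟨b, hb, hj, h'⟩ := exists_isSemiholonomicAt h
  have h1 : b ζ.src = ζ.val := congrArg JetSpace.val hj
  have h2 := h'.jetLin_eq (x₀ := x₀) (y₀ := y₀) (h1 ▸ hc)
  rwa [hj, h1] at h2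

theorem mem_chart2_source (h : ζ ∈ SH2 E M) (hc : ζ.val ∈ (chart1 E x₀ y₀).source) :
    ζ ∈ (jetChart E (I1 E) x₀ (basePt x₀ y₀)).source := by
  refine mem_jetChart_source.2 ⟨?_, hc⟩
  rw [← SH2_val_src h]
  exact (mem_chart1_source.1 hc).1

/-- By `SH2_jetLin` all the other coordinates are determined by the 1-jet, so each uniqueness
question for (1,1)-jets becomes an equation between bilinear maps. -/
theorem SH2_ext (h : ζ ∈ SH2 E M) (h' : ζ' ∈ SH2 E M) (hc : ζ.val ∈ (chart1 E x₀ y₀).source)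
    (hv : ζ.val = ζ'.val) (hB : secondPart x₀ y₀ ζ = secondPart x₀ y₀ ζ') : ζ = ζ' := by
  refine jet_ext (mem_chart2_source h hc) ?_ hv ?_
  · rw [← SH2_val_src h, ← SH2_val_src h', hv]
  · rw [SH2_jetLin h hc, SH2_jetLin h' (hv ▸ hc), hB, hv]

variable (x₀ y₀ ξ B) in
/-- The semi-holonomic (1,1)-jet with value `ξ` and with second order part `B` in charts. -/
def ofSecondPart : J2 E M :=
  jet1 (I1 E) (affSection x₀ y₀ (chart1 E x₀ y₀ ξ) B) ξ.src

theorem mem_affDomain (hξ : ξ ∈ (GL1 E M).carrier) (hc : ξ ∈ (chart1 E x₀ y₀).source) :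
    ξ.src ∈ affDomain x₀ y₀ (chart1 E x₀ y₀ ξ) B := by
  have h := mem_chart1_source.1 hc
  have h1 : affPath (chart1 E x₀ y₀ ξ) B (extChartAt 𝓘(ℝ, E) x₀ ξ.src) = chart1 E x₀ y₀ ξ := by
    convert affPath_self using 2
    rw [chart1_apply hc]
  refine ⟨h.1, ?_, ?_⟩
  · rw [h1, chart1_apply hc]
    exact (extChartAt 𝓘(ℝ, E) y₀).map_source h.2
  · rw [h1, chart1_apply hc]
    exact (jetLin_isInvertible_iff hc).2 hξ

theorem affSection_chart1 (hc : ξ ∈ (chart1 E x₀ y₀).source) :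
    affSection x₀ y₀ (chart1 E x₀ y₀ ξ) B ξ.src = ξ := by
  have h1 : affPath (chart1 E x₀ y₀ ξ) B (extChartAt 𝓘(ℝ, E) x₀ ξ.src) = chart1 E x₀ y₀ ξ := by
    convert affPath_self using 2
    rw [chart1_apply hc]
  unfold affSection
  rw [h1, (chart1 E x₀ y₀).left_inv hc]

theorem ofSecondPart_val (hc : ξ ∈ (chart1 E x₀ y₀).source) : (ofSecondPart x₀ y₀ ξ B).val = ξ :=
  affSection_chart1 hc

variable [CompleteSpace E]

theorem isLocalBisectionAt_affSection_chart1 (hξ : ξ ∈ (GL1 E M).carrier)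
    (hc : ξ ∈ (chart1 E x₀ y₀).source) : IsLocalBisectionAt (E := E) (I1 E) (GL1 E M)
      (affSection x₀ y₀ (chart1 E x₀ y₀ ξ) B) ξ.src := by
  refine isLocalBisectionAt_affSection (mem_affDomain hξ hc) ?_
  rw [chart1_apply hc]
  exact (jetLin_isInvertible_iff hc).2 hξ

theorem jetLin_ofSecondPart (hξ : ξ ∈ (GL1 E M).carrier) (hc : ξ ∈ (chart1 E x₀ y₀).source) :
    jetLin x₀ (basePt x₀ y₀) (ofSecondPart x₀ y₀ ξ B) =
      ((ContinuousLinearMap.id ℝ E).prod (jetLin x₀ y₀ ξ)).prod B := by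
  unfold ofSecondPart
  rw [jetLin_jet1_affSection (mem_affDomain hξ hc), chart1_apply hc]

theorem secondPart_ofSecondPart (hξ : ξ ∈ (GL1 E M).carrier) (hc : ξ ∈ (chart1 E x₀ y₀).source) :
    secondPart x₀ y₀ (ofSecondPart x₀ y₀ ξ B) = B := by
  unfold secondPart
  rw [jetLin_ofSecondPart hξ hc]
  rfl

theorem ofSecondPart_mem (hξ : ξ ∈ (GL1 E M).carrier) (hc : ξ ∈ (chart1 E x₀ y₀).source) :
    ofSecondPart x₀ y₀ ξ B ∈ SH2 E M := by
  refine ⟨⟨_, isLocalBisectionAt_affSection_chart1 hξ hc, rfl⟩, ?_⟩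
  have hv : (ofSecondPart x₀ y₀ ξ B).val = ξ := ofSecondPart_val hc
  have hc' : (ofSecondPart x₀ y₀ ξ B).val ∈ (chart1 E x₀ y₀).source := hv.symm ▸ hc
  refine jet_ext hc' ?_ rfl ?_
  · rw [hv]
    rfl
  · rw [jetLin_pStar₂ hc', jetLin_ofSecondPart hξ hc, hv]
    rfl

theorem IsSemiholonomicAt.hasFDerivAt_inCharts (hb : IsSemiholonomicAt b x)
    (h : b x ∈ (chart1 E x₀ y₀).source) :
    HasFDerivAt (inCharts 𝓘(ℝ, E) (I1 E) x₀ (basePt x₀ y₀) b)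
      (((ContinuousLinearMap.id ℝ E).prod (jetLin x₀ y₀ (b x))).prod
        (secondPart x₀ y₀ (jet1 (I1 E) b x))) (extChartAt 𝓘(ℝ, E) x₀ x) := by
  rw [← hb.jetLin_eq h]
  exact hasMFDerivAt_inCharts (hb.mem_source h) h (hb.smooth.mdifferentiableAt (by simp))

/-- Semi-holonomy identifies the derivative of β ∘ b with b(x). The strict form is what the local
inverse in `fieldAlong_spec` requires. -/
theorem IsSemiholonomicAt.hasStrictFDerivAt_val (hb : IsSemiholonomicAt b x)
    (h : b x ∈ (chart1 E x₀ y₀).source) :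
    HasStrictFDerivAt (inCharts 𝓘(ℝ, E) 𝓘(ℝ, E) x₀ y₀ (fun x' => (b x').val))
      (jetLin x₀ y₀ (b x)) (extChartAt 𝓘(ℝ, E) x₀ x) := by
  have hx := hb.mem_source h
  have hv := (mem_chart1_source.1 h).2
  have hs : ContMDiffAt 𝓘(ℝ, E) 𝓘(ℝ, E) ∞ (JetSpace.val ∘ b) x :=
    contMDiff_val.contMDiffAt.comp x hb.smooth
  have h1 := (contDiffAt_inCharts hx (g₀' := y₀) (f := JetSpace.val ∘ b) hv hs).hasStrictFDerivAt
    (by simp)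
  have h2 : jet1 𝓘(ℝ, E) (JetSpace.val ∘ b) x = b x := by
    rw [← map_jet1 (I1 E) 𝓘(ℝ, E) (JetSpace.val : J1 E M → M) b x
      (hb.smooth.mdifferentiableAt (by simp)) (contMDiff_val.mdifferentiable (by simp) _)]
    exact hb.pStar_eq
  rw [← jetLin_jet1 hx hv (hs.mdifferentiableAt (by simp)), h2] at h1
  exact h1

/-- The value and the derivative of a transported vector field, in charts. -/
theorem IsSemiholonomicAt.transport_spec (hb : IsSemiholonomicAt b x)
    (h : b x ∈ (chart1 E x₀ y₀).source) {Y : VField E M}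
    (hY : DifferentiableAt ℝ (coordField x₀ Y) (extChartAt 𝓘(ℝ, E) x₀ x)) :
    DifferentiableAt ℝ (coordField y₀ (transport b x Y)) (extChartAt 𝓘(ℝ, E) y₀ (b x).val) ∧
    (∀ w, fderiv ℝ (coordField y₀ (transport b x Y)) (extChartAt 𝓘(ℝ, E) y₀ (b x).val)
        (jetLin x₀ y₀ (b x) w) =
      secondPart x₀ y₀ (jet1 (I1 E) b x) w (coordField x₀ Y (extChartAt 𝓘(ℝ, E) x₀ x)) +
        jetLin x₀ y₀ (b x) (fderiv ℝ (coordField x₀ Y) (extChartAt 𝓘(ℝ, E) x₀ x) w)) ∧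
    coordField y₀ (transport b x Y) (extChartAt 𝓘(ℝ, E) y₀ (b x).val) =
      jetLin x₀ y₀ (b x) (coordField x₀ Y (extChartAt 𝓘(ℝ, E) x₀ x)) := by
  obtain ⟨A, hA⟩ := (jetLin_isInvertible_iff h).2 hb.mem
  have hx := hb.mem_source h
  have hv := (mem_chart1_source.1 h).2
  have hf := hb.hasStrictFDerivAt_val h
  rw [← hA] at hf
  -- Leibniz rule for u ↦ b(u) Y(u): the second part B arises from differentiating b, and A ∘ DY
  -- from differentiating Y.
  have hd := (hb.hasFDerivAt_inCharts h).snd.clm_apply hY.hasFDerivAt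
  have hb0 : (inCharts 𝓘(ℝ, E) (I1 E) x₀ (basePt x₀ y₀) b (extChartAt 𝓘(ℝ, E) x₀ x)).2 =
      jetLin x₀ y₀ (b x) := by
    rw [inCharts_apply hx, chart1_apply h]
  have hcv : ContinuousAt (fun x' => (b x').val) x :=
    (contMDiff_val.continuous.continuousAt).comp hb.smooth.continuousAt
  have key := fieldAlong_spec (f := fun x' => (b x').val) (W := fun x' => act (b x') Y)
    hx hv hcv hf (Ŵ := fun u => (inCharts 𝓘(ℝ, E) (I1 E) x₀ (basePt x₀ y₀) b u).2
      (coordField x₀ Y u)) ?_ hd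
  · refine ⟨key.1.differentiableAt, fun w => ?_, ?_⟩
    · unfold transport
      have hw : A.symm (jetLin x₀ y₀ (b x) w) = w := by
        rw [← hA]
        exact A.symm_apply_apply w
      rw [key.1.fderiv]
      simp only [ContinuousLinearMap.comp_apply, ContinuousLinearEquiv.coe_coe, hw, hb0,
        add_apply, ContinuousLinearMap.flip_apply]
      exact add_comm _ _
    · rw [coordField_apply hv]
      unfold transport
      rw [key.2, dchart_act h, hb.src_eq.self_of_nhds]
  · filter_upwards [eventually_mem_extChartAt_source hx, hb.src_eq,
      hb.smooth.continuousAt.eventually (eventually_mem_extChartAt_source h)] with x' h1 h2 h3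
    rw [dchart_act h3, inCharts_apply h1, chart1_apply h3, h2]

end SemiHolonomic

/-! ### Christoffel symbols of the symmetry jet -/

section Connection

variable {E : Type*} [NormedAddCommGroup E] [NormedSpace ℝ E]
  {M : Type*} [TopologicalSpace M] [ChartedSpace E M] [IsManifold 𝓘(ℝ, E) ∞ M]

variable {x₀ y₀ z₀ x : M} {ξ ξ' : J1 E M} {ζ ζ' : J2 E M} {b : M → J1 E M}
  {p : (E × E) × (E →L[ℝ] E)} {B : E →L[ℝ] E →L[ℝ] E} {s : M → J2 E M}

/-- The Christoffel symbols of the connection of `s` in the chart centred at `x₀`. -/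
def christoffel (s : M → J2 E M) (x₀ : M) (u : E) : E →L[ℝ] E →L[ℝ] E :=
  -(1 / 2 : ℝ) • secondPart x₀ x₀ (s ((extChartAt 𝓘(ℝ, E) x₀).symm u))

theorem negId_mem_source (hx : x ∈ (extChartAt 𝓘(ℝ, E) x₀).source) :
    (negId x : J1 E M) ∈ (chart1 E x₀ x₀).source :=
  mem_chart1_source.2 ⟨hx, hx⟩

theorem jetLin_negId (hx : x ∈ (extChartAt 𝓘(ℝ, E) x₀).source) :
    jetLin x₀ x₀ (negId x : J1 E M) = -ContinuousLinearMap.id ℝ E := by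
  ext v
  have h := (dchart_isInvertible' hx).self_apply_inverse v
  have h1 : jetLin x₀ x₀ (negId x : J1 E M) v =
      dchart 𝓘(ℝ, E) x₀ x (-((dchart 𝓘(ℝ, E) x₀ x).inverse v)) := rfl
  rw [h1, map_neg, h]
  rfl

theorem contDiffAt_christoffel (hs : IsSymmetryJet s) {u : E}
    (hu : u ∈ (extChartAt 𝓘(ℝ, E) x₀).target) : ContDiffAt ℝ ∞ (christoffel s x₀) u := by
  have hx := (extChartAt 𝓘(ℝ, E) x₀).map_target hu
  have hm : s ((extChartAt 𝓘(ℝ, E) x₀).symm u) ∈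
      (jetChart E (I1 E) x₀ (basePt x₀ x₀)).source := by
    refine mem_chart2_source (hs.mem _) ?_
    rw [hs.val_eq]
    exact negId_mem_source hx
  have h1 : ContMDiffAt 𝓘(ℝ, E) 𝓘(ℝ, E →L[ℝ] (E × E) × (E →L[ℝ] E)) ∞
      (fun u => jetLin x₀ (basePt x₀ x₀) (s ((extChartAt 𝓘(ℝ, E) x₀).symm u))) u :=
    (contMDiffAt_jetLin hm).comp u ((hs.smooth _).comp u (contMDiffAt_extChartAt_symm hu))
  have h2 : ContDiffAt ℝ ∞
      (fun u => secondPart x₀ x₀ (s ((extChartAt 𝓘(ℝ, E) x₀).symm u))) u :=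
    contDiffAt_const.clm_comp h1.contDiffAt
  exact h2.const_smul (-(1 / 2 : ℝ))

variable [FiniteDimensional ℝ E]

/-- The covariant derivative in a chart. -/
theorem dchart_cov (hs : IsSymmetryJet s) (hx : x ∈ (extChartAt 𝓘(ℝ, E) x₀).source)
    (v : TangentSpace 𝓘(ℝ, E) x) {Y : VField E M}
    (hY : DifferentiableAt ℝ (coordField x₀ Y) (extChartAt 𝓘(ℝ, E) x₀ x)) :
    dchart 𝓘(ℝ, E) x₀ x (cov s x v Y) =
      fderiv ℝ (coordField x₀ Y) (extChartAt 𝓘(ℝ, E) x₀ x) (dchart 𝓘(ℝ, E) x₀ x v) +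
        christoffel s x₀ (extChartAt 𝓘(ℝ, E) x₀ x) (dchart 𝓘(ℝ, E) x₀ x v)
          (coordField x₀ Y (extChartAt 𝓘(ℝ, E) x₀ x)) := by
  have : IsManifold 𝓘(ℝ, E) 1 M := .of_le (n := ∞) (by simp)
  have : CompleteSpace E := FiniteDimensional.complete ℝ E
  obtain ⟨hb, hj⟩ : IsLocalBisectionAt (E := E) (I1 E) (GL1 E M) (representative (s x)) (s x).src ∧
      jet1 (I1 E) (representative (s x)) (s x).src = s x :=
    @Classical.epsilon_spec _ (fun b : M → J1 E M =>
      IsLocalBisectionAt (E := E) (I1 E) (GL1 E M) b (s x).src ∧ jet1 (I1 E) b (s x).src = s x)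
      (hs.mem x).1
  rw [hs.src_eq] at hb hj
  set b := representative (s x) with hbdef
  have hbx : b x = negId x := (congrArg JetSpace.val hj).trans (hs.val_eq x)
  have hsh := hb.isSemiholonomicAt (hj ▸ hs.mem x)
  have hc : b x ∈ (chart1 E x₀ x₀).source := hbx ▸ negId_mem_source hx
  obtain ⟨h1, h2, h3⟩ := hsh.transport_spec hc hY
  rw [hj] at h2
  have hval : (b x).val = x := congrArg JetSpace.val hbx
  rw [hval] at h1 h2 h3
  rw [hbx, jetLin_negId hx] at h2 h3
  set V := transport b x Y with hV
  set u := extChartAt 𝓘(ℝ, E) x₀ x with hu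
  have hX : DifferentiableAt ℝ (coordField x₀ (FiberBundle.extend E v)) u :=
    (mdifferentiableAt_vField_iff hx).1 (FiberBundle.mdifferentiableAt_extend 𝓘(ℝ, E) E v)
  have hsum : coordField x₀ (Y + V) = coordField x₀ Y + coordField x₀ V := by
    ext u
    exact map_add _ _ _
  have hYV : DifferentiableAt ℝ (coordField x₀ (Y + V)) u := hsum ▸ hY.add h1
  have hX0 : coordField x₀ (FiberBundle.extend E v) u = dchart 𝓘(ℝ, E) x₀ x v := by
    rw [coordField_apply hx, FiberBundle.extend_apply_self]
  have hchr : christoffel s x₀ u = -(1 / 2 : ℝ) • secondPart x₀ x₀ (s x) := by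
    rw [christoffel, hu, (extChartAt 𝓘(ℝ, E) x₀).left_inv hx]
  unfold cov
  -- The first order part of s(x) is -I, so Y + s_x(Y) vanishes at x. The bracket term that
  -- differentiates the extension of v therefore drops out, and only the value v matters.
  have hzero : (coordField x₀ Y + coordField x₀ V) u = 0 := by
    rw [Pi.add_apply, h3]
    exact add_neg_cancel _
  rw [map_smul, dchart_mlieBracket hx hX hYV, VectorField.lieBracket, hX0, hsum, hzero,
    fderiv_add hY h1, hchr, map_zero, sub_zero]
  set w := dchart 𝓘(ℝ, E) x₀ x v
  have h2w := h2 w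
  simp only [neg_apply, ContinuousLinearMap.id_apply, map_neg] at h2w ⊢
  -- With A = -I the transport formula gives DV(w) = DY(w) - B(w,Y). Adding DY(w) and halving
  -- produces DY(w) - B(w,Y)/2, which is the origin of the factor in `christoffel`.
  have h2w' : fderiv ℝ (coordField x₀ V) u w = fderiv ℝ (coordField x₀ Y) u w -
      secondPart x₀ x₀ (s x) w (coordField x₀ Y u) := by
    rw [← neg_neg (fderiv ℝ (coordField x₀ V) u w), h2w]
    abel
  simp only [add_apply, h2w', smul_apply]
  module

theorem coordField_nabla (hs : IsSymmetryJet s) {X Y : VField E M} (hY : Y.Smooth) {u : E}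
    (hu : u ∈ (extChartAt 𝓘(ℝ, E) x₀).target) :
    coordField x₀ (nabla s X Y) u = fderiv ℝ (coordField x₀ Y) u (coordField x₀ X u) +
      christoffel s x₀ u (coordField x₀ X u) (coordField x₀ Y u) := by
  have hx := (extChartAt 𝓘(ℝ, E) x₀).map_target hu
  have hd : DifferentiableAt ℝ (coordField x₀ Y)
      (extChartAt 𝓘(ℝ, E) x₀ ((extChartAt 𝓘(ℝ, E) x₀).symm u)) := hY.differentiableAt hx
  have h := dchart_cov hs hx (X ((extChartAt 𝓘(ℝ, E) x₀).symm u)) hd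
  rw [(extChartAt 𝓘(ℝ, E) x₀).right_inv hu] at h
  exact h

theorem differentiableAt_nabla (hs : IsSymmetryJet s) {X Y : VField E M} (hX : X.Smooth)
    (hY : Y.Smooth) {u : E} (hu : u ∈ (extChartAt 𝓘(ℝ, E) x₀).target) :
    DifferentiableAt ℝ (coordField x₀ (nabla s X Y)) u := by
  have hX' := (hX.contDiffAt hu).differentiableAt (by simp)
  have hY' := (hY.contDiffAt hu).differentiableAt (by simp)
  have hY'' : DifferentiableAt ℝ (fderiv ℝ (coordField x₀ Y)) u :=
    ((hY.contDiffAt hu).fderiv_right (m := 1) (by exact WithTop.coe_le_coe.2 le_top)).differentiableAt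
      (by simp)
  have hG := (contDiffAt_christoffel hs hu).differentiableAt (by simp)
  refine ((hY''.clm_apply hX').add ((hG.clm_apply hX').clm_apply hY')).congr_of_eventuallyEq ?_
  filter_upwards [eventually_mem_extChartAt_target hu] with u' hu'
  exact coordField_nabla hs hY hu'

end Connection

/-! ### The unique affine (1,1)-jet over a 1-jet -/

section AffineExtension

variable {E : Type*} [NormedAddCommGroup E] [NormedSpace ℝ E]
  {M : Type*} [TopologicalSpace M] [ChartedSpace E M] [IsManifold 𝓘(ℝ, E) ∞ M]

variable {x₀ y₀ z₀ x : M} {ξ ξ' : J1 E M} {ζ ζ' : J2 E M} {b : M → J1 E M}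
  {p : (E × E) × (E →L[ℝ] E)} {B : E →L[ℝ] E →L[ℝ] E} {s : M → J2 E M}

/-- The second order part, in charts, of the affine (1,1)-jet over the 1-jet `p`. -/
def affForm (s : M → J2 E M) (x₀ y₀ : M) (p : (E × E) × (E →L[ℝ] E)) : E →L[ℝ] E →L[ℝ] E :=
  ContinuousLinearMap.compL ℝ E E E p.2 ∘L christoffel s x₀ p.1.1 -
    (ContinuousLinearMap.compL ℝ E E E).flip p.2 ∘L (christoffel s y₀ p.1.2 ∘L p.2)

theorem affForm_apply (w z : E) : affForm s x₀ y₀ p w z =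
    p.2 (christoffel s x₀ p.1.1 w z) - christoffel s y₀ p.1.2 (p.2 w) (p.2 z) := rfl

theorem contDiffAt_secondOrderForm {Γ Γ' : E → E →L[ℝ] E →L[ℝ] E}
    (h : ContDiffAt ℝ ∞ Γ p.1.1) (h' : ContDiffAt ℝ ∞ Γ' p.1.2) :
    ContDiffAt ℝ ∞ (fun p : (E × E) × (E →L[ℝ] E) =>
      ContinuousLinearMap.compL ℝ E E E p.2 ∘L Γ p.1.1 -
        (ContinuousLinearMap.compL ℝ E E E).flip p.2 ∘L (Γ' p.1.2 ∘L p.2)) p := by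
  have h1 : ContDiffAt ℝ ∞ (fun p : (E × E) × (E →L[ℝ] E) => Γ p.1.1) p :=
    h.comp p (contDiffAt_fst.fst)
  have h2 : ContDiffAt ℝ ∞ (fun p : (E × E) × (E →L[ℝ] E) => Γ' p.1.2) p :=
    h'.comp p (contDiffAt_fst.snd)
  have h3 : ContDiffAt ℝ ∞ (fun p : (E × E) × (E →L[ℝ] E) => p.2) p := contDiffAt_snd
  have h4 : ContDiffAt ℝ ∞ (fun p : (E × E) × (E →L[ℝ] E) =>
      ContinuousLinearMap.compL ℝ E E E p.2) p :=
    (ContinuousLinearMap.compL ℝ E E E).contDiff.contDiffAt.comp p h3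
  have h5 : ContDiffAt ℝ ∞ (fun p : (E × E) × (E →L[ℝ] E) =>
      (ContinuousLinearMap.compL ℝ E E E).flip p.2) p :=
    (ContinuousLinearMap.compL ℝ E E E).flip.contDiff.contDiffAt.comp p h3
  exact (h4.clm_comp h1).sub (h5.clm_comp (h2.clm_comp h3))

theorem contDiffAt_affForm (hs : IsSymmetryJet s) (hp : p ∈ (chart1 E x₀ y₀).target) :
    ContDiffAt ℝ ∞ (affForm s x₀ y₀) p :=
  have ht := mem_chart1_target.1 hp
  contDiffAt_secondOrderForm (contDiffAt_christoffel hs ht.1) (contDiffAt_christoffel hs ht.2)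

variable [FiniteDimensional ℝ E]

/-- The derivative of bY along AX is B(X,Y) + A DY(X). Adding Γ(AX,AY) and regrouping around A(DY(X)
+ Γ(X,Y)) leaves B minus `affForm` as the error, a tensor in X and Y. The third order computation
applies this at every nearby x'. -/
theorem dchart_cov_transport (hs : IsSymmetryJet s) (hb : IsSemiholonomicAt b x)
    (hc : b x ∈ (chart1 E x₀ y₀).source) {X Y : VField E M} (hY : Y.Smooth) :
    dchart 𝓘(ℝ, E) y₀ (b x).val (cov s (b x).val (act (b x) X) (transport b x Y)) =
      (secondPart x₀ y₀ (jet1 (I1 E) b x) - affForm s x₀ y₀ (chart1 E x₀ y₀ (b x)))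
        (coordField x₀ X (extChartAt 𝓘(ℝ, E) x₀ x)) (coordField x₀ Y (extChartAt 𝓘(ℝ, E) x₀ x)) +
      jetLin x₀ y₀ (b x) (coordField x₀ (nabla s X Y) (extChartAt 𝓘(ℝ, E) x₀ x)) := by
  have : CompleteSpace E := FiniteDimensional.complete ℝ E
  have hx := hb.mem_source hc
  have hv := (mem_chart1_source.1 hc).2
  obtain ⟨h1, h2, h3⟩ := hb.transport_spec hc (hY.differentiableAt hx)
  rw [dchart_cov hs hv _ h1, dchart_act hc, h3, hb.src_eq.self_of_nhds, h2,
    coordField_nabla hs hY ((extChartAt 𝓘(ℝ, E) x₀).map_source hx), sub_apply, sub_apply,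
    affForm_apply, chart1_apply hc, hb.src_eq.self_of_nhds, map_add]
  dsimp only
  abel

theorem act_nabla_eq_iff (hs : IsSymmetryJet s) (hb : IsSemiholonomicAt b x)
    (hc : b x ∈ (chart1 E x₀ y₀).source) {X Y : VField E M} (hY : Y.Smooth) :
    act (b x) (nabla s X Y) = cov s (b x).val (act (b x) X) (transport b x Y) ↔
      (secondPart x₀ y₀ (jet1 (I1 E) b x) - affForm s x₀ y₀ (chart1 E x₀ y₀ (b x)))
        (coordField x₀ X (extChartAt 𝓘(ℝ, E) x₀ x))
        (coordField x₀ Y (extChartAt 𝓘(ℝ, E) x₀ x)) = 0 := by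
  have hv := (mem_chart1_source.1 hc).2
  rw [← (dchart_isInvertible' hv).injective.eq_iff, dchart_cov_transport hs hb hc hY,
    dchart_act hc, hb.src_eq.self_of_nhds, right_eq_add]

/-- Supplies enough global test fields to pass from identities on fields to identities of
multilinear forms on E. -/
theorem exists_coordField_eq [T2Space M] (hx : x ∈ (extChartAt 𝓘(ℝ, E) x₀).source) (w : E) :
    ∃ Y : VField E M, Y.Smooth ∧ coordField x₀ Y (extChartAt 𝓘(ℝ, E) x₀ x) = w := by
  obtain ⟨Y, hY, h⟩ := exists_smooth_vField x ((dchart 𝓘(ℝ, E) x₀ x).inverse w)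
  refine ⟨Y, hY, ?_⟩
  rw [coordField_apply hx, h, (dchart_isInvertible' hx).self_apply_inverse]

/-- A semi-holonomic (1,1)-jet is affine if and only if its second order part is `affForm`. -/
theorem isAffine₂_iff [T2Space M] (hs : IsSymmetryJet s) (hζ : ζ ∈ SH2 E M)
    (hc : ζ.val ∈ (chart1 E x₀ y₀).source) :
    IsAffine₂ s ζ ↔ secondPart x₀ y₀ ζ = affForm s x₀ y₀ (chart1 E x₀ y₀ ζ.val) := by
  -- The base point is kept as a free variable x so that ζ can be replaced by `jet1 (I1 E) b x`;
  -- with `ζ.src` in its place the equation would be circular.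
  have key : ∀ (x : M) (b : M → J1 E M), x = ζ.src →
      IsLocalBisectionAt (E := E) (I1 E) (GL1 E M) b x → jet1 (I1 E) b x = ζ →
      ((∀ X Y : VField E M, X.Smooth → Y.Smooth →
        act ζ.val (nabla s X Y) = cov s ζ.val.val (act ζ.val X) (transport b x Y)) ↔
      secondPart x₀ y₀ ζ = affForm s x₀ y₀ (chart1 E x₀ y₀ ζ.val)) := by
    rintro x b - hb rfl
    have hsh := hb.isSemiholonomicAt hζ
    have hx := hsh.mem_source hc
    constructor
    · intro h
      refine sub_eq_zero.1 ?_
      ext w z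
      obtain ⟨X, hX, rfl⟩ := exists_coordField_eq hx w
      obtain ⟨Y, hY, rfl⟩ := exists_coordField_eq hx z
      exact (act_nabla_eq_iff hs hsh hc hY).1 (h X Y hX hY)
    · intro h X Y hX hY
      refine (act_nabla_eq_iff hs hsh hc hY).2 ?_
      have h' : secondPart x₀ y₀ (jet1 (I1 E) b x) - affForm s x₀ y₀ (chart1 E x₀ y₀ (b x)) = 0 :=
        sub_eq_zero.2 h
      rw [h']
      rfl
  constructor
  · rintro ⟨-, b, hb, hj, h⟩
    exact (key _ b rfl hb hj).1 h
  · intro h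
    obtain ⟨b, hb, hj⟩ := hζ.1
    exact ⟨hζ, b, hb, hj, (key _ b rfl hb hj).2 h⟩

/-- The affine (1,1)-jet over a 1-jet. -/
def affineExtension (s : M → J2 E M) (ξ : J1 E M) : J2 E M :=
  ofSecondPart ξ.src ξ.val ξ (affForm s ξ.src ξ.val (chart1 E ξ.src ξ.val ξ))

theorem affineExtension_src : (affineExtension s ξ).src = ξ.src := rfl

theorem affineExtension_val : (affineExtension s ξ).val = ξ := ofSecondPart_val mem_chart1_self

theorem affineExtension_mem (hξ : ξ ∈ (GL1 E M).carrier) : affineExtension s ξ ∈ SH2 E M :=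
  have : CompleteSpace E := FiniteDimensional.complete ℝ E
  ofSecondPart_mem hξ mem_chart1_self

variable [T2Space M]

theorem isAffine₂_affineExtension (hs : IsSymmetryJet s) (hξ : ξ ∈ (GL1 E M).carrier) :
    IsAffine₂ s (affineExtension s ξ) := by
  have : CompleteSpace E := FiniteDimensional.complete ℝ E
  have hc : (affineExtension s ξ).val ∈ (chart1 E ξ.src ξ.val).source := by
    rw [affineExtension_val]
    exact mem_chart1_self
  rw [isAffine₂_iff hs (affineExtension_mem hξ) hc, affineExtension_val]
  exact secondPart_ofSecondPart hξ mem_chart1_self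

/-- Being affine does not refer to charts. Hence the formula used at the charts centred at ξ holds
in every pair of charts, with no transformation law for Γ to compute. -/
theorem secondPart_affineExtension (hs : IsSymmetryJet s) (hξ : ξ ∈ (GL1 E M).carrier)
    (hc : ξ ∈ (chart1 E x₀ y₀).source) : secondPart x₀ y₀ (affineExtension s ξ) =
      affForm s x₀ y₀ (chart1 E x₀ y₀ ξ) := by
  have hc' : (affineExtension s ξ).val ∈ (chart1 E x₀ y₀).source := by rwa [affineExtension_val]
  have h := (isAffine₂_iff hs (affineExtension_mem hξ) hc').1 (isAffine₂_affineExtension hs hξ)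
  rwa [affineExtension_val] at h

theorem jetLin_affineExtension (hs : IsSymmetryJet s) (hξ : ξ ∈ (GL1 E M).carrier)
    (hc : ξ ∈ (chart1 E x₀ y₀).source) : jetLin x₀ (basePt x₀ y₀) (affineExtension s ξ) =
      ((ContinuousLinearMap.id ℝ E).prod (jetLin x₀ y₀ ξ)).prod
        (affForm s x₀ y₀ (chart1 E x₀ y₀ ξ)) := by
  have hc' : (affineExtension s ξ).val ∈ (chart1 E x₀ y₀).source := by rwa [affineExtension_val]
  rw [SH2_jetLin (affineExtension_mem hξ) hc', secondPart_affineExtension hs hξ hc,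
    affineExtension_val]

theorem eq_affineExtension (hs : IsSymmetryJet s) (hζ : ζ ∈ SH2 E M) (hv : ζ.val = ξ)
    (hc : ξ ∈ (chart1 E x₀ y₀).source)
    (h : secondPart x₀ y₀ ζ = affForm s x₀ y₀ (chart1 E x₀ y₀ ξ)) : ζ = affineExtension s ξ := by
  have hξ : ξ ∈ (GL1 E M).carrier := hv ▸ SH2_val_mem hζ
  refine SH2_ext (x₀ := x₀) (y₀ := y₀) hζ (affineExtension_mem hξ) (hv ▸ hc)
    (hv.trans affineExtension_val.symm) ?_
  rw [h, secondPart_affineExtension hs hξ hc]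

theorem eq_affineExtension_of_isAffine₂ (hs : IsSymmetryJet s) (h : IsAffine₂ s ζ) :
    ζ = affineExtension s ζ.val :=
  eq_affineExtension hs h.1 rfl mem_chart1_self ((isAffine₂_iff hs h.1 mem_chart1_self).1 h)

theorem contMDiffAt_affineExtension (hs : IsSymmetryJet s) (hξ : ξ ∈ (GL1 E M).carrier) :
    ContMDiffAt (I1 E) (I2 E) ∞ (affineExtension s) ξ := by
  have : CompleteSpace E := FiniteDimensional.complete ℝ E
  have hc := mem_chart1_self (ξ := ξ)
  have hc' : (affineExtension s ξ).val ∈ (chart1 E ξ.src ξ.val).source := by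
    rwa [affineExtension_val]
  refine contMDiffAt_jet (J := I1 E) le_rfl (mem_chart2_source (affineExtension_mem hξ) hc')
    contMDiff_src.contMDiffAt ?_ ?_
  · simp only [affineExtension_val]
    exact contMDiffAt_id
  · have h1 : ContMDiffAt (I1 E) 𝓘(ℝ, E →L[ℝ] E) ∞ (jetLin ξ.src ξ.val) ξ := contMDiffAt_jetLin hc
    have h2 : ContMDiffAt (I1 E) 𝓘(ℝ, E →L[ℝ] E →L[ℝ] E) ∞
        (fun ξ' => affForm s ξ.src ξ.val (chart1 E ξ.src ξ.val ξ')) ξ :=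
      ContMDiffAt.comp ξ (I' := 𝓘(ℝ, (E × E) × (E →L[ℝ] E)))
        (contDiffAt_affForm hs ((chart1 E ξ.src ξ.val).map_source hc)).contMDiffAt
        (contMDiffAt_extChartAt_of_mem hc)
    -- Pairing of linear maps is written through the injections `inl` and `inr`, which makes it
    -- visibly smooth in both arguments.
    have h3 : ContDiff ℝ ∞ (fun q : (E →L[ℝ] E) × (E →L[ℝ] E →L[ℝ] E) =>
        ((ContinuousLinearMap.id ℝ E).prod q.1).prod q.2) := by
      have h4 : (fun q : (E →L[ℝ] E) × (E →L[ℝ] E →L[ℝ] E) =>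
          ((ContinuousLinearMap.id ℝ E).prod q.1).prod q.2) = fun q =>
          ContinuousLinearMap.inl ℝ (E × E) (E →L[ℝ] E) ∘L (ContinuousLinearMap.inl ℝ E E +
            ContinuousLinearMap.inr ℝ E E ∘L q.1) +
            ContinuousLinearMap.inr ℝ (E × E) (E →L[ℝ] E) ∘L q.2 := by
        funext q
        ext1 w
        simp
      rw [h4]
      exact (contDiff_const.clm_comp (contDiff_const.add (contDiff_const.clm_comp contDiff_fst))).add
        (contDiff_const.clm_comp contDiff_snd)
    refine (ContMDiffAt.comp ξ h3.contMDiff.contMDiffAt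
      (h1.prodMk_space h2)).congr_of_eventuallyEq ?_
    filter_upwards [eventually_mem_extChartAt_source hc, isOpen_GL1.mem_nhds hξ] with ξ' h4 h5
    exact jetLin_affineExtension hs h5 h4

theorem christoffel_extChartAt (hx : x ∈ (extChartAt 𝓘(ℝ, E) x₀).source) :
    christoffel s x₀ (extChartAt 𝓘(ℝ, E) x₀ x) = -(1 / 2 : ℝ) • secondPart x₀ x₀ (s x) := by
  rw [christoffel, (extChartAt 𝓘(ℝ, E) x₀).left_inv hx]

/-- At A = -I the form is -Γ(w,z) - Γ(-w,-z) = -2Γ(w,z), which is the second part of s(x) by the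
definition of Γ. -/
theorem affineExtension_negId (hs : IsSymmetryJet s) (x : M) :
    affineExtension s (negId x) = s x := by
  have hx := mem_extChartAt_source (I := 𝓘(ℝ, E)) x
  refine (eq_affineExtension hs (hs.mem x) (hs.val_eq x) (negId_mem_source hx) ?_).symm
  ext w z
  rw [affForm_apply, chart1_apply (negId_mem_source hx), jetLin_negId hx]
  have h1 : (negId x : J1 E M).src = x := rfl
  have h2 : (negId x : J1 E M).val = x := rfl
  simp only [h1, h2, christoffel_extChartAt hx, neg_apply, smul_apply, ContinuousLinearMap.id_apply, map_neg]
  module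

end AffineExtension

/-! ### Products of jets in charts -/

section Products

variable {E : Type*} [NormedAddCommGroup E] [NormedSpace ℝ E]
  {M : Type*} [TopologicalSpace M] [ChartedSpace E M]

/-- The product of the groupoid `GL1`, extended by a junk value to all pairs of 1-jets. -/
def mulJet (ξ' ξ : J1 E M) : J1 E M :=
  .mk ξ.src ξ'.val (ContinuousLinearMap.comp (σ₁₂ := RingHom.id ℝ) (σ₂₃ := RingHom.id ℝ)
    (M₁ := E) (M₂ := E) (M₃ := E) ξ'.lin ξ.lin)

variable {x₀ y₀ z₀ x : M} {ξ ξ' η : J1 E M}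

theorem jet1_congr {F : Type*} [NormedAddCommGroup F] [NormedSpace ℝ F]
    {H : Type*} [TopologicalSpace H] {J : ModelWithCorners ℝ F H}
    {G : Type*} [TopologicalSpace G] [ChartedSpace H G] {f g : M → G} (h : f =ᶠ[𝓝 x] g) :
    (jet1 J f x : JetSpace E M J G) = jet1 J g x := by
  unfold jet1
  rw [h.mfderiv_eq, h.self_of_nhds]

/-- Replaces the relational product, with its dependent endpoints, by an honest function that can be
differentiated along bisections. -/
theorem GL1_isMul_iff : (GL1 E M).IsMul ξ' ξ η ↔ ξ'.src = ξ.val ∧ η = mulJet ξ' ξ := by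
  constructor
  · rintro ⟨x, y, z, A, B, rfl, rfl, rfl⟩
    exact ⟨rfl, rfl⟩
  · rintro ⟨h, rfl⟩
    obtain ⟨⟨x, y⟩, A⟩ := ξ
    obtain ⟨⟨y', z⟩, B⟩ := ξ'
    obtain rfl : y' = y := h
    exact ⟨x, y', z, A, B, rfl, rfl, rfl⟩

variable [IsManifold 𝓘(ℝ, E) ∞ M] {ζ ζ' : J2 E M} {b b' c : M → J1 E M} {s : M → J2 E M}

theorem mulJet_mem_source (hc : ξ ∈ (chart1 E x₀ y₀).source) (hc' : ξ' ∈ (chart1 E y₀ z₀).source) :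
    mulJet ξ' ξ ∈ (chart1 E x₀ z₀).source :=
  mem_chart1_source.2 ⟨(mem_chart1_source.1 hc).1, (mem_chart1_source.1 hc').2⟩

theorem jetLin_mulJet (h : ξ'.src = ξ.val) (hc : ξ ∈ (chart1 E x₀ y₀).source) :
    jetLin x₀ z₀ (mulJet ξ' ξ) = jetLin y₀ z₀ ξ' ∘L jetLin x₀ y₀ ξ := by
  obtain ⟨⟨x, y⟩, A⟩ := ξ
  obtain ⟨⟨y', z⟩, B⟩ := ξ'
  obtain rfl : y' = y := h
  have hi : (dchart 𝓘(ℝ, E) y₀ y').IsInvertible := dchart_isInvertible' (mem_chart1_source.1 hc).2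
  ext v
  have h1 := hi.inverse_apply_self (A ((dchart 𝓘(ℝ, E) x₀ x).inverse v))
  exact (congrArg (fun w => dchart 𝓘(ℝ, E) z₀ z (B w)) h1).symm

theorem mulJet_mem (h : ξ'.src = ξ.val) (hξ : ξ ∈ (GL1 E M).carrier)
    (hξ' : ξ' ∈ (GL1 E M).carrier) : mulJet ξ' ξ ∈ (GL1 E M).carrier := by
  have hc := mem_chart1_self (ξ := ξ)
  have hc' : ξ' ∈ (chart1 E ξ.val ξ'.val).source := h ▸ mem_chart1_self (ξ := ξ')
  rw [← jetLin_isInvertible_iff (mulJet_mem_source hc hc'), jetLin_mulJet h hc]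
  exact ((jetLin_isInvertible_iff hc').2 hξ').comp ((jetLin_isInvertible_iff hc).2 hξ)

theorem contMDiffAt_mulJet (hb : ContMDiffAt 𝓘(ℝ, E) (I1 E) ∞ b x)
    (hb' : ContMDiffAt 𝓘(ℝ, E) (I1 E) ∞ b' (b x).val)
    (h : ∀ᶠ y in 𝓝 (b x).val, (b' y).src = y) :
    ContMDiffAt 𝓘(ℝ, E) (I1 E) ∞ (fun x' => mulJet (b' (b x').val) (b x')) x := by
  have hv : ContMDiffAt 𝓘(ℝ, E) 𝓘(ℝ, E) ∞ (fun x' => (b x').val) x :=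
    contMDiff_val.contMDiffAt.comp x hb
  have hbb : ContMDiffAt 𝓘(ℝ, E) (I1 E) ∞ (fun x' => b' (b x').val) x := hb'.comp x hv
  have hc := mem_chart1_self (ξ := b x)
  have hc' : b' (b x).val ∈ (chart1 E (b x).val (b' (b x).val).val).source := by
    have h1 := mem_chart1_self (ξ := b' (b x).val)
    rwa [h.self_of_nhds] at h1
  have hs : ContMDiffAt 𝓘(ℝ, E) 𝓘(ℝ, E) ∞ (fun x' => (b x').src) x :=
    contMDiff_src.contMDiffAt.comp x hb
  have hv' : ContMDiffAt 𝓘(ℝ, E) 𝓘(ℝ, E) ∞ (fun x' => (b' (b x').val).val) x :=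
    contMDiff_val.contMDiffAt.comp x hbb
  refine contMDiffAt_jet (J := 𝓘(ℝ, E)) (x₀ := (b x).src) (g₀ := (b' (b x).val).val) le_rfl
    (mulJet_mem_source hc hc') hs hv' ?_
  have h1 : ContMDiffAt 𝓘(ℝ, E) 𝓘(ℝ, E →L[ℝ] E) ∞ (fun x' => jetLin (b x).src (b x).val (b x')) x :=
    ContMDiffAt.comp x (contMDiffAt_jetLin hc) hb
  have h2 : ContMDiffAt 𝓘(ℝ, E) 𝓘(ℝ, E →L[ℝ] E) ∞
      (fun x' => jetLin (b x).val (b' (b x).val).val (b' (b x').val)) x :=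
    ContMDiffAt.comp x (contMDiffAt_jetLin hc') hbb
  refine (h2.clm_comp h1).congr_of_eventuallyEq ?_
  filter_upwards [hv.continuousAt.eventually h, hb.continuousAt.eventually
    (eventually_mem_extChartAt_source hc)] with x' h3 h4
  exact jetLin_mulJet h3 h4

theorem pStar₂_jet1 (hb : ContMDiffAt 𝓘(ℝ, E) (I1 E) ∞ b x) :
    pStar₂ (jet1 (I1 E) b x) = jet1 𝓘(ℝ, E) (fun x' => (b x').val) x :=
  map_jet1 (I1 E) 𝓘(ℝ, E) (JetSpace.val : J1 E M → M) b x
    (hb.mdifferentiableAt (by simp)) (contMDiff_val.mdifferentiable (by simp) _)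

variable [CompleteSpace E]

/-- The germ b is not assumed to be a bisection. Its jet has the coordinates of an `ofSecondPart`
jet, and that one is represented by a genuine bisection. -/
theorem IsSemiholonomicAt.jet1_mem (hb : IsSemiholonomicAt b x) : jet1 (I1 E) b x ∈ SH2 E M := by
  have hc := mem_chart1_self (ξ := b x)
  have h : jet1 (I1 E) b x = ofSecondPart (b x).src (b x).val (b x)
      (secondPart (b x).src (b x).val (jet1 (I1 E) b x)) := by
    refine jet_ext (x₀ := (b x).src) (g₀ := basePt (b x).src (b x).val) ?_ ?_ ?_ ?_
    · exact mem_jetChart_source.2 ⟨hb.mem_source hc, hc⟩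
    · exact hb.src_eq.self_of_nhds.symm
    · exact (ofSecondPart_val hc).symm
    · rw [jetLin_ofSecondPart hb.mem hc, hb.jetLin_eq hc]
  rw [h]
  exact ofSecondPart_mem hb.mem hc

theorem IsSemiholonomicAt.mul (hb : IsSemiholonomicAt b x) (hb' : IsSemiholonomicAt b' (b x).val) :
    IsSemiholonomicAt (fun x' => mulJet (b' (b x').val) (b x')) x := by
  have hsm := contMDiffAt_mulJet hb.smooth hb'.smooth hb'.src_eq
  have hs' := hb'.src_eq.self_of_nhds
  refine ⟨hsm, hb.src_eq, mulJet_mem hs' hb.mem hb'.mem, ?_⟩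
  rw [pStar₂_jet1 hsm]
  have hc := mem_chart1_self (ξ := b x)
  have hc' : b' (b x).val ∈ (chart1 E (b x).val (b' (b x).val).val).source := by
    have h1 := mem_chart1_self (ξ := b' (b x).val)
    rwa [hs'] at h1
  have hx := hb.mem_source hc
  have hmem := mulJet_mem_source hc hc'
  have hv : ContMDiffAt 𝓘(ℝ, E) 𝓘(ℝ, E) ∞ (fun x' => (b x').val) x :=
    contMDiff_val.contMDiffAt.comp x hb.smooth
  have hv' : ContMDiffAt 𝓘(ℝ, E) 𝓘(ℝ, E) ∞ (fun x' => (b' x').val) (b x).val :=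
    contMDiff_val.contMDiffAt.comp _ hb'.smooth
  have e1 : jet1 𝓘(ℝ, E) (fun x' => (b x').val) x = b x :=
    (pStar₂_jet1 hb.smooth).symm.trans hb.pStar_eq
  have e2 : jet1 𝓘(ℝ, E) (fun x' => (b' x').val) (b x).val = b' (b x).val :=
    (pStar₂_jet1 hb'.smooth).symm.trans hb'.pStar_eq
  refine Eq.symm ?_
  refine jet_ext hmem (hb.src_eq.self_of_nhds) rfl ?_
  rw [jetLin_mulJet hs' hc]
  have h3 : jet1 𝓘(ℝ, E) (fun x' => (mulJet (b' (b x').val) (b x')).val) x =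
      (jet1 𝓘(ℝ, E) (fun x' => (b x').val) x : J1 E M).map 𝓘(ℝ, E) (fun x' => (b' x').val) :=
    (map_jet1 𝓘(ℝ, E) 𝓘(ℝ, E) (fun x' => (b' x').val) (fun x' => (b x').val) x
      (hv.mdifferentiableAt (by simp)) (hv'.mdifferentiableAt (by simp))).symm
  rw [e1] at h3
  rw [h3, jetLin_map (g₀ := (b x).val) (mem_chart1_source.1 hc).2 (mem_chart1_source.1 hc').2
    (hv'.mdifferentiableAt (by simp))]
  rw [← jetLin_jet1 (mem_chart1_source.1 hc).2 (mem_chart1_source.1 hc').2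
    (hv'.mdifferentiableAt (by simp)), e2]

/-- The second order part of a product. -/
theorem secondPart_mulJet (hb : IsSemiholonomicAt b x) (hb' : IsSemiholonomicAt b' (b x).val)
    (hm : ∀ᶠ x' in 𝓝 x, c x' = mulJet (b' (b x').val) (b x'))
    (hc : b x ∈ (chart1 E x₀ y₀).source) (hc' : b' (b x).val ∈ (chart1 E y₀ z₀).source) (w z : E) :
    secondPart x₀ z₀ (jet1 (I1 E) c x : J2 E M) w z =
      secondPart y₀ z₀ (jet1 (I1 E) b' (b x).val) (jetLin x₀ y₀ (b x) w) (jetLin x₀ y₀ (b x) z) +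
        jetLin y₀ z₀ (b' (b x).val) (secondPart x₀ y₀ (jet1 (I1 E) b x) w z) := by
  have hx := hb.mem_source hc
  have hv : ContMDiffAt 𝓘(ℝ, E) 𝓘(ℝ, E) ∞ (fun x' => (b x').val) x :=
    contMDiff_val.contMDiffAt.comp x hb.smooth
  have e : (jet1 (I1 E) c x : J2 E M) = jet1 (I1 E) (fun x' => mulJet (b' (b x').val) (b x')) x :=
    jet1_congr hm
  rw [e]
  have h1 := (hb.hasFDerivAt_inCharts hc).snd
  have h2 := (hb'.hasFDerivAt_inCharts hc').snd
  have h3 := (hb.hasStrictFDerivAt_val hc).hasFDerivAt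
  have h4 := ((hb.mul hb').hasFDerivAt_inCharts (mulJet_mem_source hc hc')).snd
  have hv0 : inCharts 𝓘(ℝ, E) 𝓘(ℝ, E) x₀ y₀ (fun x' => (b x').val) (extChartAt 𝓘(ℝ, E) x₀ x) =
      extChartAt 𝓘(ℝ, E) y₀ (b x).val := inCharts_apply hx
  rw [← hv0] at h2
  have h5 := (h2.comp _ h3).clm_comp h1
  have h6 : (fun u => (inCharts 𝓘(ℝ, E) (I1 E) x₀ (basePt x₀ z₀)
      (fun x' => mulJet (b' (b x').val) (b x')) u).2) =ᶠ[𝓝 (extChartAt 𝓘(ℝ, E) x₀ x)] fun u =>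
      ((inCharts 𝓘(ℝ, E) (I1 E) y₀ (basePt y₀ z₀) b'
        (inCharts 𝓘(ℝ, E) 𝓘(ℝ, E) x₀ y₀ (fun x' => (b x').val) u)).2).comp
      (inCharts 𝓘(ℝ, E) (I1 E) x₀ (basePt x₀ y₀) b u).2 := by
    have hall : ∀ᶠ x' in 𝓝 x, b x' ∈ (chart1 E x₀ y₀).source ∧
        b' (b x').val ∈ (chart1 E y₀ z₀).source ∧ (b' (b x').val).src = (b x').val := by
      filter_upwards [hb.smooth.continuousAt.eventually (eventually_mem_extChartAt_source hc),
        hv.continuousAt.eventually (hb'.smooth.continuousAt.eventually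
          (eventually_mem_extChartAt_source hc')), hv.continuousAt.eventually hb'.src_eq]
        with x' h1 h2 h3
      exact ⟨h1, h2, h3⟩
    filter_upwards [eventually_extChartAt_symm hx hall] with u hu
    obtain ⟨g1, g2, g3⟩ := hu
    have k1 : inCharts 𝓘(ℝ, E) (I1 E) y₀ (basePt y₀ z₀) b'
        (inCharts 𝓘(ℝ, E) 𝓘(ℝ, E) x₀ y₀ (fun x' => (b x').val) u) =
        chart1 E y₀ z₀ (b' (b ((extChartAt 𝓘(ℝ, E) x₀).symm u)).val) :=
      inCharts_apply (mem_chart1_source.1 g1).2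
    rw [k1]
    simp only [inCharts, Function.comp_apply]
    rw [chart1_apply g1, chart1_apply g2, chart1_apply (mulJet_mem_source g1 g2)]
    exact jetLin_mulJet g3 g1
  -- Two derivatives of the linear part of the product are compared: the one defining its second
  -- part, and the Leibniz and chain rule expansion of A'(f(u)) ∘ A(u) with f the target map of b.
  have h7 := (h4.congr_of_eventuallyEq h6.symm).unique h5
  have h8 := congrArg (fun L : E →L[ℝ] E →L[ℝ] E => L w z) h7
  have k1 : (inCharts 𝓘(ℝ, E) (I1 E) x₀ (basePt x₀ y₀) b (extChartAt 𝓘(ℝ, E) x₀ x)).2 =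
      jetLin x₀ y₀ (b x) := by
    rw [inCharts_apply hx, chart1_apply hc]
  have k2 : (inCharts 𝓘(ℝ, E) (I1 E) y₀ (basePt y₀ z₀) b' (extChartAt 𝓘(ℝ, E) y₀ (b x).val)).2 =
      jetLin y₀ z₀ (b' (b x).val) := by
    rw [inCharts_apply (mem_chart1_source.1 hc).2, chart1_apply hc']
  rw [← k1, ← k2, ← hv0]
  refine h8.trans ?_
  rw [k1]
  simp [add_comm]

end Products

/-! ### The affine extension is a morphism, and the only one -/

section Morphism

variable {E : Type*} [NormedAddCommGroup E] [NormedSpace ℝ E] [FiniteDimensional ℝ E]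
  {M : Type*} [TopologicalSpace M] [ChartedSpace E M] [IsManifold 𝓘(ℝ, E) ∞ M]

variable {x₀ y₀ z₀ x : M} {ξ ξ' η : J1 E M} {ζ ζ' θ : J2 E M} {b b' c : M → J1 E M} {s : M → J2 E M}
  {S : J1 E M → J2 E M}

theorem negId_mem (x : M) : negId x ∈ (GL1 E M).carrier :=
  ⟨ContinuousLinearEquiv.neg ℝ, by ext v; rfl⟩

theorem secondPart_of_isMul (hζ' : ζ' ∈ SH2 E M) (hζ : ζ ∈ SH2 E M)
    (h : (NH2 E M).IsMul ζ' ζ θ) (hc : ζ.val ∈ (chart1 E x₀ y₀).source)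
    (hc' : ζ'.val ∈ (chart1 E y₀ z₀).source) (w z : E) :
    secondPart x₀ z₀ θ w z =
      secondPart y₀ z₀ ζ' (jetLin x₀ y₀ ζ.val w) (jetLin x₀ y₀ ζ.val z) +
        jetLin y₀ z₀ ζ'.val (secondPart x₀ y₀ ζ w z) := by
  have : CompleteSpace E := FiniteDimensional.complete ℝ E
  obtain ⟨x, b', b, c, hb, hb', hm, rfl, rfl, rfl⟩ := h
  exact secondPart_mulJet (hb.isSemiholonomicAt hζ) (hb'.isSemiholonomicAt hζ')
    (hm.mono fun x' h => (GL1_isMul_iff.1 h).2) hc hc' w z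

variable [T2Space M]

/-- With `affForm` on both factors the product has second part Γ_y(A·,A·) pushed by A' minus Γ_z,
plus A'AΓ_x minus A'Γ_y(A·,A·). The two middle terms cancel and `affForm` of the product remains. -/
theorem affineExtension_isMul_of_bisections (hs : IsSymmetryJet s)
    (hb : IsLocalBisectionAt (E := E) (I1 E) (GL1 E M) b x)
    (hj : jet1 (I1 E) b x = affineExtension s (b x))
    (hb' : IsLocalBisectionAt (E := E) (I1 E) (GL1 E M) b' (b x).val)
    (hj' : jet1 (I1 E) b' (b x).val = affineExtension s (b' (b x).val))
    (hξ : b x ∈ (GL1 E M).carrier) (hξ' : b' (b x).val ∈ (GL1 E M).carrier) :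
    (NH2 E M).IsMul (affineExtension s (b' (b x).val)) (affineExtension s (b x))
      (affineExtension s (mulJet (b' (b x).val) (b x))) := by
  have : CompleteSpace E := FiniteDimensional.complete ℝ E
  have hsb := hb.isSemiholonomicAt (hj ▸ affineExtension_mem hξ)
  have hsb' := hb'.isSemiholonomicAt (hj' ▸ affineExtension_mem hξ')
  have hsrc := hsb'.src_eq.self_of_nhds
  have hc := mem_chart1_self (ξ := b x)
  have hc' : b' (b x).val ∈ (chart1 E (b x).val (b' (b x).val).val).source := by
    have h1 := mem_chart1_self (ξ := b' (b x).val)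
    rwa [hsrc] at h1
  have hv : Tendsto (fun x' => (b x').val) (𝓝 x) (𝓝 (b x).val) :=
    (contMDiff_val.contMDiffAt.comp x hb.contMDiffAt).continuousAt
  refine ⟨x, b', b, fun x' => mulJet (b' (b x').val) (b x'), hb, hb', ?_, hj.symm, hj'.symm, ?_⟩
  · filter_upwards [hv.eventually hsb'.src_eq] with x' h using GL1_isMul_iff.2 ⟨h, rfl⟩
  · refine (eq_affineExtension (ξ := mulJet (b' (b x).val) (b x)) hs
      (hsb.mul hsb').jet1_mem rfl (mulJet_mem_source hc hc') ?_).symm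
    ext w z
    rw [secondPart_mulJet hsb hsb' (Eventually.of_forall fun _ => rfl) hc hc', hj, hj',
      secondPart_affineExtension hs hξ hc, secondPart_affineExtension hs hξ' hc',
      affForm_apply, affForm_apply, affForm_apply, chart1_apply hc, chart1_apply hc',
      chart1_apply (mulJet_mem_source hc hc'), jetLin_mulJet hsrc hc]
    simp only [ContinuousLinearMap.comp_apply, map_sub, hsrc]
    exact sub_add_sub_cancel' _ _ _

theorem affineExtension_isMul (hs : IsSymmetryJet s) (h : ξ'.src = ξ.val)
    (hξ : ξ ∈ (GL1 E M).carrier) (hξ' : ξ' ∈ (GL1 E M).carrier) :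
    (NH2 E M).IsMul (affineExtension s ξ') (affineExtension s ξ)
      (affineExtension s (mulJet ξ' ξ)) := by
  obtain ⟨b, hb, hj⟩ := (affineExtension_mem (s := s) hξ).1
  obtain ⟨b', hb', hj'⟩ := (affineExtension_mem (s := s) hξ').1
  rw [affineExtension_src] at hb hj hb' hj'
  have hv : b ξ.src = ξ := (congrArg JetSpace.val hj).trans affineExtension_val
  have hv' : b' ξ'.src = ξ' := (congrArg JetSpace.val hj').trans affineExtension_val
  rw [h] at hb' hj' hv'
  -- The source becomes a free variable, after which ξ and ξ' can be eliminated in favour of the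
  -- values of b and b'.
  generalize ξ.src = x at *
  subst hv
  subst hv'
  exact affineExtension_isMul_of_bisections hs hb hj hb' hj' hξ hξ'

theorem isAffineExtension_affineExtension (hs : IsSymmetryJet s) :
    IsAffineExtension s (affineExtension s) where
  morphism :=
    { smooth := fun _ hξ => (contMDiffAt_affineExtension hs hξ).contMDiffWithinAt
      mapsTo := fun _ hξ => (affineExtension_mem hξ).1
      src_eq := fun _ _ => rfl
      tgt_eq := fun _ _ => congrArg JetSpace.val affineExtension_val
      map_mul := by
        intro ξ' hξ' ξ hξ η _ h
        obtain ⟨h', rfl⟩ := GL1_isMul_iff.1 h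
        exact affineExtension_isMul hs h' hξ hξ' }
  mem := fun _ hξ => affineExtension_mem hξ
  val_eq := fun _ _ => affineExtension_val
  negId_eq := affineExtension_negId hs

theorem mulJet_negId : mulJet ξ (negId ξ.src) = mulJet (negId ξ.val) ξ := by
  refine congrArg (JetSpace.mk (J := 𝓘(ℝ, E)) ξ.src ξ.val) ?_
  ext v
  exact map_neg ξ.lin v

/-- Since -I is central, S(ξ)·s(x) and s(y)·S(ξ) are both S(-ξ). In the first product B enters with
sign +, because it is evaluated at (-w,-z); in the second with sign -, because it is followed by -I.
So B does not cancel and is determined. -/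
theorem IsAffineExtension.eqOn (hs : IsSymmetryJet s) (h : IsAffineExtension s S) :
    EqOn S (affineExtension s) (GL1 E M).carrier := by
  intro ξ hξ
  have : CompleteSpace E := FiniteDimensional.complete ℝ E
  have hm := mulJet_mem (ξ' := ξ) (ξ := negId ξ.src) rfl (negId_mem _) hξ
  have hc := mem_chart1_self (ξ := ξ)
  have hx := (mem_chart1_source.1 hc).1
  have hy := (mem_chart1_source.1 hc).2
  have h1 := h.morphism.map_mul ξ hξ _ (negId_mem ξ.src) _ hm (GL1_isMul_iff.2 ⟨rfl, rfl⟩)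
  have h2 := h.morphism.map_mul _ (negId_mem ξ.val) ξ hξ _ hm
    (GL1_isMul_iff.2 ⟨rfl, mulJet_negId⟩)
  rw [h.negId_eq] at h1 h2
  refine eq_affineExtension hs (h.mem ξ hξ) (h.val_eq ξ hξ) hc ?_
  ext w z
  have hcx : (s ξ.src).val ∈ (chart1 E ξ.src ξ.src).source := by
    rw [hs.val_eq]
    exact negId_mem_source hx
  have hcy : (s ξ.val).val ∈ (chart1 E ξ.val ξ.val).source := by
    rw [hs.val_eq]
    exact negId_mem_source hy
  have hcS : (S ξ).val ∈ (chart1 E ξ.src ξ.val).source := by rwa [h.val_eq ξ hξ]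
  have e1 := secondPart_of_isMul (h.mem ξ hξ) (hs.mem _) h1 hcx hcS w z
  have e2 := secondPart_of_isMul (hs.mem _) (h.mem ξ hξ) h2 hcS hcy w z
  rw [e1, h.val_eq ξ hξ, hs.val_eq, hs.val_eq, jetLin_negId hx, jetLin_negId hy] at e2
  rw [affForm_apply, chart1_apply hc, christoffel_extChartAt hx, christoffel_extChartAt hy]
  simp only [neg_apply, smul_apply, ContinuousLinearMap.id_apply, map_neg, neg_neg, map_smul] at e2 ⊢
  have e3 : (2 : ℝ) • secondPart ξ.src ξ.val (S ξ) w z =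
      secondPart ξ.val ξ.val (s ξ.val) (jetLin ξ.src ξ.val ξ w) (jetLin ξ.src ξ.val ξ z) -
        jetLin ξ.src ξ.val ξ (secondPart ξ.src ξ.src (s ξ.src) w z) := by
    rw [two_smul, eq_sub_iff_add_eq, add_assoc, e2]
    abel
  rw [← sub_eq_zero] at e3 ⊢
  have e4 := congrArg (fun v => (1 / 2 : ℝ) • v) e3
  simp only [smul_zero] at e4
  rw [← e4]
  module

end Morphism

/-! ### The extension to (1,1,1)-jets -/

section ThirdExtension

variable {E : Type*} [NormedAddCommGroup E] [NormedSpace ℝ E] [FiniteDimensional ℝ E]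
  {M : Type*} [TopologicalSpace M] [ChartedSpace E M] [IsManifold 𝓘(ℝ, E) ∞ M]

variable {x : M} {ξ ξ' η : J1 E M} {b b' c : M → J1 E M} {s : M → J2 E M}

theorem IsLocalBisectionAt.eventually_mem
    (hb : IsLocalBisectionAt (E := E) (I1 E) (GL1 E M) b x) :
    ∀ᶠ x' in 𝓝 x, b x' ∈ (GL1 E M).carrier := by
  obtain ⟨⟨U, hU, hxU, hs, h⟩, -⟩ := hb
  filter_upwards [hU.mem_nhds hxU] with x' hx' using (h x' hx').1

theorem thirdExtension_val : (thirdExtension (affineExtension s) ξ).val = affineExtension s ξ :=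
  congrArg (affineExtension s) affineExtension_val

variable [T2Space M]

/-- Allows any smooth representative b of S(ξ), so that 𝕊(ξ) can be computed with whichever germ is
convenient. -/
theorem thirdExtension_eq_jet1 (hs : IsSymmetryJet s) (hb : ContMDiffAt 𝓘(ℝ, E) (I1 E) ∞ b x)
    (hx : b x ∈ (GL1 E M).carrier) (hj : affineExtension s ξ = jet1 (I1 E) b x) :
    thirdExtension (affineExtension s) ξ = jet1 (I2 E) (affineExtension s ∘ b) x := by
  unfold thirdExtension
  rw [hj]
  exact map_jet1 _ _ _ _ _ (hb.mdifferentiableAt (by simp))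
    ((contMDiffAt_affineExtension hs hx).mdifferentiableAt (by simp))

theorem IsLocalBisectionAt.affineExtension_comp (hs : IsSymmetryJet s)
    (hb : IsLocalBisectionAt (E := E) (I1 E) (GL1 E M) b x) :
    IsLocalBisectionAt (E := E) (I2 E) (NH2 E M) (affineExtension s ∘ b) x := by
  obtain ⟨⟨U, hU, hxU, hsm, h⟩, hd⟩ := hb
  have hS := (isAffineExtension_affineExtension hs).morphism
  refine ⟨⟨U, hU, hxU, hS.smooth.comp hsm fun x' hx' => (h x' hx').1,
    fun x' hx' => ⟨hS.mapsTo _ (h x' hx').1, (h x' hx').2⟩⟩, ?_⟩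
  have e : (NH2 E M).tgt ∘ affineExtension s ∘ b = (GL1 E M).tgt ∘ b :=
    funext fun x' => congrArg JetSpace.val affineExtension_val
  rwa [e]

/-- Bisections witnessing S(ξ')·S(ξ) = S(η) are composed with S. As S is multiplicative at every
nearby point, the composites witness the product one order higher. -/
theorem thirdExtension_isMul (hs : IsSymmetryJet s)
    (hξ : ξ ∈ (GL1 E M).carrier) (hξ' : ξ' ∈ (GL1 E M).carrier) (hη : η ∈ (GL1 E M).carrier)
    (h : (GL1 E M).IsMul ξ' ξ η) :
    (NH3 E M).IsMul (thirdExtension (affineExtension s) ξ') (thirdExtension (affineExtension s) ξ)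
      (thirdExtension (affineExtension s) η) := by
  have hS := isAffineExtension_affineExtension hs
  obtain ⟨x, b', b, c, hb, hb', hm, e, e', e''⟩ := hS.morphism.map_mul _ hξ' _ hξ _ hη h
  have ht : (NH2 E M).tgt ((affineExtension s ∘ b) x) = (b x).val :=
    congrArg JetSpace.val affineExtension_val
  have hv : Tendsto (fun x' => (b x').val) (𝓝 x) (𝓝 (b x).val) :=
    (contMDiff_val.contMDiffAt.comp x hb.contMDiffAt).continuousAt
  have hm' : ∀ᶠ x' in 𝓝 x, (b' (b x').val).src = (b x').val ∧ c x' = mulJet (b' (b x').val) (b x') :=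
    hm.mono fun x' h => GL1_isMul_iff.1 h
  have hb'src : ∀ᶠ y in 𝓝 (b x).val, (b' y).src = y := by
    obtain ⟨⟨U, hU, hxU, -, h⟩, -⟩ := hb'
    filter_upwards [hU.mem_nhds hxU] with x' hx' using (h x' hx').2
  have hc : ContMDiffAt 𝓘(ℝ, E) (I1 E) ∞ c x :=
    (contMDiffAt_mulJet hb.contMDiffAt hb'.contMDiffAt hb'src).congr_of_eventuallyEq
      (hm'.mono fun x' h => h.2)
  have hcx : c x = η := by
    rw [← (affineExtension_val (s := s) (ξ := η)), e'']
    rfl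
  refine ⟨x, affineExtension s ∘ b', affineExtension s ∘ b, affineExtension s ∘ c,
    hb.affineExtension_comp hs, ?_, ?_, thirdExtension_eq_jet1 hs hb.contMDiffAt
      hb.eventually_mem.self_of_nhds e, ?_, thirdExtension_eq_jet1 hs hc (hcx ▸ hη) e''⟩
  · rw [ht]
    exact hb'.affineExtension_comp hs
  · filter_upwards [hm', hb.eventually_mem, hv.eventually hb'.eventually_mem] with x' h1 h2 h3
    have ht' : (NH2 E M).tgt ((affineExtension s ∘ b) x') = (b x').val :=
      congrArg JetSpace.val affineExtension_val
    rw [ht', Function.comp_apply, Function.comp_apply, Function.comp_apply, h1.2]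
    exact affineExtension_isMul hs h1.1 h2 h3
  · rw [ht]
    exact thirdExtension_eq_jet1 hs hb'.contMDiffAt hb'.eventually_mem.self_of_nhds e'

theorem pStar₃_thirdExtension (hs : IsSymmetryJet s) (hξ : ξ ∈ (GL1 E M).carrier) :
    pStar₃ (thirdExtension (affineExtension s) ξ) = affineExtension s ξ := by
  obtain ⟨b, hb, hj⟩ := (affineExtension_mem (s := s) hξ).1
  have hm := hb.eventually_mem.self_of_nhds
  have hS := contMDiffAt_affineExtension hs hm
  rw [thirdExtension_eq_jet1 hs hb.contMDiffAt hm hj.symm, pStar₃,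
    map_jet1 _ _ _ _ _ ((hS.comp _ hb.contMDiffAt).mdifferentiableAt (by simp))
      (contMDiff_val.mdifferentiable (by simp) _)]
  have e : JetSpace.val ∘ affineExtension s ∘ b = b := funext fun x' => affineExtension_val
  rw [e, hj]

/-- S takes semi-holonomic values, so p_* ∘ S = p ∘ S = id on 1-jets in `GL1`; thus p_* ∘ S ∘ b
agrees with b near the source. -/
theorem pStarStar_thirdExtension (hs : IsSymmetryJet s) (hξ : ξ ∈ (GL1 E M).carrier) :
    pStarStar (thirdExtension (affineExtension s) ξ) = affineExtension s ξ := by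
  obtain ⟨b, hb, hj⟩ := (affineExtension_mem (s := s) hξ).1
  have hm := hb.eventually_mem.self_of_nhds
  have hS := contMDiffAt_affineExtension hs hm
  have hp : ContMDiffAt (I2 E) (I1 E) ∞ (pStar₂ : J2 E M → J1 E M)
      ((affineExtension s ∘ b) (affineExtension s ξ).src) :=
    contMDiffAt_map contMDiff_val.contMDiffAt
  rw [thirdExtension_eq_jet1 hs hb.contMDiffAt hm hj.symm, pStarStar,
    map_jet1 _ _ _ _ _ ((hS.comp _ hb.contMDiffAt).mdifferentiableAt (by simp))
      (hp.mdifferentiableAt (by simp))]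
  have e : pStar₂ ∘ affineExtension s ∘ b =ᶠ[𝓝 (affineExtension s ξ).src] b := by
    filter_upwards [hb.eventually_mem] with x' h
    exact (affineExtension_mem h).2.symm.trans affineExtension_val
  exact (jet1_congr e).trans hj

theorem thirdExtension_mem (hs : IsSymmetryJet s) (hξ : ξ ∈ (GL1 E M).carrier) :
    thirdExtension (affineExtension s) ξ ∈ SH3 E M := by
  obtain ⟨b, hb, hj⟩ := (affineExtension_mem (s := s) hξ).1
  refine ⟨⟨_, hb.affineExtension_comp hs, (thirdExtension_eq_jet1 hs hb.contMDiffAt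
    hb.eventually_mem.self_of_nhds hj.symm).symm⟩, ?_, ?_, ?_⟩
  · rw [thirdExtension_val, pStar₃_thirdExtension hs hξ]
  · rw [pStar₃_thirdExtension hs hξ, pStarStar_thirdExtension hs hξ]
  · rw [thirdExtension_val]
    exact affineExtension_mem hξ

theorem isLieGroupoidMorphism_thirdExtension (hs : IsSymmetryJet s) :
    IsLieGroupoidMorphism (I1 E) (I3 E) (GL1 E M) (NH3 E M)
      (thirdExtension (affineExtension s)) where
  smooth ξ hξ := by
    have h : ContMDiffAt (I2 E) (I3 E) ∞ (JetSpace.map (I2 E) (affineExtension s))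
        (affineExtension s ξ) := by
      refine contMDiffAt_map ?_
      rw [affineExtension_val]
      exact contMDiffAt_affineExtension hs hξ
    exact (h.comp ξ (contMDiffAt_affineExtension hs hξ)).contMDiffWithinAt
  mapsTo ξ hξ := (thirdExtension_mem hs hξ).1
  src_eq ξ hξ := rfl
  tgt_eq ξ hξ := by
    change (thirdExtension (affineExtension s) ξ).val.val.val = ξ.val
    rw [thirdExtension_val, affineExtension_val]
  map_mul ξ' hξ' ξ hξ η hη h := thirdExtension_isMul hs hξ hξ' hη h

end ThirdExtension

/-! ### Families of bisections and their affine defect -/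

section Families

variable {E : Type*} [NormedAddCommGroup E] [NormedSpace ℝ E]
  {M : Type*} [TopologicalSpace M] [ChartedSpace E M] [IsManifold 𝓘(ℝ, E) ∞ M]

variable {x₀ y₀ x : M} {ζ : J3 E M} {b : M → M → J1 E M} {s : M → J2 E M}

/-- A smooth family `b x'` of local bisections near `x'` with semi-holonomic jets at `x'`. -/
structure IsSemiholonomicFamily (b : M → M → J1 E M) (x : M) : Prop where
  smooth : ContMDiffAt (𝓘(ℝ, E).prod 𝓘(ℝ, E)) (I1 E) ∞ (fun q : M × M => b q.1 q.2) (x, x)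
  semiholonomic : ∀ᶠ x' in 𝓝 x, IsSemiholonomicAt (b x') x'
  diag : ∀ᶠ x' in 𝓝 x, b x' x' = b x x'

theorem IsFamily.isSemiholonomicFamily (h : IsFamily b ζ) : IsSemiholonomicFamily b ζ.src := by
  obtain ⟨U, hU, hζU, hsm, hm⟩ := h.smooth
  refine ⟨hsm.contMDiffAt (hU.mem_nhds hζU), ?_, h.diag⟩
  have hd : ∀ᶠ x' in 𝓝 ζ.src, (x', x') ∈ U :=
    (continuous_id.prodMk continuous_id).continuousAt.eventually (hU.mem_nhds hζU)
  filter_upwards [hd, h.holonomic] with x' hx' hhol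
  have hsm' : ContMDiffAt 𝓘(ℝ, E) (I1 E) ∞ (b x') x' :=
    ContMDiffAt.comp (I' := 𝓘(ℝ, E).prod 𝓘(ℝ, E)) (g := fun q : M × M => b q.1 q.2)
      (f := fun x'' => (x', x'')) x' (hsm.contMDiffAt (hU.mem_nhds hx'))
      (contMDiffAt_const.prodMk contMDiffAt_id)
  have hev : ∀ᶠ x'' in 𝓝 x', (x', x'') ∈ U :=
    (continuous_const.prodMk continuous_id).continuousAt.eventually (hU.mem_nhds hx')
  exact ⟨hsm', hev.mono fun x'' h => (hm _ h).2, (hm _ hx').1, (pStar₂_jet1 hsm').trans hhol⟩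

namespace IsSemiholonomicFamily

theorem self (h : IsSemiholonomicFamily b x) : IsSemiholonomicAt (b x) x :=
  h.semiholonomic.self_of_nhds

theorem contMDiffAt_diag (h : IsSemiholonomicFamily b x) :
    ContMDiffAt 𝓘(ℝ, E) (I1 E) ∞ (fun x' => b x' x') x :=
  ContMDiffAt.comp (I' := 𝓘(ℝ, E).prod 𝓘(ℝ, E)) (g := fun q : M × M => b q.1 q.2)
      (f := fun x' => (x', x')) x h.smooth (contMDiffAt_id.prodMk contMDiffAt_id)

theorem eventually_mem_source (h : IsSemiholonomicFamily b x)
    (hc : b x x ∈ (chart1 E x₀ y₀).source) : ∀ᶠ x' in 𝓝 x, b x' x' ∈ (chart1 E x₀ y₀).source :=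
  h.contMDiffAt_diag.continuousAt.eventually (eventually_mem_extChartAt_source hc)

/-- In charts the linear part at x' is the partial derivative in the second variable evaluated on
the diagonal, hence smooth in x' by joint smoothness of the family. -/
theorem contMDiffAt_jet1 (h : IsSemiholonomicFamily b x) :
    ContMDiffAt 𝓘(ℝ, E) (I2 E) ∞ (fun x' => (jet1 (I1 E) (b x') x' : J2 E M)) x := by
  set y := (b x x).val with hy
  have hc : b x x ∈ (chart1 E x y).source := by
    have h1 := mem_chart1_self (ξ := b x x)
    rwa [h.self.src_eq.self_of_nhds] at h1
  have hx := mem_extChartAt_source (I := 𝓘(ℝ, E)) x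
  have ht := mem_extChartAt_target (I := 𝓘(ℝ, E)) x
  refine contMDiffAt_jet (J := I1 E) (x₀ := x) (g₀ := basePt x y) le_rfl
    (mem_jetChart_source.2 ⟨hx, hc⟩) contMDiffAt_id h.contMDiffAt_diag ?_
  set φ := extChartAt 𝓘(ℝ, E) x with hφ
  have hφs : ContMDiffAt 𝓘(ℝ, E) 𝓘(ℝ, E) ∞ φ.symm (φ x) := contMDiffAt_extChartAt_symm ht
  have hsymm : φ.symm (φ x) = x := φ.left_inv hx
  have hq : ContMDiffAt 𝓘(ℝ, E × E) (𝓘(ℝ, E).prod 𝓘(ℝ, E)) ∞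
      (fun q : E × E => (φ.symm q.1, φ.symm q.2)) (φ x, φ x) :=
    (ContMDiffAt.comp (I' := 𝓘(ℝ, E)) (f := fun q : E × E => q.1) (g := φ.symm) _ hφs
        contDiff_fst.contMDiff.contMDiffAt).prodMk
      (ContMDiffAt.comp (I' := 𝓘(ℝ, E)) (f := fun q : E × E => q.2) (g := φ.symm) _ hφs
        contDiff_snd.contMDiff.contMDiffAt)
  have h1 : ContMDiffAt 𝓘(ℝ, E × E) (I1 E) ∞
      (fun q : E × E => b (φ.symm q.1) (φ.symm q.2)) (φ x, φ x) := by
    refine ContMDiffAt.comp (I' := 𝓘(ℝ, E).prod 𝓘(ℝ, E)) (g := fun q : M × M => b q.1 q.2)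
      (f := fun q : E × E => (φ.symm q.1, φ.symm q.2)) _ ?_ hq
    rw [hsymm]
    exact h.smooth
  have h2 : ContDiffAt ℝ ∞ (Function.uncurry fun v => inCharts 𝓘(ℝ, E) (I1 E) x (basePt x y)
      (b (φ.symm v))) (φ x, φ x) := by
    rw [← contMDiffAt_iff_contDiffAt]
    refine ContMDiffAt.comp (I' := I1 E) (f := fun q : E × E => b (φ.symm q.1) (φ.symm q.2))
      (g := chart1 E x y) _ ?_ h1
    rw [hsymm]
    exact contMDiffAt_extChartAt_of_mem hc
  have h3 : ContDiffAt ℝ ∞ (fun v => fderiv ℝ (inCharts 𝓘(ℝ, E) (I1 E) x (basePt x y)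
      (b (φ.symm v))) v) (φ x) := h2.fderiv contDiffAt_id (by simp)
  have h4 : ContMDiffAt 𝓘(ℝ, E) 𝓘(ℝ, E →L[ℝ] (E × E) × (E →L[ℝ] E)) ∞
      (fun x' => fderiv ℝ (inCharts 𝓘(ℝ, E) (I1 E) x (basePt x y)
      (b (φ.symm (φ x')))) (φ x')) x :=
    ContMDiffAt.comp (I' := 𝓘(ℝ, E)) x h3.contMDiffAt (contMDiffAt_extChartAt_of_mem hx)
  refine h4.congr_of_eventuallyEq ?_
  filter_upwards [h.semiholonomic, h.eventually_mem_source hc,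
    eventually_mem_extChartAt_source hx] with x' g1 g2 g3
  rw [jetLin_jet1 g3 g2 (g1.smooth.mdifferentiableAt (by simp)), φ.left_inv g3]

end IsSemiholonomicFamily

/-- The failure, in charts, of the (1,1)-jets of a family of bisections to be affine. -/
def affDefect (s : M → J2 E M) (b : M → M → J1 E M) (x₀ y₀ x : M) : E →L[ℝ] E →L[ℝ] E :=
  secondPart x₀ y₀ (jet1 (I1 E) (b x) x) - affForm s x₀ y₀ (chart1 E x₀ y₀ (b x x))

namespace IsSemiholonomicFamily

theorem contMDiffAt_affDefect [CompleteSpace E] (hs : IsSymmetryJet s) (h : IsSemiholonomicFamily b x)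
    (hc : b x x ∈ (chart1 E x₀ y₀).source) :
    ContMDiffAt 𝓘(ℝ, E) 𝓘(ℝ, E →L[ℝ] E →L[ℝ] E) ∞ (affDefect s b x₀ y₀) x := by
  have hj : jet1 (I1 E) (b x) x ∈ (jetChart E (I1 E) x₀ (basePt x₀ y₀)).source :=
    mem_jetChart_source.2 ⟨h.self.mem_source hc, hc⟩
  have h1 : ContMDiffAt 𝓘(ℝ, E) 𝓘(ℝ, E →L[ℝ] (E × E) × (E →L[ℝ] E)) ∞
      (fun x' => jetLin x₀ (basePt x₀ y₀) (jet1 (I1 E) (b x') x')) x :=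
    ContMDiffAt.comp (I' := I2 E) (g := jetLin x₀ (basePt x₀ y₀))
      (f := fun x' => (jet1 (I1 E) (b x') x' : J2 E M)) x (contMDiffAt_jetLin hj) h.contMDiffAt_jet1
  have h2 : ContMDiffAt 𝓘(ℝ, E) 𝓘(ℝ, E →L[ℝ] E →L[ℝ] E) ∞
      (fun x' => secondPart x₀ y₀ (jet1 (I1 E) (b x') x')) x := contMDiffAt_const.clm_comp h1
  have h3 : ContMDiffAt 𝓘(ℝ, E) 𝓘(ℝ, (E × E) × (E →L[ℝ] E)) ∞
      (fun x' => chart1 E x₀ y₀ (b x' x')) x :=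
    ContMDiffAt.comp x (contMDiffAt_extChartAt_of_mem hc) h.contMDiffAt_diag
  have h4 : ContMDiffAt 𝓘(ℝ, E) 𝓘(ℝ, E →L[ℝ] E →L[ℝ] E) ∞
      (fun x' => affForm s x₀ y₀ (chart1 E x₀ y₀ (b x' x'))) x :=
    ContMDiffAt.comp x (contDiffAt_affForm hs ((chart1 E x₀ y₀).map_source hc)).contMDiffAt h3
  exact h2.sub h4

theorem hasFDerivAt_affDefect [CompleteSpace E] (hs : IsSymmetryJet s) (h : IsSemiholonomicFamily b x)
    (hc : b x x ∈ (chart1 E x₀ y₀).source) :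
    HasFDerivAt (fun u => affDefect s b x₀ y₀ ((extChartAt 𝓘(ℝ, E) x₀).symm u))
      (fderiv ℝ (fun u => affDefect s b x₀ y₀ ((extChartAt 𝓘(ℝ, E) x₀).symm u))
        (extChartAt 𝓘(ℝ, E) x₀ x)) (extChartAt 𝓘(ℝ, E) x₀ x) := by
  have hx := h.self.mem_source hc
  have h1 : ContMDiffAt 𝓘(ℝ, E) 𝓘(ℝ, E →L[ℝ] E →L[ℝ] E) ∞
      (fun u => affDefect s b x₀ y₀ ((extChartAt 𝓘(ℝ, E) x₀).symm u)) (extChartAt 𝓘(ℝ, E) x₀ x) := by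
    refine ContMDiffAt.comp (I' := 𝓘(ℝ, E)) (g := affDefect s b x₀ y₀)
      (f := (extChartAt 𝓘(ℝ, E) x₀).symm) _ ?_
      (contMDiffAt_extChartAt_symm ((extChartAt 𝓘(ℝ, E) x₀).map_source hx))
    rw [(extChartAt 𝓘(ℝ, E) x₀).left_inv hx]
    exact h.contMDiffAt_affDefect hs hc
  exact (h1.contDiffAt.differentiableAt (by simp)).hasFDerivAt

/-- With U = ∇_Y Z, the inner field at the image of x' is δ(x')(Y,Z) + b_x(x') U in charts. As δ(x)
= 0, differentiating along X yields Dδ(X)(Y,Z) plus the terms for transporting U by b_x; those give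
A ∇_X U exactly, because the (1,1)-part is affine. -/
theorem act_nabla_nabla_eq_iff [FiniteDimensional ℝ E] (hs : IsSymmetryJet s)
    (h : IsSemiholonomicFamily b x)
    (hc : b x x ∈ (chart1 E x₀ y₀).source) (h0 : affDefect s b x₀ y₀ x = 0)
    {X Y Z : VField E M} (hY : Y.Smooth) (hZ : Z.Smooth) :
    act (b x x) (nabla s X (nabla s Y Z)) = cov s (b x x).val (act (b x x) X)
        (fieldAlong (fun x' => (b x x').val) x
          (fun x' => cov s (b x x').val (act (b x x') Y) (transport (b x') x' Z))) ↔
      fderiv ℝ (fun u => affDefect s b x₀ y₀ ((extChartAt 𝓘(ℝ, E) x₀).symm u))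
        (extChartAt 𝓘(ℝ, E) x₀ x) (coordField x₀ X (extChartAt 𝓘(ℝ, E) x₀ x))
        (coordField x₀ Y (extChartAt 𝓘(ℝ, E) x₀ x))
        (coordField x₀ Z (extChartAt 𝓘(ℝ, E) x₀ x)) = 0 := by
  have : CompleteSpace E := FiniteDimensional.complete ℝ E
  have hsh := h.self
  have hx := hsh.mem_source hc
  have hv := (mem_chart1_source.1 hc).2
  have hD := h.hasFDerivAt_affDefect hs hc
  set φ := extChartAt 𝓘(ℝ, E) x₀ with hφ
  set D := fderiv ℝ (fun u => affDefect s b x₀ y₀ (φ.symm u)) (φ x) with hDdef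
  have ht : φ x ∈ φ.target := φ.map_source hx
  set U := coordField x₀ (nabla s Y Z) with hU
  obtain ⟨A, hA⟩ := (jetLin_isInvertible_iff hc).2 hsh.mem
  have hf := hsh.hasStrictFDerivAt_val hc
  rw [← hA] at hf
  have hcv : ContinuousAt (fun x' => (b x x').val) x :=
    (contMDiff_val.continuous.continuousAt).comp hsh.smooth.continuousAt
  have hY' := ((hY.contDiffAt ht).differentiableAt (by simp)).hasFDerivAt
  have hZ' := ((hZ.contDiffAt ht).differentiableAt (by simp)).hasFDerivAt
  have hU' := (differentiableAt_nabla hs hY hZ ht).hasFDerivAt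
  -- Product rule for δ(u)(Y,Z) + b_x(u)U. The derivatives of Y and Z appear multiplied by δ(x) and
  -- will vanish.
  have hW := ((hD.clm_apply hY').clm_apply hZ').add
    ((hsh.hasFDerivAt_inCharts hc).snd.clm_apply hU')
  have hb0 : (inCharts 𝓘(ℝ, E) (I1 E) x₀ (basePt x₀ y₀) (b x) (φ x)).2 = jetLin x₀ y₀ (b x x) := by
    rw [inCharts_apply hx, chart1_apply hc]
  have key := fieldAlong_spec (f := fun x' => (b x x').val)
    (W := fun x' => cov s (b x x').val (act (b x x') Y) (transport (b x') x' Z))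
    hx hv hcv hf ?_ hW
  · obtain ⟨k1, k2⟩ := key
    have hsp : secondPart x₀ y₀ (jet1 (I1 E) (b x) x) = affForm s x₀ y₀ (chart1 E x₀ y₀ (b x x)) :=
      sub_eq_zero.1 h0
    have hself := dchart_cov_transport hs hsh hc hZ (X := Y)
    rw [sub_eq_zero.2 hsp] at hself
    have hw : A.symm (jetLin x₀ y₀ (b x x) (coordField x₀ X (φ x))) = coordField x₀ X (φ x) := by
      rw [← hA]
      exact A.symm_apply_apply _
    have hN : coordField x₀ (nabla s X (nabla s Y Z)) (φ x) = fderiv ℝ U (φ x) (coordField x₀ X (φ x)) +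
        christoffel s x₀ (φ x) (coordField x₀ X (φ x)) (U (φ x)) := by
      rw [coordField_apply hx, coordField_apply hx]
      exact dchart_cov hs hx (X x) (differentiableAt_nabla hs hY hZ ht)
    have hder : fderiv ℝ (coordField y₀ (fieldAlong (fun x' => (b x x').val) x
        (fun x' => cov s (b x x').val (act (b x x') Y) (transport (b x') x' Z))))
        (extChartAt 𝓘(ℝ, E) y₀ (b x x).val) (jetLin x₀ y₀ (b x x) (coordField x₀ X (φ x))) =
        D (coordField x₀ X (φ x)) (coordField x₀ Y (φ x)) (coordField x₀ Z (φ x)) +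
          (affForm s x₀ y₀ (chart1 E x₀ y₀ (b x x)) (coordField x₀ X (φ x)) (U (φ x)) +
          jetLin x₀ y₀ (b x x) (fderiv ℝ U (φ x) (coordField x₀ X (φ x)))) := by
      rw [k1.fderiv, ← hsp, ← hb0]
      rw [← hb0] at hw
      simp only [ContinuousLinearMap.comp_apply, ContinuousLinearEquiv.coe_coe, hw, add_apply,
        ContinuousLinearMap.flip_apply, φ.left_inv hx, h0, zero_apply, zero_add]
      exact congrArg _ (add_comm _ _)
    have hval : dchart 𝓘(ℝ, E) y₀ (b x x).val (cov s (b x x).val (act (b x x) Y)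
        (transport (b x) x Z)) = jetLin x₀ y₀ (b x x) (U (φ x)) := by
      rw [hself]
      exact zero_add _
    have hact : ∀ X : VField E M, dchart 𝓘(ℝ, E) y₀ (b x x).val (act (b x x) X) =
        jetLin x₀ y₀ (b x x) (coordField x₀ X (φ x)) := by
      intro X
      rw [dchart_act hc, hsh.src_eq.self_of_nhds]
    rw [← (dchart_isInvertible' hv).injective.eq_iff, dchart_cov hs hv _ k1.differentiableAt, hact,
      hact, coordField_apply hv, k2, hval, hder, hN, affForm_apply, chart1_apply hc,
      hsh.src_eq.self_of_nhds, map_add, ← sub_eq_zero, ← neg_eq_zero]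
    refine Eq.congr ?_ rfl
    dsimp only
    abel
  -- The second order formula for b_{x'} at x' involves b_{x'}(x'); the normalization on the
  -- diagonal replaces it by b_x(x').
  · filter_upwards [h.semiholonomic, h.diag, h.eventually_mem_source hc,
      eventually_mem_extChartAt_source hx] with x' g1 g2 g3 g4
    have e := dchart_cov_transport hs g1 g3 hZ (X := Y)
    have g3' := g3
    rw [g2] at g3'
    change affDefect s b x₀ y₀ (φ.symm (φ x')) (coordField x₀ Y (φ x')) (coordField x₀ Z (φ x')) +
      (inCharts 𝓘(ℝ, E) (I1 E) x₀ (basePt x₀ y₀) (b x) (φ x')).2 (U (φ x')) = _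
    rw [φ.left_inv g4, inCharts_apply g4, chart1_apply g3', ← g2]
    exact e.symm

end IsSemiholonomicFamily

end Families

/-! ### Uniqueness of affine (1,1,1)-jets -/

section AffineThirdJets

variable {E : Type*} [NormedAddCommGroup E] [NormedSpace ℝ E] [FiniteDimensional ℝ E]
  {M : Type*} [TopologicalSpace M] [T2Space M] [ChartedSpace E M] [IsManifold 𝓘(ℝ, E) ∞ M]

variable {x₀ y₀ x : M} {ξ : J1 E M} {ζ : J3 E M} {b : M → M → J1 E M} {s : M → J2 E M}

theorem IsSemiholonomicFamily.affDefect_eq_zero_iff (hs : IsSymmetryJet s)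
    (h : IsSemiholonomicFamily b x) (hc : b x x ∈ (chart1 E x₀ y₀).source) :
    affDefect s b x₀ y₀ x = 0 ↔ jet1 (I1 E) (b x) x = affineExtension s (b x x) := by
  have : CompleteSpace E := FiniteDimensional.complete ℝ E
  constructor
  · intro h0
    exact eq_affineExtension hs h.self.jet1_mem rfl hc (sub_eq_zero.1 h0)
  · intro hj
    unfold affDefect
    rw [hj, secondPart_affineExtension hs h.self.mem hc, sub_self]

set_option synthInstance.maxHeartbeats 200000 in
theorem fderiv_eq_of_eventuallyEq_add {F : Type*} [NormedAddCommGroup F] [NormedSpace ℝ F]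
    {f g : E → F} {d : E → E →L[ℝ] E →L[ℝ] E} {u : E} (L : (E →L[ℝ] E →L[ℝ] E) →L[ℝ] F)
    (h : f =ᶠ[𝓝 u] fun u => g u + L (d u)) (hg : DifferentiableAt ℝ g u)
    (hd : HasFDerivAt d (0 : E →L[ℝ] E →L[ℝ] E →L[ℝ] E) u) : fderiv ℝ f u = fderiv ℝ g u := by
  rw [h.fderiv_eq]
  refine (hg.hasFDerivAt.add (L.hasFDerivAt.comp u hd)).fderiv.trans ?_
  rw [ContinuousLinearMap.comp_zero, add_zero]

/-- Both sides are jets of curves of (1,1)-jets over the same 1-jets b_{x'}(x'), and in charts these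
curves differ only by δ in the second part. They agree to first order at x once δ and its derivative
vanish there. -/
theorem IsSemiholonomicFamily.jet1_eq_thirdExtension (hs : IsSymmetryJet s)
    (h : IsSemiholonomicFamily b x) (hc : b x x ∈ (chart1 E x₀ y₀).source)
    (h0 : affDefect s b x₀ y₀ x = 0)
    (hD : fderiv ℝ (fun u => affDefect s b x₀ y₀ ((extChartAt 𝓘(ℝ, E) x₀).symm u))
      (extChartAt 𝓘(ℝ, E) x₀ x) = 0) :
    jet1 (I2 E) (fun x' => (jet1 (I1 E) (b x') x' : J2 E M)) x =
      thirdExtension (affineExtension s) (b x x) := by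
  have : CompleteSpace E := FiniteDimensional.complete ℝ E
  have hx := h.self.mem_source hc
  have hj := (h.affDefect_eq_zero_iff hs hc).1 h0
  have hd : affineExtension s ∘ b x =ᶠ[𝓝 x] fun x' => affineExtension s (b x' x') :=
    h.diag.mono fun x' h' => congrArg (affineExtension s) h'.symm
  rw [thirdExtension_eq_jet1 hs h.self.smooth h.self.mem hj.symm, jet1_congr hd]
  have hS : ContMDiffAt 𝓘(ℝ, E) (I2 E) ∞ (fun x' => affineExtension s (b x' x')) x :=
    ContMDiffAt.comp (I' := I1 E) (g := affineExtension s) (f := fun x' => b x' x') x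
      (contMDiffAt_affineExtension hs h.self.mem) h.contMDiffAt_diag
  set e₀ : J2 E M := JetSpace.mk x₀ (basePt x₀ y₀) 0 with he₀
  have hmem : jet1 (I1 E) (b x) x ∈ (extChartAt (I2 E) e₀).source :=
    mem_jetChart_source.2 ⟨hx, hc⟩
  have hmem' : affineExtension s (b x x) ∈ (extChartAt (I2 E) e₀).source := hj ▸ hmem
  refine jet_ext (J := I2 E) (x₀ := x₀) (g₀ := e₀) (mem_jetChart_source.2 ⟨hx, hmem⟩) rfl hj ?_
  rw [jetLin_jet1 (b := fun x' => (jet1 (I1 E) (b x') x' : J2 E M)) hx hmem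
        (h.contMDiffAt_jet1.mdifferentiableAt (by simp)),
    jetLin_jet1 (b := fun x' => affineExtension s (b x' x')) hx hmem' (hS.mdifferentiableAt (by simp))]
  -- The inclusion of the second part into the chart coordinates of `J2`, with zeros in all other
  -- slots.
  let L : (E →L[ℝ] E →L[ℝ] E) →L[ℝ] (E × (E × E) × (E →L[ℝ] E)) × (E →L[ℝ] (E × E) × (E →L[ℝ] E)) :=
    ContinuousLinearMap.inr ℝ (E × (E × E) × (E →L[ℝ] E)) (E →L[ℝ] (E × E) × (E →L[ℝ] E)) ∘L
      ContinuousLinearMap.compL ℝ E (E →L[ℝ] E) ((E × E) × (E →L[ℝ] E))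
        (ContinuousLinearMap.inr ℝ (E × E) (E →L[ℝ] E))
  have hev : inCharts 𝓘(ℝ, E) (I2 E) x₀ e₀ (fun x' => (jet1 (I1 E) (b x') x' : J2 E M))
      =ᶠ[𝓝 (extChartAt 𝓘(ℝ, E) x₀ x)] fun u =>
        inCharts 𝓘(ℝ, E) (I2 E) x₀ e₀ (fun x' => affineExtension s (b x' x')) u +
        L (affDefect s b x₀ y₀ ((extChartAt 𝓘(ℝ, E) x₀).symm u)) := by
    refine eventually_extChartAt_symm (p := fun x' => extChartAt (I2 E) e₀ (jet1 (I1 E) (b x') x') =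
      extChartAt (I2 E) e₀ (affineExtension s (b x' x')) + L (affDefect s b x₀ y₀ x')) hx ?_
    filter_upwards [h.semiholonomic, h.eventually_mem_source hc] with x' g1 g2
    have k1 : jet1 (I1 E) (b x') x' ∈ (jetChart E (I1 E) x₀ (basePt x₀ y₀)).source :=
      mem_jetChart_source.2 ⟨g1.mem_source g2, g2⟩
    have hv : (affineExtension s (b x' x')).val ∈ (chart1 E x₀ y₀).source := by
      rwa [affineExtension_val]
    have k2 : affineExtension s (b x' x') ∈ (jetChart E (I1 E) x₀ (basePt x₀ y₀)).source :=
      mem_chart2_source (affineExtension_mem g1.mem) hv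
    have e1 : extChartAt (I2 E) e₀ (jet1 (I1 E) (b x') x') = _ := jetChart_apply k1
    have e2 : extChartAt (I2 E) e₀ (affineExtension s (b x' x')) = _ := jetChart_apply k2
    rw [e1, e2, g1.jetLin_eq g2, jetLin_affineExtension hs g1.mem g2, affineExtension_val,
      affineExtension_src, g1.src_eq.self_of_nhds]
    refine Prod.ext ?_ ?_
    · exact (add_zero _).symm
    · ext1 w
      refine Prod.ext (add_zero _).symm ?_
      exact (add_sub_cancel _ _).symm
  have hd' := h.hasFDerivAt_affDefect hs hc
  rw [hD] at hd'
  exact fderiv_eq_of_eventuallyEq_add L hev ((contDiffAt_inCharts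
    (f := fun x' => affineExtension s (b x' x')) hx hmem' hS).differentiableAt (by simp)) hd'

theorem IsSemiholonomicFamily.forall_act_nabla_nabla_eq_iff (hs : IsSymmetryJet s)
    (h : IsSemiholonomicFamily b x) (hc : b x x ∈ (chart1 E x₀ y₀).source)
    (h0 : affDefect s b x₀ y₀ x = 0) :
    (∀ X Y Z : VField E M, X.Smooth → Y.Smooth → Z.Smooth →
      act (b x x) (nabla s X (nabla s Y Z)) = cov s (b x x).val (act (b x x) X)
        (fieldAlong (fun x' => (b x x').val) x
          (fun x' => cov s (b x x').val (act (b x x') Y) (transport (b x') x' Z)))) ↔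
      fderiv ℝ (fun u => affDefect s b x₀ y₀ ((extChartAt 𝓘(ℝ, E) x₀).symm u))
        (extChartAt 𝓘(ℝ, E) x₀ x) = 0 := by
  have hx := h.self.mem_source hc
  constructor
  · intro hid
    ext w w' w''
    obtain ⟨X, hX, rfl⟩ := exists_coordField_eq hx w
    obtain ⟨Y, hY, rfl⟩ := exists_coordField_eq hx w'
    obtain ⟨Z, hZ, rfl⟩ := exists_coordField_eq hx w''
    exact (h.act_nabla_nabla_eq_iff hs hc h0 hY hZ).1 (hid X Y Z hX hY hZ)
  · intro hD X Y Z hX hY hZ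
    rw [h.act_nabla_nabla_eq_iff hs hc h0 hY hZ, hD]
    rfl

/-- Over an affine (1,1)-jet, the affine identity for (1,1,1)-jets characterises `thirdExtension`. -/
theorem IsSemiholonomicFamily.eq_thirdExtension_of_forall (hs : IsSymmetryJet s)
    (h : IsSemiholonomicFamily b x) (hj : jet1 (I1 E) (b x) x = affineExtension s (b x x))
    (hid : ∀ X Y Z : VField E M, X.Smooth → Y.Smooth → Z.Smooth →
      act (b x x) (nabla s X (nabla s Y Z)) = cov s (b x x).val (act (b x x) X)
        (fieldAlong (fun x' => (b x x').val) x
          (fun x' => cov s (b x x').val (act (b x x') Y) (transport (b x') x' Z)))) :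
    jet1 (I2 E) (fun x' => (jet1 (I1 E) (b x') x' : J2 E M)) x =
      thirdExtension (affineExtension s) (b x x) := by
  have hc := mem_chart1_self (ξ := b x x)
  have h0 := (h.affDefect_eq_zero_iff hs hc).2 hj
  exact h.jet1_eq_thirdExtension hs hc h0 ((h.forall_act_nabla_nabla_eq_iff hs hc h0).1 hid)

theorem eq_thirdExtension_of_isAffine₃ (hs : IsSymmetryJet s) (h : IsAffine₃ s ζ) :
    ζ = thirdExtension (affineExtension s) ζ.val.val := by
  obtain ⟨-, h2, b, hb, hid⟩ := h
  have hj := hb.jet_eq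
  have hf := hb.isSemiholonomicFamily
  clear hb
  -- The source is again generalized to x so that ζ can be replaced by the jet of the family.
  have key : ∀ (x : M) (ζ : J3 E M), IsSemiholonomicFamily b x →
      jet1 (I2 E) (fun x' => (jet1 (I1 E) (b x') x' : J2 E M)) x = ζ → IsAffine₂ s ζ.val →
      (∀ X Y Z : VField E M, X.Smooth → Y.Smooth → Z.Smooth →
      act ζ.val.val (nabla s X (nabla s Y Z)) =
        cov s ζ.val.val.val (act ζ.val.val X)
          (fieldAlong (fun x' => (b x x').val) x
            (fun x' => cov s (b x x').val (act (b x x') Y) (transport (b x') x' Z)))) →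
      ζ = thirdExtension (affineExtension s) ζ.val.val := by
    rintro x ζ hf rfl h2 hid
    exact hf.eq_thirdExtension_of_forall hs (eq_affineExtension_of_isAffine₂ hs h2) hid
  exact key _ _ hf hj h2 hid

end AffineThirdJets

/-! ### Existence: a family with vanishing defect -/

section AffineFamily

variable {E : Type*} [NormedAddCommGroup E] [NormedSpace ℝ E] [FiniteDimensional ℝ E]
  {M : Type*} [TopologicalSpace M] [ChartedSpace E M] [IsManifold 𝓘(ℝ, E) ∞ M]

variable {x₀ y₀ x : M} {ξ : J1 E M} {ζ : J3 E M} {b : M → M → J1 E M} {s : M → J2 E M}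

/-- A local section whose jet at the source of `ξ` is the affine extension of `ξ`, in charts. -/
def affineSection (s : M → J2 E M) (x₀ y₀ : M) (ξ : J1 E M) : M → J1 E M :=
  affSection x₀ y₀ (chart1 E x₀ y₀ ξ) (affForm s x₀ y₀ (chart1 E x₀ y₀ ξ))

/-- The domain of `affineSection`. -/
def affineDomain (s : M → J2 E M) (x₀ y₀ : M) (ξ : J1 E M) : Set M :=
  affDomain x₀ y₀ (chart1 E x₀ y₀ ξ) (affForm s x₀ y₀ (chart1 E x₀ y₀ ξ))

/-- The family of bisections with affine jets along an affine section. -/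
def affineFamily (s : M → J2 E M) (ξ : J1 E M) (x' : M) : M → J1 E M :=
  affineSection s ξ.src ξ.val (affineSection s ξ.src ξ.val ξ x')

theorem affineSection_self (hc : ξ ∈ (chart1 E x₀ y₀).source) :
    affineSection s x₀ y₀ ξ ξ.src = ξ := affSection_chart1 hc

theorem affineSection_src (hx : x ∈ affineDomain s x₀ y₀ ξ) :
    (affineSection s x₀ y₀ ξ x).src = x := affSection_src hx

theorem affineSection_mem_source (hx : x ∈ affineDomain s x₀ y₀ ξ) :
    affineSection s x₀ y₀ ξ x ∈ (chart1 E x₀ y₀).source := affSection_mem_source hx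

theorem affineSection_mem (hx : x ∈ affineDomain s x₀ y₀ ξ) :
    affineSection s x₀ y₀ ξ x ∈ (GL1 E M).carrier := affSection_mem hx

theorem affineFamily_src : affineFamily s ξ ξ.src = affineSection s ξ.src ξ.val ξ := by
  unfold affineFamily
  rw [affineSection_self mem_chart1_self]

theorem affineFamily_self (hx : x ∈ affineDomain s ξ.src ξ.val ξ) :
    affineFamily s ξ x x = affineSection s ξ.src ξ.val ξ x := by
  have h := affineSection_self (s := s) (affineSection_mem_source hx)
  rw [affineSection_src hx] at h
  exact h

theorem isOpen_affineDomain : IsOpen (affineDomain s x₀ y₀ ξ) :=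
  have : CompleteSpace E := FiniteDimensional.complete ℝ E
  isOpen_affDomain

theorem self_mem_affineDomain (hξ : ξ ∈ (GL1 E M).carrier) (hc : ξ ∈ (chart1 E x₀ y₀).source) :
    ξ.src ∈ affineDomain s x₀ y₀ ξ :=
  have : CompleteSpace E := FiniteDimensional.complete ℝ E
  mem_affDomain hξ hc

/-- In charts the family is an affine path whose base point and bilinear coefficient depend smoothly
on x'. The domain requires the path to have its target in the chart and an invertible linear part,
both open conditions. -/
theorem contMDiffOn_affineFamily (hs : IsSymmetryJet s) (hξ : ξ ∈ (GL1 E M).carrier) :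
    ∃ U : Set (M × M), IsOpen U ∧ (ξ.src, ξ.src) ∈ U ∧
      ContMDiffOn (𝓘(ℝ, E).prod 𝓘(ℝ, E)) (I1 E) ∞ (fun q : M × M => affineFamily s ξ q.1 q.2) U ∧
      ∀ q ∈ U, affineFamily s ξ q.1 q.2 ∈ (GL1 E M).carrier ∧ (affineFamily s ξ q.1 q.2).src = q.2 := by
  have : CompleteSpace E := FiniteDimensional.complete ℝ E
  set x₀ := ξ.src with hx₀
  set y₀ := ξ.val with hy₀
  have hc : ξ ∈ (chart1 E x₀ y₀).source := mem_chart1_self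
  have hself : x₀ ∈ affineDomain s x₀ y₀ ξ := self_mem_affineDomain hξ hc
  let D : Set (M × M) := affineDomain s x₀ y₀ ξ ×ˢ (extChartAt 𝓘(ℝ, E) x₀).source
  let P : M → (E × E) × (E →L[ℝ] E) := fun x' => chart1 E x₀ y₀ (affineSection s x₀ y₀ ξ x')
  let Θ : M × M → (E × E) × (E →L[ℝ] E) := fun q =>
    affPath (P q.1) (affForm s x₀ y₀ (P q.1)) (extChartAt 𝓘(ℝ, E) x₀ q.2)
  let O : Set ((E × E) × (E →L[ℝ] E)) := {r | r.1.2 ∈ (extChartAt 𝓘(ℝ, E) y₀).target ∧ r.2.IsInvertible}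
  have hO : IsOpen O := ((isOpen_extChartAt_target y₀).preimage
    (continuous_snd.comp continuous_fst)).inter (isOpen_isInvertible.preimage continuous_snd)
  have hD : IsOpen D := isOpen_affineDomain.prod (isOpen_extChartAt_source x₀)
  have hΘ : ∀ q ∈ D, ContMDiffAt (𝓘(ℝ, E).prod 𝓘(ℝ, E)) 𝓘(ℝ, (E × E) × (E →L[ℝ] E)) ∞ Θ q := by
    rintro ⟨x', x''⟩ ⟨h1, h2⟩
    have hm : affineSection s x₀ y₀ ξ x' ∈ (chart1 E x₀ y₀).source := affSection_mem_source h1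
    have k1 : ContMDiffAt 𝓘(ℝ, E) 𝓘(ℝ, (E × E) × (E →L[ℝ] E)) ∞ P x' :=
      ContMDiffAt.comp (I' := I1 E) (g := chart1 E x₀ y₀) (f := affineSection s x₀ y₀ ξ) x'
        (contMDiffAt_extChartAt_of_mem hm) (contMDiffAt_affSection h1)
    have k2 : ContMDiffAt (𝓘(ℝ, E).prod 𝓘(ℝ, E)) 𝓘(ℝ, (E × E) × (E →L[ℝ] E)) ∞
        (fun q : M × M => P q.1) (x', x'') :=
      ContMDiffAt.comp (I' := 𝓘(ℝ, E)) (g := P) (f := Prod.fst) (x', x'') k1 contMDiffAt_fst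
    have k3 : ContMDiffAt (𝓘(ℝ, E).prod 𝓘(ℝ, E)) 𝓘(ℝ, E →L[ℝ] E →L[ℝ] E) ∞
        (fun q : M × M => affForm s x₀ y₀ (P q.1)) (x', x'') :=
      ContMDiffAt.comp (I' := 𝓘(ℝ, (E × E) × (E →L[ℝ] E))) (g := affForm s x₀ y₀)
        (f := fun q : M × M => P q.1) (x', x'')
        (contDiffAt_affForm hs ((chart1 E x₀ y₀).map_source hm)).contMDiffAt k2
    have k4 : ContMDiffAt (𝓘(ℝ, E).prod 𝓘(ℝ, E)) 𝓘(ℝ, E) ∞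
        (fun q : M × M => extChartAt 𝓘(ℝ, E) x₀ q.2) (x', x'') :=
      ContMDiffAt.comp (I' := 𝓘(ℝ, E)) (g := extChartAt 𝓘(ℝ, E) x₀) (f := Prod.snd) (x', x'')
        (contMDiffAt_extChartAt_of_mem h2) contMDiffAt_snd
    exact ContMDiffAt.comp (I' := 𝓘(ℝ, ((E × E) × (E →L[ℝ] E)) × (E →L[ℝ] E →L[ℝ] E) × E))
      (g := fun q : ((E × E) × (E →L[ℝ] E)) × (E →L[ℝ] E →L[ℝ] E) × E => affPath q.1 q.2.1 q.2.2)
      (f := fun q : M × M => (P q.1, affForm s x₀ y₀ (P q.1), extChartAt 𝓘(ℝ, E) x₀ q.2)) (x', x'')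
      contDiff_affPath.contMDiff.contMDiffAt (k2.prodMk_space (k3.prodMk_space k4))
  have hdom : ∀ q ∈ D ∩ Θ ⁻¹' O, q.2 ∈ affineDomain s x₀ y₀ (affineSection s x₀ y₀ ξ q.1) :=
    fun q hq => ⟨hq.1.2, hq.2.1, hq.2.2⟩
  refine ⟨D ∩ Θ ⁻¹' O, ContinuousOn.isOpen_inter_preimage
    (fun q hq => (hΘ q hq).continuousAt.continuousWithinAt) hD hO, ?_, ?_, ?_⟩
  · refine ⟨⟨hself, hself.1⟩, ?_⟩
    have h1 : affineSection s x₀ y₀ ξ x₀ = ξ := affineSection_self hc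
    have h2 : (x₀ : M) ∈ affineDomain s x₀ y₀ (affineSection s x₀ y₀ ξ x₀) := by rwa [h1]
    exact h2.2
  · intro q hq
    exact (ContMDiffAt.comp (I' := 𝓘(ℝ, (E × E) × (E →L[ℝ] E))) (g := (chart1 E x₀ y₀).symm) (f := Θ) q
      (contMDiffAt_extChartAt_symm (affPath_mem_target (hdom q hq))) (hΘ q hq.1)).contMDiffWithinAt
  · exact fun q hq => ⟨affSection_mem (hdom q hq), affSection_src (hdom q hq)⟩

variable [T2Space M]

theorem jet1_affineSection (hs : IsSymmetryJet s) (hξ : ξ ∈ (GL1 E M).carrier)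
    (hc : ξ ∈ (chart1 E x₀ y₀).source) :
    jet1 (I1 E) (affineSection s x₀ y₀ ξ) ξ.src = affineExtension s ξ :=
  have : CompleteSpace E := FiniteDimensional.complete ℝ E
  eq_affineExtension hs (ofSecondPart_mem hξ hc) (ofSecondPart_val hc) hc
    (secondPart_ofSecondPart hξ hc)

/-- The member at x is built from the 1-jet on the base section at x with its own affine form. Its
jet is thus affine throughout the domain, not just at the source of ξ. -/
theorem jet1_affineFamily (hs : IsSymmetryJet s) (hx : x ∈ affineDomain s ξ.src ξ.val ξ) :
    jet1 (I1 E) (affineFamily s ξ x) x = affineExtension s (affineSection s ξ.src ξ.val ξ x) := by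
  have h := jet1_affineSection hs (affineSection_mem hx) (affineSection_mem_source hx)
  rw [affineSection_src hx] at h
  exact h

theorem isFamily_affineFamily (hs : IsSymmetryJet s) (hξ : ξ ∈ (GL1 E M).carrier) :
    IsFamily (affineFamily s ξ) (thirdExtension (affineExtension s) ξ) where
  smooth := contMDiffOn_affineFamily hs hξ
  jet_eq := by
    have : CompleteSpace E := FiniteDimensional.complete ℝ E
    have hself : ξ.src ∈ affineDomain s ξ.src ξ.val ξ := self_mem_affineDomain hξ mem_chart1_self
    have h1 : (fun x' => (jet1 (I1 E) (affineFamily s ξ x') x' : J2 E M)) =ᶠ[𝓝 ξ.src]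
        affineExtension s ∘ affineSection s ξ.src ξ.val ξ := by
      filter_upwards [isOpen_affineDomain.mem_nhds hself] with x hx using jet1_affineFamily hs hx
    exact (jet1_congr h1).trans
      (thirdExtension_eq_jet1 hs (contMDiffAt_affSection hself) (affSection_mem hself) rfl).symm
  diag := by
    have hself : ξ.src ∈ affineDomain s ξ.src ξ.val ξ := self_mem_affineDomain hξ mem_chart1_self
    filter_upwards [isOpen_affineDomain.mem_nhds hself] with x hx
    exact (affineFamily_self hx).trans (congrFun affineFamily_src x).symm
  holonomic := by
    have : CompleteSpace E := FiniteDimensional.complete ℝ E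
    have hself : ξ.src ∈ affineDomain s ξ.src ξ.val ξ := self_mem_affineDomain hξ mem_chart1_self
    filter_upwards [isOpen_affineDomain.mem_nhds hself] with x hx
    have hm : x ∈ affineDomain s ξ.src ξ.val (affineSection s ξ.src ξ.val ξ x) := by
      have h := self_mem_affineDomain (s := s) (affineSection_mem hx) (affineSection_mem_source hx)
      rw [affineSection_src hx] at h
      exact h
    have hsm : ContMDiffAt 𝓘(ℝ, E) (I1 E) ∞ (affineFamily s ξ x) x := contMDiffAt_affSection hm
    rw [← pStar₂_jet1 hsm, jet1_affineFamily hs hx, affineFamily_self hx,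
      ← (affineExtension_mem (affineSection_mem hx)).2]
    exact affineExtension_val

theorem isAffine₃_thirdExtension (hs : IsSymmetryJet s) (hξ : ξ ∈ (GL1 E M).carrier) :
    IsAffine₃ s (thirdExtension (affineExtension s) ξ) := by
  have hfam := isFamily_affineFamily hs hξ
  refine ⟨thirdExtension_mem hs hξ, ?_, affineFamily s ξ, hfam, ?_⟩
  · rw [thirdExtension_val]
    exact isAffine₂_affineExtension hs hξ
  have h : IsSemiholonomicFamily (affineFamily s ξ) ξ.src := hfam.isSemiholonomicFamily
  have hself : ξ.src ∈ affineDomain s ξ.src ξ.val ξ := self_mem_affineDomain hξ mem_chart1_self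
  have hb : affineFamily s ξ ξ.src ξ.src = ξ :=
    (affineFamily_self hself).trans (affineSection_self mem_chart1_self)
  have hc : affineFamily s ξ ξ.src ξ.src ∈ (chart1 E ξ.src ξ.val).source := by
    rw [hb]
    exact mem_chart1_self
  have h0 : ∀ x ∈ affineDomain s ξ.src ξ.val ξ,
      affDefect s (affineFamily s ξ) ξ.src ξ.val x = 0 := by
    intro x hx
    unfold affDefect
    rw [jet1_affineFamily hs hx, affineFamily_self hx,
      secondPart_affineExtension hs (affineSection_mem hx) (affineSection_mem_source hx)]
    exact sub_self _
  -- The defect vanishes on a whole neighbourhood, so its derivative does too, which is the third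
  -- order identity.
  have hD : fderiv ℝ (fun u => affDefect s (affineFamily s ξ) ξ.src ξ.val
      ((extChartAt 𝓘(ℝ, E) ξ.src).symm u)) (extChartAt 𝓘(ℝ, E) ξ.src ξ.src) = 0 := by
    have hev : (fun u => affDefect s (affineFamily s ξ) ξ.src ξ.val
        ((extChartAt 𝓘(ℝ, E) ξ.src).symm u)) =ᶠ[𝓝 (extChartAt 𝓘(ℝ, E) ξ.src ξ.src)] fun _ => 0 :=
      eventually_extChartAt_symm (p := fun x => affDefect s (affineFamily s ξ) ξ.src ξ.val x = 0)
        (mem_extChartAt_source _)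
        (by filter_upwards [isOpen_affineDomain.mem_nhds hself] with x hx using h0 x hx)
    rw [hev.fderiv_eq, fderiv_fun_const]
    rfl
  have hid := (h.forall_act_nabla_nabla_eq_iff hs hc (h0 _ hself)).2 hD
  have hv : (thirdExtension (affineExtension s) ξ).val.val = affineFamily s ξ ξ.src ξ.src := by
    rw [thirdExtension_val, affineExtension_val, hb]
  rw [hv]
  exact hid

end AffineFamily

end AffineJets

end

theorem proposition6p4 {E : Type*} [NormedAddCommGroup E] [NormedSpace ℝ E] [FiniteDimensional ℝ E]
    {M : Type*} [TopologicalSpace M] [T2Space M] [ChartedSpace E M] [IsManifold 𝓘(ℝ, E) ∞ M]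
    (s : M → J2 E M) (hs : IsSymmetryJet s) :
    ∃ S : J1 E M → J2 E M,
      IsAffineExtension s S ∧
      (∀ S' : J1 E M → J2 E M, IsAffineExtension s S' → EqOn S' S (GL1 E M).carrier) ∧
      IsLieGroupoidMorphism (I1 E) (I3 E) (GL1 E M) (NH3 E M) (thirdExtension S) ∧
      ∀ ξ ∈ (GL1 E M).carrier,
        thirdExtension S ξ ∈ SH3 E M ∧
        (thirdExtension S ξ).val = S ξ ∧
        IsAffine₃ s (thirdExtension S ξ) ∧
        ∀ ζ : J3 E M, IsAffine₃ s ζ → ζ.val.val = ξ → ζ = thirdExtension S ξ := by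
  have hS := isAffineExtension_affineExtension hs
  exact ⟨affineExtension s, hS, fun S' hS' => hS'.eqOn hs,
    isLieGroupoidMorphism_thirdExtension hs, fun ξ hξ => ⟨thirdExtension_mem hs hξ,
    thirdExtension_val, isAffine₃_thirdExtension hs hξ, fun ζ hζ h =>
    h ▸ eq_thirdExtension_of_isAffine₃ hs hζ⟩⟩
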